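/- **Theorem.** All graphs are finite and simple. A graph is *chordal* if it has no induced cycle of length at least $4$. For a graph $G$ and a set $A\subseteq\binom{V(G)}{2}$, $G+A$ denotes the graph obtained from $G$ by adding all pairs of $A$ as edges. For an integer $k\ge 0$, $\textsc{Chordal}-ke$ is the class of all graphs $G$ for which there is a set $A\subseteq\binom{V(G)}{2}\setminus E(G)$ with $|A|\le k$ such that $G+A$ is chordal. *Coloring* is the problem of deciding, for a graph $G$ and an integer $\ell\ge 1$ (both part of the input), whether $\chi(G)\le \ell$, that is, whether $G$ has a proper coloring with $\ell$ colors. (1) *Coloring* can be solved in time $2^{O(k\log k)}\cdot n^{O(1)}$ on $\textsc{Chordal}-ke$, where $n=|V(G)|$. Precisely: there are one program for the random access machine (unit cost for assignments, additions, truncated subtractions, indirect loads and stores, jumps and zero tests; no multiplication) and a constant $c$ such that, for all $k\ge 0$, all $G\in\textsc{Chordal}-ke$ with $V(G)=\{0,\dots,n-1\}$ and all $\ell\ge 1$, the program, given $n$, $\ell$ and the adjacency matrix of $G$, decides correctly whether $\chi(G)\le\ell$ within $c\cdot 2^{c\,k\log_2 k}\cdot (n+1)^{c}$ steps, where $k\log_2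 k$ is read as $0$ for $k=0$. (2) Moreover, if $G$ is a graph and $A\subseteq\binom{V(G)}{2}$ is a set with $|A|\le k$ such that $G+A$ is chordal, then every clique $C$ of $G+A$ has at most $(2k)^{2k}$ partitions into nonempty independent sets of $G$ (with $0^0=1$). -/

import Mathlib

/-- A graph is chordal if it has no induced cycle of length at least four. -/
def SimpleGraph.IsChordal {V : Type*} (G : SimpleGraph V) : Prop :=
  ∀ m : ℕ, 4 ≤ m → ¬ (SimpleGraph.cycleGraph m).IsIndContained G

/-- The graph `G + A`, obtained from `G` by adding all pairs of `A` as edges. -/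
def SimpleGraph.addPairs {V : Type*} (G : SimpleGraph V) (A : Finset (Sym2 V)) : SimpleGraph V :=
  G ⊔ SimpleGraph.fromEdgeSet (A : Set (Sym2 V))

/-- The class `Chordal - ke`: graphs that become chordal after the addition of a set `A` of at most
`k` non-edges (pairs of distinct nonadjacent vertices). -/
def SimpleGraph.InChordalMinus {V : Type*} (G : SimpleGraph V) (k : ℕ) : Prop :=
  ∃ A : Finset (Sym2 V), (∀ e ∈ A, ¬ e.IsDiag ∧ e ∉ G.edgeSet) ∧ A.card ≤ k ∧
    (G.addPairs A).IsChordal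

/-- Partitions of a finite vertex set `C` into nonempty independent sets of `G`. -/
def SimpleGraph.indepPartitions {V : Type*} [DecidableEq V] (G : SimpleGraph V) (C : Finset V) :
    Set (Finpartition C) :=
  {P | ∀ X ∈ P.parts, G.IsIndepSet (X : Set V)}

namespace Ram

/-- Instructions of a random access machine with finitely many registers (those mentioned in the
program), and an unbounded memory of cells holding natural numbers. There is no multiplication,
so unit cost per instruction is polynomially related to Turing machine time. -/
inductive Instr where
  /-- `r_d := c` -/
  | const (d c : ℕ)
  /-- `r_d := r_a` -/
  | copy (d a : ℕ)
  /-- `r_d := r_a + r_b` -/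
  | add (d a b : ℕ)
  /-- `r_d := max (r_a - r_b) 0` -/
  | sub (d a b : ℕ)
  /-- `r_d := memory[r_a]` -/
  | load (d a : ℕ)
  /-- `memory[r_a] := r_b` -/
  | store (a b : ℕ)
  /-- continue at instruction `l` -/
  | jump (l : ℕ)
  /-- continue at instruction `l` if `r_a = 0`, and at the next instruction otherwise -/
  | jumpZero (a l : ℕ)

/-- A program: the instructions, numbered from `0`. -/
abbrev Program := List Instr

/-- A configuration: instruction counter, register contents and memory contents. -/
structure Cfg where
  pc : ℕ
  reg : ℕ → ℕ
  mem : ℕ → ℕ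

/-- The effect of executing one instruction. -/
def exec : Instr → Cfg → Cfg
  | .const d c, s => ⟨s.pc + 1, Function.update s.reg d c, s.mem⟩
  | .copy d a, s => ⟨s.pc + 1, Function.update s.reg d (s.reg a), s.mem⟩
  | .add d a b, s => ⟨s.pc + 1, Function.update s.reg d (s.reg a + s.reg b), s.mem⟩
  | .sub d a b, s => ⟨s.pc + 1, Function.update s.reg d (s.reg a - s.reg b), s.mem⟩
  | .load d a, s => ⟨s.pc + 1, Function.update s.reg d (s.mem (s.reg a)), s.mem⟩
  | .store a b, s => ⟨s.pc + 1, s.reg, Function.update s.mem (s.reg a) (s.reg b)⟩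
  | .jump l, s => ⟨l, s.reg, s.mem⟩
  | .jumpZero a l, s => ⟨if s.reg a = 0 then l else s.pc + 1, s.reg, s.mem⟩

/-- The machine has halted when the instruction counter has left the program. -/
def Halted (P : Program) (s : Cfg) : Prop := P.length ≤ s.pc

/-- One step of the machine; a halted machine stays where it is. -/
def step (P : Program) (s : Cfg) : Cfg :=
  match P[s.pc]? with
  | some i => exec i s
  | none => s

/-- Started in `s`, the program halts after at most `t` steps, with `1` in register `0` if `φ` is
true and with `0` in register `0` if `φ` is false. -/
def DecidesWithin (P : Program) (s : Cfg) (t : ℕ) (φ : Prop) : Prop :=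
  Halted P ((step P)^[t] s) ∧ (φ → ((step P)^[t] s).reg 0 = 1) ∧ (¬ φ → ((step P)^[t] s).reg 0 = 0)

open Classical in
/-- The initial configuration on an instance `(G, l)` of the colouring problem, `G` being a graph on
the vertices `0, …, n - 1`: register `0` holds `n`, register `1` holds `l`, the cells
`0, …, n² - 1` of the memory hold the adjacency matrix of `G` row by row, and everything else
is `0`. -/
noncomputable def colouringInput {n : ℕ} (G : SimpleGraph (Fin n)) (l : ℕ) : Cfg where
  pc := 0
  reg := fun r => if r = 0 then n else if r = 1 then l else 0
  mem := fun a => if ∃ i j : Fin n, a = i.val * n + j.val ∧ G.Adj i j then 1 else 0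

end Ram

/-! Part (1) is a bounded search tree. Chordality enters only through perfect elimination: chordal
graphs satisfy `Elim` by Dirac's theorem (`IsChordal.elim`), and `Elim` is tested by deleting
simplicial vertices as long as there are any. Suppose that H fails `Elim` but satisfies it after
adding at most d + 1 edges. An inclusion-minimal vertex set S violating `Elim` is the vertex set of
an induced cycle, and of any two consecutive vertices of that cycle one is an end of an added edge
(`card_le_of_minimal`); hence |S| ≤ 4(d + 1). Moreover some added edge pq lies inside S. By Zykov's
dichotomy, a colouring of H gives p and q different colours and colours H + pq, or gives them equal
colours and colours the graph in which p and q are identified. Both graphs need at most d further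
edges, the second because `Elim` survives the contraction of an edge (`FillLE.exists_pair`,
`Elim.contractInto`). Guessing p and q in S, with their order encoding the alternative, leaves at
most (4d)^(2d) branches. At a leaf one tests whether every nonempty vertex subset has a vertex with
fewer than l neighbours in it. Greedy colouring makes this test sound whatever was guessed, and on a
graph with `Elim` it is equivalent to l-colourability.

Neither k nor A is given to the program, so d is increased from 0. Level d answers yes if some leaf
passes the degeneracy test. Otherwise it answers no if some branch that only added edges ends in a
graph with `Elim`: such a branch certifies a completion with at most d edges, so the search at level
d was exhaustive. If neither happens, d is increased. Some level d ≤ k stops, because the completion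
promised by the hypothesis is found there.

The machine program is obtained by writing the algorithm as a loop program (`Stmt`) and compiling
it. If all stored values and loop bounds are at most X, the compiled code takes at most X^w steps,
with w depending on the program text alone (`Stmt.exec_cmd`). So only the size of the numbers has to
be estimated, and the largest factor is the number (4k)^(2k) of branches.

Part (2): two vertices of the clique that share an independent part are joined by a pair of A.
Vertices outside all pairs of A therefore form singleton parts, and a partition is determined by the
map sending each of the at most 2k remaining vertices to the least one in its part. -/

namespace Ram

/-! ### Structured commands and their machine code -/

/-- Structured commands: single instructions, sequencing, and loops running while a register is
nonzero. -/
inductive Cmd where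
  | prim (i : Instr)
  | seq (c d : Cmd)
  | loop (r : ℕ) (c : Cmd)

/-- Terminating execution of a structured command on registers and memory, with a step count. -/
inductive Cmd.Exec : Cmd → (ℕ → ℕ) → (ℕ → ℕ) → (ℕ → ℕ) → (ℕ → ℕ) → ℕ → Prop
  -- The instruction must fall through to the next one wherever it is placed; control flow is left
  -- to `loop`.
  | prim {i R M R' M'} (h : ∀ pc, exec i ⟨pc, R, M⟩ = ⟨pc + 1, R', M'⟩) :
      Cmd.Exec (.prim i) R M R' M' 1
  | seq {c d R M R₁ M₁ R₂ M₂ t₁ t₂} (h₁ : Cmd.Exec c R M R₁ M₁ t₁)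
      (h₂ : Cmd.Exec d R₁ M₁ R₂ M₂ t₂) : Cmd.Exec (.seq c d) R M R₂ M₂ (t₁ + t₂)
  | done {r c R M} (h : R r = 0) : Cmd.Exec (.loop r c) R M R M 1
  | more {r c R M R₁ M₁ R₂ M₂ t₁ t₂} (h : R r ≠ 0) (h₁ : Cmd.Exec c R M R₁ M₁ t₁)
      (h₂ : Cmd.Exec (.loop r c) R₁ M₁ R₂ M₂ t₂) :
      Cmd.Exec (.loop r c) R M R₂ M₂ (t₁ + t₂ + 2)

/-- The number of instructions of a compiled command. -/
def Cmd.size : Cmd → ℕ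
  | .prim _ => 1
  | .seq c d => c.size + d.size
  | .loop _ c => c.size + 2

/-- The machine code of a command placed at address `o`. -/
def Cmd.code : Cmd → ℕ → List Instr
  | .prim i, _ => [i]
  | .seq c d, o => c.code o ++ d.code (o + c.size)
  | .loop r c, o => .jumpZero r (o + c.size + 2) :: (c.code (o + 1) ++ [.jump o])

theorem Cmd.length_code (c : Cmd) (o : ℕ) : (c.code o).length = c.size := by
  induction c generalizing o with
  | prim i => rfl
  | seq c d hc hd => simp [code, size, hc, hd]
  | loop r c hc => simp [code, size, hc]

/-- The program `P` contains the code `L` at address `o`. -/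
def CodeAt (P : Program) (o : ℕ) (L : List Instr) : Prop :=
  ∀ i, i < L.length → P[o + i]? = L[i]?

theorem CodeAt.left {P : Program} {o : ℕ} {L L' : List Instr} (h : CodeAt P o (L ++ L')) :
    CodeAt P o L := fun i hi => by
  rw [h i (by simp; omega), List.getElem?_append_left hi]

theorem CodeAt.right {P : Program} {o : ℕ} {L L' : List Instr} (h : CodeAt P o (L ++ L')) :
    CodeAt P (o + L.length) L' := fun i hi => by
  rw [add_assoc, h (L.length + i) (by simp; omega), List.getElem?_append_right (by omega)]
  simp

theorem CodeAt.head {P : Program} {o : ℕ} {i : Instr} {L : List Instr}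
    (h : CodeAt P o (i :: L)) : P[o]? = some i := by
  simpa using h 0 (by simp)

theorem CodeAt.tail {P : Program} {o : ℕ} {i : Instr} {L : List Instr}
    (h : CodeAt P o (i :: L)) : CodeAt P (o + 1) L := by
  have := CodeAt.right (L := [i]) (L' := L) (by simpa using h)
  simpa using this

/-- Induction on the execution. The step counts are exact, so iterates of `step` compose; each loop
iteration pays two extra steps, for the zero test and for the jump back. -/
theorem Cmd.Exec.run {c : Cmd} {R M R' M' : ℕ → ℕ} {t : ℕ} (h : Cmd.Exec c R M R' M' t) :
    ∀ {P : Program} {o : ℕ}, CodeAt P o (c.code o) →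
      (step P)^[t] ⟨o, R, M⟩ = ⟨o + c.size, R', M'⟩ := by
  induction h with
  | prim h =>
    intro P o hP
    have := hP.head
    simp [step, this, h, Cmd.size]
  | @seq c d R M R₁ M₁ R₂ M₂ t₁ t₂ h₁ h₂ ih₁ ih₂ =>
    intro P o hP
    have hP₂ := CodeAt.right hP
    rw [Cmd.length_code] at hP₂
    rw [add_comm t₁, Function.iterate_add_apply, ih₁ (CodeAt.left hP), ih₂ hP₂]
    simp [Cmd.size, add_assoc]
  | done h =>
    intro P o hP
    have := hP.head
    simp [step, this, exec, h, Cmd.size, add_assoc]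
  | @more r c R M R₁ M₁ R₂ M₂ t₁ t₂ h h₁ h₂ ih₁ ih₂ =>
    intro P o hP
    have hb := CodeAt.left (CodeAt.tail hP)
    have hj := CodeAt.right (CodeAt.tail hP)
    rw [Cmd.length_code] at hj
    have e₁ : step P ⟨o, R, M⟩ = ⟨o + 1, R, M⟩ := by simp [step, hP.head, exec, h]
    have e₂ : step P ⟨o + 1 + c.size, R₁, M₁⟩ = ⟨o, R₁, M₁⟩ := by simp [step, hj.head, exec]
    rw [show t₁ + t₂ + 2 = t₂ + (1 + (t₁ + 1)) by ring, Function.iterate_add_apply,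
      Function.iterate_add_apply, Function.iterate_succ_apply (step P) t₁, e₁, ih₁ hb,
      Function.iterate_one, e₂, ih₂ hP]

end Ram

/-! ### Loop programs and their compilation -/

namespace Ram

/-- Expressions over natural-number variables, the input cells, four arrays, and bounded sums. -/
inductive Exp where
  | const (c : ℕ)
  | var (x : ℕ)
  | inp (e : Exp)
  | arr (a : Fin 4) (e : Exp)
  | add (e f : Exp)
  | sub (e f : Exp)
  | mul (e f : Exp)
  | sum (x : ℕ) (e f : Exp)

/-- Loop programs: assignments to variables and array cells, sequencing, and loops whose number of
iterations is fixed on entry. -/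
inductive Stmt where
  | assign (x : ℕ) (e : Exp)
  | store (a : Fin 4) (i e : Exp)
  | seq (c d : Stmt)
  | loop (x : ℕ) (e : Exp) (c : Stmt)

/-- States of loop programs: variables, four arrays, and a read-only input of length `base`. -/
structure St where
  v : ℕ → ℕ
  A : Fin 4 → ℕ → ℕ
  base : ℕ
  input : ℕ → ℕ

namespace St

/-- Assign the variable `x`. -/
def setV (σ : St) (x k : ℕ) : St := { σ with v := Function.update σ.v x k }

/-- Assign the cell `i` of the array `a`. -/
def setA (σ : St) (a : Fin 4) (i k : ℕ) : St :=
  { σ with A := Function.update σ.A a (Function.update (σ.A a) i k) }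

/-- The memory of the machine: the input, followed by the interleaved arrays. -/
def mem (σ : St) (m : ℕ) : ℕ :=
  if m < σ.base then σ.input m else σ.A (Fin.ofNat 4 (m - σ.base)) ((m - σ.base) / 4)

@[simp] theorem setV_base (σ : St) (x k : ℕ) : (σ.setV x k).base = σ.base := rfl
@[simp] theorem setV_input (σ : St) (x k : ℕ) : (σ.setV x k).input = σ.input := rfl
@[simp] theorem setA_v (σ : St) (a : Fin 4) (i k : ℕ) : (σ.setA a i k).v = σ.v := rfl
@[simp] theorem setA_base (σ : St) (a : Fin 4) (i k : ℕ) : (σ.setA a i k).base = σ.base := rfl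
@[simp] theorem setA_input (σ : St) (a : Fin 4) (i k : ℕ) : (σ.setA a i k).input = σ.input := rfl

theorem setV_v (σ : St) (x k y : ℕ) :
    (σ.setV x k).v y = if y = x then k else σ.v y := by
  simp [setV, Function.update_apply]

theorem setA_A (σ : St) (a : Fin 4) (i k : ℕ) (b : Fin 4) (j : ℕ) :
    (σ.setA a i k).A b j = if b = a ∧ j = i then k else σ.A b j := by
  by_cases h : b = a
  · subst h; simp [setA, Function.update_apply]
  · simp [setA, h]

@[simp] theorem setV_setV (σ : St) (x k k' : ℕ) : (σ.setV x k).setV x k' = σ.setV x k' := by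
  simp [setV]

theorem setV_self (σ : St) (x : ℕ) : σ.setV x (σ.v x) = σ := by
  simp [setV]

theorem mem_of_lt {σ : St} {m : ℕ} (h : m < σ.base) : σ.mem m = σ.input m := if_pos h

theorem mem_of_not_lt {σ : St} {m : ℕ} (h : ¬ m < σ.base) :
    σ.mem m = σ.A (Fin.ofNat 4 (m - σ.base)) ((m - σ.base) / 4) := if_neg h

/-- Cell i of array a sits at address base + 4i + a, written with additions only because the machine
cannot multiply. -/
theorem mem_arr (σ : St) (a : Fin 4) (i : ℕ) :
    σ.mem (i + i + (i + i) + a.val + σ.base) = σ.A a i := by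
  have h : i + i + (i + i) + a.val + σ.base - σ.base = 4 * i + a.val := by omega
  rw [mem, if_neg (by omega), h]
  congr 1
  · ext
    simp [Fin.ofNat]
  · omega

theorem setA_mem (σ : St) (a : Fin 4) (i k : ℕ) :
    (σ.setA a i k).mem = Function.update σ.mem (i + i + (i + i) + a.val + σ.base) k := by
  ext m
  rw [Function.update_apply]
  split_ifs with h
  · subst h
    have := (σ.setA a i k).mem_arr a i
    rw [setA_base] at this
    rw [this, setA_A]
    simp
  · by_cases hm : m < σ.base
    · rw [mem_of_lt hm, mem_of_lt (by exact hm), setA_input]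
    · rw [mem_of_not_lt hm, mem_of_not_lt (by exact hm), setA_A, setA_base, if_neg]
      rintro ⟨h₁, h₂⟩
      apply h
      have h₁ : (m - σ.base) % 4 = a.val := by rw [← h₁]; simp [Fin.ofNat]
      omega

/-- All stored values are at most `X`. -/
structure Bnd (X : ℕ) (σ : St) : Prop where
  v : ∀ x, σ.v x ≤ X
  A : ∀ a i, σ.A a i ≤ X
  input : ∀ i, i < σ.base → σ.input i ≤ X

theorem Bnd.mono {X Y : ℕ} {σ : St} (h : Bnd X σ) (hXY : X ≤ Y) : Bnd Y σ :=
  ⟨fun x => (h.v x).trans hXY, fun a i => (h.A a i).trans hXY,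
    fun i hi => (h.input i hi).trans hXY⟩

theorem Bnd.setV {X : ℕ} {σ : St} (h : Bnd X σ) {x k : ℕ} (hk : k ≤ X) : Bnd X (σ.setV x k) :=
  ⟨fun y => by rw [setV_v]; split_ifs; exacts [hk, h.v y], h.A, h.input⟩

theorem Bnd.setA {X : ℕ} {σ : St} (h : Bnd X σ) {a : Fin 4} {i k : ℕ} (hk : k ≤ X) :
    Bnd X (σ.setA a i k) :=
  ⟨h.v, fun b j => by rw [setA_A]; split_ifs; exacts [hk, h.A b j], h.input⟩

theorem Bnd.mem {X : ℕ} {σ : St} (h : Bnd X σ) (m : ℕ) : σ.mem m ≤ X := by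
  unfold St.mem
  split_ifs with hm
  exacts [h.input _ hm, h.A _ _]

end St

/-- The value of an expression. -/
def Exp.eval : Exp → St → ℕ
  | const c, _ => c
  | var x, σ => σ.v x
  | inp e, σ => σ.mem (e.eval σ)
  | arr a e, σ => σ.A a (e.eval σ)
  | add e f, σ => e.eval σ + f.eval σ
  | sub e f, σ => e.eval σ - f.eval σ
  | mul e f, σ => e.eval σ * f.eval σ
  | sum x e f, σ => ∑ i ∈ Finset.range (e.eval σ), f.eval (σ.setV x i)

/-- Apply `g 0`, …, `g (n - 1)` in this order. -/
def loopN {α : Type*} (g : ℕ → α → α) : ℕ → α → α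
  | 0, σ => σ
  | n + 1, σ => g n (loopN g n σ)

/-- The effect of a loop program; loop variables are restored after the loop. -/
def Stmt.den : Stmt → St → St
  | assign x e, σ => σ.setV x (e.eval σ)
  | store a i e, σ => σ.setA a (i.eval σ) (e.eval σ)
  | seq c d, σ => d.den (c.den σ)
  | .loop x e c, σ => (loopN (fun i τ => c.den (τ.setV x i)) (e.eval σ) σ).setV x (σ.v x)

/-- Every value assigned, and every loop bound, in the run of a program is at most `X`. -/
def Stmt.Bdd (X : ℕ) : Stmt → St → Prop
  | assign _ e, σ => e.eval σ ≤ X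
  | store _ _ e, σ => e.eval σ ≤ X
  | seq c d, σ => c.Bdd X σ ∧ d.Bdd X (c.den σ)
  | .loop x e c, σ => e.eval σ ≤ X ∧
      ∀ i < e.eval σ, c.Bdd X ((loopN (fun i τ => c.den (τ.setV x i)) i σ).setV x i)

/-- Exponent of a bound for the value and the evaluation time of an expression. -/
def Exp.wt : Exp → ℕ
  | const c => c + 1
  | var _ => 1
  | inp e => e.wt + 1
  | arr _ e => e.wt + 1
  | add e f => e.wt + f.wt + 1
  | sub e f => e.wt + f.wt + 1
  | mul e f => e.wt + f.wt + 1
  | sum _ e f => e.wt + (e.wt + 1) * f.wt + 1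

/-- Exponent of a bound for the running time of a loop program. -/
def Stmt.wt : Stmt → ℕ
  | assign _ e => e.wt + 1
  | store _ i e => i.wt + e.wt + 1
  | seq c d => c.wt + d.wt + 1
  | .loop _ e c => e.wt + c.wt + 1

/-- Lets the costs of two consecutive parts be bounded by a product, so that the exponents in `wt`
simply add up. -/
theorem add_le_mul_add_one {p q : ℕ} (hp : 1 ≤ p) (hq : 1 ≤ q) : p + q ≤ p * q + 1 := by
  nlinarith [Nat.mul_le_mul hp hq, Nat.sub_add_cancel hp, Nat.sub_add_cancel hq,
    Nat.zero_le ((p - 1) * (q - 1)), mul_comm p q]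

theorem Exp.eval_le (e : Exp) :
    ∀ {X : ℕ}, 20 ≤ X → ∀ {σ : St}, σ.Bnd X → e.eval σ ≤ X ^ e.wt := by
  induction e with
  | const c =>
    intro X hX σ h
    exact (Nat.lt_pow_self (by omega : 1 < X)).le.trans (Nat.pow_le_pow_right (by omega) (Nat.le_succ c))
  | var x => intro X hX σ h; simpa [eval, wt] using h.v x
  | inp e ih =>
    intro X hX σ h
    exact (h.mem _).trans (Nat.le_self_pow (by simp [wt]) X)
  | arr a e ih =>
    intro X hX σ h
    exact (h.A _ _).trans (Nat.le_self_pow (by simp [wt]) X)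
  | add e f he hf =>
    intro X hX σ h
    have h₁ := he hX h
    have h₂ := hf hX h
    have := add_le_mul_add_one (Nat.one_le_pow e.wt X (by omega)) (Nat.one_le_pow f.wt X (by omega))
    have h₃ : 1 ≤ X ^ e.wt * X ^ f.wt := Nat.mul_pos (by positivity) (by positivity)
    simp only [eval, wt, pow_succ, pow_add]
    nlinarith
  | sub e f he hf =>
    intro X hX σ h
    exact (Nat.sub_le _ _).trans ((he hX h).trans
      (Nat.pow_le_pow_right (by omega) (by simp [wt]; omega)))
  | mul e f he hf =>
    intro X hX σ h
    calc e.eval σ * f.eval σ ≤ X ^ e.wt * X ^ f.wt := Nat.mul_le_mul (he hX h) (hf hX h)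
      _ = X ^ (e.wt + f.wt) := (pow_add _ _ _).symm
      _ ≤ _ := Nat.pow_le_pow_right (by omega) (by simp [wt])
  | sum x e f he hf =>
    intro X hX σ h
    have h₁ := he hX h
    -- The summation index may be as large as X ^ e.wt, so the summand is evaluated in states
    -- bounded by X ^ (e.wt + 1). This is the source of the factor e.wt + 1 in the weight of a sum.
    have hX' : X ≤ X ^ (e.wt + 1) := Nat.le_self_pow (by omega) X
    have h₂ : ∀ i ∈ Finset.range (e.eval σ), f.eval (σ.setV x i) ≤ (X ^ (e.wt + 1)) ^ f.wt := by
      intro i hi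
      refine hf (hX.trans hX') ((h.mono hX').setV ?_)
      exact (Finset.mem_range.1 hi).le.trans (h₁.trans (Nat.pow_le_pow_right (by omega) (by omega)))
    calc _ ≤ ∑ i ∈ Finset.range (e.eval σ), (X ^ (e.wt + 1)) ^ f.wt := Finset.sum_le_sum h₂
      _ = e.eval σ * X ^ ((e.wt + 1) * f.wt) := by simp [pow_mul]
      _ ≤ X ^ e.wt * X ^ ((e.wt + 1) * f.wt) := Nat.mul_le_mul_right _ h₁
      _ = X ^ (e.wt + (e.wt + 1) * f.wt) := (pow_add _ _ _).symm
      _ ≤ _ := Nat.pow_le_pow_right (by omega) (by simp [wt])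

/-- The register of a temporary. -/
def tmp (j : ℕ) : ℕ := 2 * j + 2

/-- The register of a variable. -/
def vreg (x : ℕ) : ℕ := 2 * x + 1

-- Temporaries use the even registers from 2 on, variables the odd registers, and register 0 holds
-- the start of the arrays; hence the three kinds never interfere.
@[simp] theorem tmp_inj {i j : ℕ} : tmp i = tmp j ↔ i = j := by simp [tmp]
@[simp] theorem vreg_inj {i j : ℕ} : vreg i = vreg j ↔ i = j := by simp [vreg]
@[simp] theorem tmp_ne_vreg {i j : ℕ} : tmp i ≠ vreg j := by simp [tmp, vreg]; omega
@[simp] theorem vreg_ne_tmp {i j : ℕ} : vreg j ≠ tmp i := by simp [tmp, vreg]; omega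
@[simp] theorem zero_ne_tmp {i : ℕ} : 0 ≠ tmp i := by simp [tmp]
@[simp] theorem zero_ne_vreg {i : ℕ} : 0 ≠ vreg i := by simp [vreg]

/-- Registers and memory represent a state. -/
structure Sim (σ : St) (R M : ℕ → ℕ) : Prop where
  base : R 0 = σ.base
  v : ∀ x, R (vreg x) = σ.v x
  mem : M = σ.mem

theorem Sim.tmp {σ : St} {R M : ℕ → ℕ} (h : Sim σ R M) (j k : ℕ) :
    Sim σ (Function.update R (tmp j) k) M :=
  ⟨by simp [h.base], fun x => by simp [h.v], h.mem⟩

theorem Sim.setV {σ : St} {R M : ℕ → ℕ} (h : Sim σ R M) (x k : ℕ) :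
    Sim (σ.setV x k) (Function.update R (vreg x) k) M :=
  ⟨by simp [h.base],
    fun y => by simp [Function.update_apply, h.v, St.setV_v], h.mem⟩

namespace Cmd

/-- Sequencing of a list of commands. -/
infixr:60 " ;; " => Cmd.seq

theorem Exec.const (R M : ℕ → ℕ) (d c : ℕ) :
    Exec (.prim (.const d c)) R M (Function.update R d c) M 1 := .prim fun _ => rfl
theorem Exec.copy (R M : ℕ → ℕ) (d a : ℕ) :
    Exec (.prim (.copy d a)) R M (Function.update R d (R a)) M 1 := .prim fun _ => rfl
theorem Exec.add (R M : ℕ → ℕ) (d a b : ℕ) :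
    Exec (.prim (.add d a b)) R M (Function.update R d (R a + R b)) M 1 := .prim fun _ => rfl
theorem Exec.sub (R M : ℕ → ℕ) (d a b : ℕ) :
    Exec (.prim (.sub d a b)) R M (Function.update R d (R a - R b)) M 1 := .prim fun _ => rfl
theorem Exec.load (R M : ℕ → ℕ) (d a : ℕ) :
    Exec (.prim (.load d a)) R M (Function.update R d (M (R a))) M 1 := .prim fun _ => rfl
theorem Exec.store (R M : ℕ → ℕ) (a b : ℕ) :
    Exec (.prim (.store a b)) R M R (Function.update M (R a) (R b)) 1 := .prim fun _ => rfl

/-- A loop that counts a register down from `N` and keeps an invariant. -/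
theorem Exec.count {c : Cmd} {r N C : ℕ} (I : ℕ → (ℕ → ℕ) → (ℕ → ℕ) → Prop)
    (hc : ∀ i < N, ∀ R M, I i R M → R r = N - i →
      ∃ R' M' t, Exec c R M R' M' t ∧ t ≤ C ∧ I (i + 1) R' M' ∧ R' r = N - (i + 1)) :
    ∀ {R M : ℕ → ℕ}, I 0 R M → R r = N →
      ∃ R' M' t, Exec (.loop r c) R M R' M' t ∧ t ≤ N * (C + 2) + 1 ∧ I N R' M' := by
  suffices h : ∀ k i, i + k = N → ∀ R M, I i R M → R r = k →
      ∃ R' M' t, Exec (.loop r c) R M R' M' t ∧ t ≤ k * (C + 2) + 1 ∧ I N R' M' from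
    fun {R M} h0 hr => h N 0 (by omega) R M h0 hr
  intro k
  induction k with
  | zero =>
    intro i hi R M hI hr
    obtain rfl : i = N := by omega
    exact ⟨R, M, 1, .done hr, by omega, hI⟩
  | succ k ih =>
    intro i hi R M hI hr
    obtain ⟨R₁, M₁, t₁, e₁, ht₁, hI₁, hr₁⟩ := hc i (by omega) R M hI (by omega)
    obtain ⟨R₂, M₂, t₂, e₂, ht₂, hI₂⟩ := ih (i + 1) (by omega) R₁ M₁ hI₁ (by omega)
    refine ⟨R₂, M₂, _, .more (by omega) e₁ e₂, ?_, hI₂⟩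
    rw [Nat.succ_mul]
    omega

end Cmd

open Cmd in
/-- The command that evaluates an expression into the temporary `r`. -/
def Exp.cmd : Exp → ℕ → Cmd
  | const c, r => .prim (.const (tmp r) c)
  | var x, r => .prim (.copy (tmp r) (vreg x))
  | inp e, r => e.cmd r ;; .prim (.load (tmp r) (tmp r))
  | arr a e, r => e.cmd r ;; .prim (.add (tmp r) (tmp r) (tmp r)) ;;
      .prim (.add (tmp r) (tmp r) (tmp r)) ;; .prim (.const (tmp (r + 1)) a.val) ;;
      .prim (.add (tmp r) (tmp r) (tmp (r + 1))) ;; .prim (.add (tmp r) (tmp r) 0) ;;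
      .prim (.load (tmp r) (tmp r))
  | add e f, r => e.cmd r ;; f.cmd (r + 1) ;; .prim (.add (tmp r) (tmp r) (tmp (r + 1)))
  | sub e f, r => e.cmd r ;; f.cmd (r + 1) ;; .prim (.sub (tmp r) (tmp r) (tmp (r + 1)))
  | mul e f, r => e.cmd r ;; f.cmd (r + 1) ;; .prim (.const (tmp (r + 2)) 0) ;;
      .prim (.const (tmp (r + 3)) 1) ;;
      .loop (tmp (r + 1)) (.prim (.add (tmp (r + 2)) (tmp (r + 2)) (tmp r)) ;;
        .prim (.sub (tmp (r + 1)) (tmp (r + 1)) (tmp (r + 3)))) ;;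
      .prim (.copy (tmp r) (tmp (r + 2)))
  | sum x e f, r => e.cmd r ;; .prim (.const (tmp (r + 1)) 0) ;; .prim (.const (tmp (r + 2)) 0) ;;
      .prim (.copy (tmp (r + 3)) (vreg x)) ;;
      .loop (tmp r) (.prim (.copy (vreg x) (tmp (r + 2))) ;; f.cmd (r + 4) ;;
        .prim (.add (tmp (r + 1)) (tmp (r + 1)) (tmp (r + 4))) ;;
        .prim (.const (tmp (r + 4)) 1) ;;
        .prim (.add (tmp (r + 2)) (tmp (r + 2)) (tmp (r + 4))) ;;
        .prim (.sub (tmp r) (tmp r) (tmp (r + 4)))) ;;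
      .prim (.copy (vreg x) (tmp (r + 3))) ;; .prim (.copy (tmp r) (tmp (r + 1)))

open Cmd in
/-- The command of a loop program, using temporaries from `r` on. -/
def Stmt.cmd : Stmt → ℕ → Cmd
  | assign x e, r => e.cmd r ;; .prim (.copy (vreg x) (tmp r))
  | store a i e, r => i.cmd r ;; e.cmd (r + 1) ;; .prim (.add (tmp r) (tmp r) (tmp r)) ;;
      .prim (.add (tmp r) (tmp r) (tmp r)) ;; .prim (.const (tmp (r + 2)) a.val) ;;
      .prim (.add (tmp r) (tmp r) (tmp (r + 2))) ;; .prim (.add (tmp r) (tmp r) 0) ;;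
      .prim (.store (tmp r) (tmp (r + 1)))
  | seq c d, r => c.cmd r ;; d.cmd r
  | .loop x e c, r => e.cmd r ;; .prim (.const (tmp (r + 1)) 0) ;;
      .prim (.copy (tmp (r + 2)) (vreg x)) ;;
      .loop (tmp r) (.prim (.copy (vreg x) (tmp (r + 1))) ;; c.cmd (r + 3) ;;
        .prim (.const (tmp (r + 3)) 1) ;;
        .prim (.add (tmp (r + 1)) (tmp (r + 1)) (tmp (r + 3))) ;;
        .prim (.sub (tmp r) (tmp r) (tmp (r + 3)))) ;;
      .prim (.copy (vreg x) (tmp (r + 2)))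

end Ram

/-! ### Correctness and running time of compiled programs -/

namespace Ram

/-- Evaluation at level r disturbs only temporaries with index at least r, so a pending intermediate
result survives the evaluation of a later operand at level r + 1. Products and sums are counting
loops. The assumption 20 ≤ X absorbs the constant overhead of each construct into one extra factor
X. -/
theorem Exp.exec_cmd (e : Exp) :
    ∀ {X : ℕ}, 20 ≤ X → ∀ {σ : St}, σ.Bnd X → ∀ (r : ℕ) {R M : ℕ → ℕ}, Sim σ R M →
      ∃ R' t, Cmd.Exec (e.cmd r) R M R' M t ∧ t ≤ X ^ e.wt ∧ Sim σ R' M ∧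
        R' (tmp r) = e.eval σ ∧ ∀ j < r, R' (tmp j) = R (tmp j) := by
  induction e with
  | const c =>
    intro X hX σ h r R M hS
    exact ⟨_, 1, .const .., Nat.one_le_pow _ _ (by omega), hS.tmp _ _, by simp [eval],
      fun j hj => by simp [hj.ne]⟩
  | var x =>
    intro X hX σ h r R M hS
    exact ⟨_, 1, .copy .., Nat.one_le_pow _ _ (by omega), hS.tmp _ _, by simp [eval, hS.v],
      fun j hj => by simp [hj.ne]⟩
  | inp e ih =>
    intro X hX σ h r R M hS
    obtain ⟨R₁, t₁, h₁, ht₁, hS₁, hv₁, hf₁⟩ := ih hX h r hS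
    refine ⟨_, _, .seq h₁ (.load ..), ?_, hS₁.tmp _ _, by simp [eval, hv₁, hS₁.mem],
      fun j hj => by simp [hj.ne, hf₁ j hj]⟩
    have : 1 ≤ X ^ e.wt := Nat.one_le_pow _ _ (by omega)
    simp only [wt, pow_succ]
    nlinarith
  | arr a e ih =>
    intro X hX σ h r R M hS
    obtain ⟨R₁, t₁, h₁, ht₁, hS₁, hv₁, hf₁⟩ := ih hX h r hS
    refine ⟨_, _, .seq h₁ (.seq (.add ..) (.seq (.add ..) (.seq (.const ..) (.seq (.add ..)
      (.seq (.add ..) (.load ..)))))), ?_,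
      (((((hS₁.tmp _ _).tmp _ _).tmp _ _).tmp _ _).tmp _ _).tmp _ _, ?_, fun j hj => ?_⟩
    · have : 1 ≤ X ^ e.wt := Nat.one_le_pow _ _ (by omega)
      simp only [wt, pow_succ]
      nlinarith
    · simp [eval, hv₁, hS₁.mem, hS₁.base, St.mem_arr]
    · simp [hj.ne, hf₁ j hj, show j ≠ r + 1 by omega]
  | add e f he hf =>
    intro X hX σ h r R M hS
    obtain ⟨R₁, t₁, h₁, ht₁, hS₁, hv₁, hf₁⟩ := he hX h r hS
    obtain ⟨R₂, t₂, h₂, ht₂, hS₂, hv₂, hf₂⟩ := hf hX h (r + 1) hS₁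
    refine ⟨_, _, .seq h₁ (.seq h₂ (.add ..)), ?_, hS₂.tmp _ _, ?_, fun j hj => ?_⟩
    · have := add_le_mul_add_one (Nat.one_le_pow e.wt X (by omega))
        (Nat.one_le_pow f.wt X (by omega))
      have h₃ : 1 ≤ X ^ e.wt * X ^ f.wt := Nat.mul_pos (by positivity) (by positivity)
      simp only [wt, pow_succ, pow_add]
      nlinarith
    · simp [eval, hv₂, hf₂ r (by omega), hv₁]
    · simp [hj.ne, hf₁ j hj, hf₂ j (by omega)]
  | sub e f he hf =>
    intro X hX σ h r R M hS
    obtain ⟨R₁, t₁, h₁, ht₁, hS₁, hv₁, hf₁⟩ := he hX h r hS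
    obtain ⟨R₂, t₂, h₂, ht₂, hS₂, hv₂, hf₂⟩ := hf hX h (r + 1) hS₁
    refine ⟨_, _, .seq h₁ (.seq h₂ (.sub ..)), ?_, hS₂.tmp _ _, ?_, fun j hj => ?_⟩
    · have := add_le_mul_add_one (Nat.one_le_pow e.wt X (by omega))
        (Nat.one_le_pow f.wt X (by omega))
      have h₃ : 1 ≤ X ^ e.wt * X ^ f.wt := Nat.mul_pos (by positivity) (by positivity)
      simp only [wt, pow_succ, pow_add]
      nlinarith
    · simp [eval, hv₂, hf₂ r (by omega), hv₁]
    · simp [hj.ne, hf₁ j hj, hf₂ j (by omega)]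
  | mul e f he hf =>
    intro X hX σ h r R M hS
    obtain ⟨R₁, t₁, h₁, ht₁, hS₁, hv₁, hf₁⟩ := he hX h r hS
    obtain ⟨R₂, t₂, h₂, ht₂, hS₂, hv₂, hf₂⟩ := hf hX h (r + 1) hS₁
    obtain ⟨R₃, M₃, t₃, h₃, ht₃, rfl, hS₃, hv₃, hf₃⟩ := Cmd.Exec.count (N := f.eval σ) (C := 2)
      (r := tmp (r + 1)) (c := .seq (.prim (.add (tmp (r + 2)) (tmp (r + 2)) (tmp r)))
        (.prim (.sub (tmp (r + 1)) (tmp (r + 1)) (tmp (r + 3)))))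
      (fun i R' M' => M' = M ∧ Sim σ R' M ∧
        (R' (tmp (r + 2)) = i * e.eval σ ∧ R' (tmp r) = e.eval σ ∧ R' (tmp (r + 3)) = 1) ∧
        ∀ j < r, R' (tmp j) = R (tmp j))
      (by
        rintro i hi R' _ ⟨rfl, hS', ⟨e₁, e₂, e₃⟩, hf'⟩ hr
        refine ⟨_, _, _, .seq (.add ..) (.sub ..), by omega,
          ⟨rfl, (hS'.tmp _ _).tmp _ _, ⟨?_, ?_, ?_⟩, fun j hj => ?_⟩, ?_⟩
        · simp [e₁, e₂, Nat.succ_mul]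
        · simp [e₂]
        · simp [e₃]
        · simp [hf' j hj, show j ≠ r + 1 by omega, show j ≠ r + 2 by omega]
        · simp [e₃, hr]; omega)
      (R := Function.update (Function.update R₂ (tmp (r + 2)) 0) (tmp (r + 3)) 1) (M := M)
      ⟨rfl, (hS₂.tmp _ _).tmp _ _, ⟨by simp, by simp [hf₂ r (by omega), hv₁], by simp⟩,
        fun j hj => by simp [hf₁ j hj, hf₂ j (by omega), show j ≠ r + 3 by omega,
          show j ≠ r + 2 by omega]⟩
      (by simp [hv₂])
    refine ⟨_, _, .seq h₁ (.seq h₂ (.seq (.const ..) (.seq (.const ..) (.seq h₃ (.copy ..))))),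
      ?_, hS₃.tmp _ _, ?_, fun j hj => ?_⟩
    · have := add_le_mul_add_one (Nat.one_le_pow e.wt X (by omega))
        (Nat.one_le_pow f.wt X (by omega))
      have h₃ : 1 ≤ X ^ e.wt * X ^ f.wt := Nat.mul_pos (by positivity) (by positivity)
      have h₄ := f.eval_le hX h
      have h₅ : X ^ f.wt ≤ X ^ e.wt * X ^ f.wt :=
        Nat.le_mul_of_pos_left _ (by positivity)
      simp only [wt, pow_succ, pow_add]
      nlinarith
    · simp [eval, hv₃.1, mul_comm]
    · simp [hj.ne, hf₃ j hj]
  | sum x e f he hf =>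
    intro X hX σ h r R M hS
    obtain ⟨R₁, t₁, h₁, ht₁, hS₁, hv₁, hf₁⟩ := he hX h r hS
    have hle := e.eval_le hX h
    have hX' : X ≤ X ^ (e.wt + 1) := Nat.le_self_pow (by omega) X
    -- Between iterations the register of x holds a stale index, so the invariant represents σ only
    -- up to the value of x; the original value waits in temporary r + 3.
    obtain ⟨R₃, M₃, t₃, h₃, ht₃, rfl, ⟨k, hS₃⟩, hv₃, hf₃⟩ := Cmd.Exec.count (N := e.eval σ)
      (C := (X ^ (e.wt + 1)) ^ f.wt + 5) (r := tmp r)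
      (c := .seq (.prim (.copy (vreg x) (tmp (r + 2)))) (.seq (f.cmd (r + 4))
        (.seq (.prim (.add (tmp (r + 1)) (tmp (r + 1)) (tmp (r + 4))))
        (.seq (.prim (.const (tmp (r + 4)) 1))
        (.seq (.prim (.add (tmp (r + 2)) (tmp (r + 2)) (tmp (r + 4))))
        (.prim (.sub (tmp r) (tmp r) (tmp (r + 4)))))))))
      (fun i R' M' => M' = M ∧ (∃ k, Sim (σ.setV x k) R' M) ∧
        (R' (tmp (r + 1)) = ∑ i ∈ Finset.range i, f.eval (σ.setV x i) ∧ R' (tmp (r + 2)) = i ∧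
          R' (tmp (r + 3)) = σ.v x) ∧
        ∀ j < r, R' (tmp j) = R (tmp j))
      (by
        rintro i hi R' _ ⟨rfl, ⟨k, hS'⟩, ⟨e₁, e₂, e₃⟩, hf'⟩ hr
        have hS'' := hS'.setV x i
        rw [St.setV_setV] at hS''
        obtain ⟨R₄, t₄, h₄, ht₄, hS₄, hv₄, hf₄⟩ := hf (hX.trans hX')
          (((h.mono hX').setV (x := x) (k := i)) (hi.le.trans (hle.trans
            (Nat.pow_le_pow_right (by omega) (by omega))))) (r + 4) hS''
        have g₀ := hf₄ r (by omega)
        have g₁ := hf₄ (r + 1) (by omega)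
        have g₂ := hf₄ (r + 2) (by omega)
        have g₃ := hf₄ (r + 3) (by omega)
        simp at g₀ g₁ g₂ g₃
        refine ⟨_, _, _, .seq (.copy ..) (.seq (e₂ ▸ h₄) (.seq (.add ..) (.seq (.const ..)
          (.seq (.add ..) (.sub ..))))), by omega,
          ⟨rfl, ⟨i, (((hS₄.tmp _ _).tmp _ _).tmp _ _).tmp _ _⟩, ⟨?_, ?_, ?_⟩, fun j hj => ?_⟩, ?_⟩
        · simp [g₁, e₁, hv₄, Finset.sum_range_succ]
        · simp [g₂, e₂]
        · simp [g₃, e₃]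
        · simp [hf' j hj, hf₄ j (by omega), show j ≠ r + 1 by omega, show j ≠ r + 2 by omega,
            show j ≠ r by omega, show j ≠ r + 4 by omega]
        · simp [g₀, hr]; omega)
      (R := Function.update (Function.update (Function.update R₁ (tmp (r + 1)) 0)
        (tmp (r + 2)) 0) (tmp (r + 3)) (R₁ (vreg x))) (M := M)
      ⟨rfl, ⟨σ.v x, by rw [St.setV_self]; exact ((hS₁.tmp _ _).tmp _ _).tmp _ _⟩,
        ⟨by simp, by simp, by simp [hS₁.v]⟩,
        fun j hj => by simp [hf₁ j hj, show j ≠ r + 3 by omega,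
          show j ≠ r + 2 by omega, show j ≠ r + 1 by omega]⟩
      (by simp [hv₁])
    have hS₄ := (hS₃.setV x (σ.v x)).tmp r (R₃ (tmp (r + 1)))
    rw [St.setV_setV, St.setV_self] at hS₄
    have h₀ := Cmd.Exec.copy (Function.update (Function.update R₁ (tmp (r + 1)) 0)
      (tmp (r + 2)) 0) M₃ (tmp (r + 3)) (vreg x)
    simp only [ne_eq, vreg_ne_tmp, not_false_eq_true, Function.update_of_ne] at h₀
    refine ⟨Function.update (Function.update R₃ (vreg x) (R₃ (tmp (r + 3)))) (tmp r)
      (Function.update R₃ (vreg x) (R₃ (tmp (r + 3))) (tmp (r + 1))), _,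
      .seq h₁ (.seq (.const ..) (.seq (.const ..) (.seq h₀ (.seq h₃
        (.seq (.copy ..) (.copy ..)))))), ?_, ?_, ?_, fun j hj => ?_⟩
    · have h₅ : 1 ≤ X ^ e.wt := Nat.one_le_pow _ _ (by omega)
      have h₆ : 1 ≤ (X ^ (e.wt + 1)) ^ f.wt := Nat.one_le_pow _ _ (by positivity)
      have h₇ := Nat.mul_le_mul_right ((X ^ (e.wt + 1)) ^ f.wt + 5 + 2) hle
      have h₈ : 1 ≤ X ^ e.wt * (X ^ (e.wt + 1)) ^ f.wt := Nat.mul_pos h₅ h₆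
      have h₉ := Nat.le_mul_of_pos_right (X ^ e.wt) h₆
      simp only [wt]
      rw [pow_succ, pow_add, pow_mul]
      nlinarith
    · simpa [hv₃.2.2] using hS₄
    · simp [eval, hv₃.1]
    · simp [hj.ne, hf₃ j hj]

theorem Stmt.bnd_den {X : ℕ} (c : Stmt) :
    ∀ {σ : St}, σ.Bnd X → c.Bdd X σ → (c.den σ).Bnd X := by
  induction c with
  | assign x e => intro σ h hb; exact h.setV hb
  | store a i e => intro σ h hb; exact h.setA hb
  | seq c d hc hd => intro σ h hb; exact hd (hc h hb.1) hb.2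
  | loop x e c hc =>
    intro σ h hb
    suffices H : ∀ i ≤ e.eval σ, (loopN (fun i τ => c.den (τ.setV x i)) i σ).Bnd X from
      (H _ le_rfl).setV (h.v x)
    intro i
    induction i with
    | zero => exact fun _ => h
    | succ i ih =>
      exact fun hi => hc ((ih (by omega)).setV (by have := hb.1; omega)) (hb.2 i (by omega))

/-- The counter of a loop lives in temporaries below those of the body, and the number of iterations
is fixed on entry; a loop therefore costs at most its bound times the cost of the body plus
constants. This is what makes running time a matter of bounding stored values. -/
theorem Stmt.exec_cmd {X : ℕ} (hX : 20 ≤ X) (c : Stmt) :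
    ∀ {σ : St}, σ.Bnd X → c.Bdd X σ → ∀ (r : ℕ) {R M : ℕ → ℕ}, Sim σ R M →
      ∃ R' M' t, Cmd.Exec (c.cmd r) R M R' M' t ∧ t ≤ X ^ c.wt ∧ Sim (c.den σ) R' M' ∧
        ∀ j < r, R' (tmp j) = R (tmp j) := by
  induction c with
  | assign x e =>
    intro σ h hb r R M hS
    obtain ⟨R₁, t₁, h₁, ht₁, hS₁, hv₁, hf₁⟩ := e.exec_cmd hX h r hS
    refine ⟨_, _, _, .seq h₁ (.copy ..), ?_, ?_, fun j hj => by simp [hf₁ j hj]⟩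
    · have : 1 ≤ X ^ e.wt := Nat.one_le_pow _ _ (by omega)
      simp only [wt, pow_succ]
      nlinarith
    · rw [hv₁]; exact hS₁.setV _ _
  | store a i e =>
    intro σ h hb r R M hS
    obtain ⟨R₁, t₁, h₁, ht₁, hS₁, hv₁, hf₁⟩ := i.exec_cmd hX h r hS
    obtain ⟨R₂, t₂, h₂, ht₂, hS₂, hv₂, hf₂⟩ := e.exec_cmd hX h (r + 1) hS₁
    have g := hf₂ r (by omega)
    refine ⟨_, _, _, .seq h₁ (.seq h₂ (.seq (.add ..) (.seq (.add ..) (.seq (.const ..)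
      (.seq (.add ..) (.seq (.add ..) (.store ..))))))), ?_, ?_, fun j hj => ?_⟩
    · have := add_le_mul_add_one (Nat.one_le_pow i.wt X (by omega))
        (Nat.one_le_pow e.wt X (by omega))
      have h₃ : 1 ≤ X ^ i.wt * X ^ e.wt := Nat.mul_pos (by positivity) (by positivity)
      simp only [wt, pow_succ, pow_add]
      nlinarith
    · have hS₃ := ((((hS₂.tmp r (R₂ (tmp r) + R₂ (tmp r))).tmp r
        (R₂ (tmp r) + R₂ (tmp r) + (R₂ (tmp r) + R₂ (tmp r)))).tmp (r + 2) a.val).tmp r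
        (R₂ (tmp r) + R₂ (tmp r) + (R₂ (tmp r) + R₂ (tmp r)) + a.val)).tmp r
        (R₂ (tmp r) + R₂ (tmp r) + (R₂ (tmp r) + R₂ (tmp r)) + a.val + σ.base)
      refine ⟨?_, fun y => ?_, ?_⟩
      · simp [hS₂.base, den]
      · simp [hS₂.v, den]
      · simp [den, St.setA_mem, hS₂.mem, g, hv₁, hv₂, hS₂.base]
    · simp [hj.ne, hf₁ j hj, hf₂ j (by omega), show j ≠ r + 2 by omega]
  | seq c d hc hd =>
    intro σ h hb r R M hS
    obtain ⟨R₁, M₁, t₁, h₁, ht₁, hS₁, hf₁⟩ := hc h hb.1 r hS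
    obtain ⟨R₂, M₂, t₂, h₂, ht₂, hS₂, hf₂⟩ := hd (c.bnd_den h hb.1) hb.2 r hS₁
    refine ⟨_, _, _, .seq h₁ h₂, ?_, hS₂, fun j hj => (hf₂ j hj).trans (hf₁ j hj)⟩
    have := add_le_mul_add_one (Nat.one_le_pow c.wt X (by omega))
        (Nat.one_le_pow d.wt X (by omega))
    have h₃ : 1 ≤ X ^ c.wt * X ^ d.wt := Nat.mul_pos (by positivity) (by positivity)
    simp only [wt, pow_succ, pow_add]
    nlinarith
  | loop x e c hc =>
    intro σ h hb r R M hS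
    obtain ⟨R₁, t₁, h₁, ht₁, hS₁, hv₁, hf₁⟩ := e.exec_cmd hX h r hS
    set τ : ℕ → St := fun i => loopN (fun i τ => c.den (τ.setV x i)) i σ with hτ
    have hB : ∀ i ≤ e.eval σ, (τ i).Bnd X := by
      intro i
      induction i with
      | zero => exact fun _ => h
      | succ i ih =>
        exact fun hi => c.bnd_den ((ih (by omega)).setV (by have := hb.1; omega))
          (hb.2 i (by omega))
    obtain ⟨R₃, M₃, t₃, h₃, ht₃, ⟨k, hS₃⟩, hv₃, hf₃⟩ := Cmd.Exec.count (N := e.eval σ)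
      (C := X ^ c.wt + 4) (r := tmp r)
      (c := .seq (.prim (.copy (vreg x) (tmp (r + 1)))) (.seq (c.cmd (r + 3))
        (.seq (.prim (.const (tmp (r + 3)) 1))
        (.seq (.prim (.add (tmp (r + 1)) (tmp (r + 1)) (tmp (r + 3))))
        (.prim (.sub (tmp r) (tmp r) (tmp (r + 3))))))))
      (fun i R' M' => (∃ k, Sim ((τ i).setV x k) R' M') ∧
        (R' (tmp (r + 1)) = i ∧ R' (tmp (r + 2)) = σ.v x) ∧
        ∀ j < r, R' (tmp j) = R (tmp j))
      (by
        rintro i hi R' M' ⟨⟨k, hS'⟩, ⟨e₁, e₂⟩, hf'⟩ hr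
        have hS'' := hS'.setV x i
        rw [St.setV_setV] at hS''
        obtain ⟨R₄, M₄, t₄, h₄, ht₄, hS₄, hf₄⟩ := hc
          ((hB i hi.le).setV (by have := hb.1; omega)) (hb.2 i hi) (r + 3) hS''
        have g₀ := hf₄ r (by omega)
        have g₁ := hf₄ (r + 1) (by omega)
        have g₂ := hf₄ (r + 2) (by omega)
        simp at g₀ g₁ g₂
        refine ⟨_, _, _, .seq (.copy ..) (.seq (e₁ ▸ h₄) (.seq (.const ..)
          (.seq (.add ..) (.sub ..)))), by omega,
          ⟨⟨(τ (i + 1)).v x, ?_⟩, ⟨?_, ?_⟩, fun j hj => ?_⟩, ?_⟩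
        · rw [St.setV_self]
          exact ((hS₄.tmp _ _).tmp _ _).tmp _ _
        · simp [g₁, e₁]
        · simp [g₂, e₂]
        · simp [hf' j hj, hf₄ j (by omega), show j ≠ r + 1 by omega, show j ≠ r + 3 by omega,
            show j ≠ r by omega]
        · simp [g₀, hr]; omega)
      (R := Function.update (Function.update R₁ (tmp (r + 1)) 0) (tmp (r + 2)) (R₁ (vreg x)))
      (M := M)
      ⟨⟨σ.v x, by
          rw [show τ 0 = σ from rfl, St.setV_self]; exact (hS₁.tmp _ _).tmp _ _⟩,
        ⟨by simp, by simp [hS₁.v]⟩,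
        fun j hj => by simp [hf₁ j hj, show j ≠ r + 2 by omega, show j ≠ r + 1 by omega]⟩
      (by simp [hv₁])
    have hS₄ := hS₃.setV x (σ.v x)
    rw [St.setV_setV] at hS₄
    have h₀ := Cmd.Exec.copy (Function.update R₁ (tmp (r + 1)) 0) M (tmp (r + 2)) (vreg x)
    simp only [ne_eq, vreg_ne_tmp, not_false_eq_true, Function.update_of_ne] at h₀
    refine ⟨Function.update R₃ (vreg x) (R₃ (tmp (r + 2))), M₃, _,
      .seq h₁ (.seq (.const ..) (.seq h₀ (.seq h₃ (.copy ..)))), ?_, ?_, fun j hj => ?_⟩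
    · have h₅ : 1 ≤ X ^ e.wt := Nat.one_le_pow _ _ (by omega)
      have h₆ : 1 ≤ X ^ c.wt := Nat.one_le_pow _ _ (by omega)
      have h₇ := Nat.mul_le_mul_right (X ^ c.wt + 4 + 2) (e.eval_le hX h)
      have h₈ : 1 ≤ X ^ e.wt * X ^ c.wt := Nat.mul_pos h₅ h₆
      have h₉ := Nat.le_mul_of_pos_right (X ^ e.wt) h₆
      simp only [wt]
      rw [pow_succ, pow_add]
      nlinarith
    · rw [hv₃.2]; exact hS₄
    · simp [hf₃ j hj]

end Ram

/-! ### Perfect elimination orderings and Dirac's theorem -/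

namespace SimpleGraph

section Elimination

variable {V : Type*} {G H : SimpleGraph V} {T T' : Finset V}

/-- The neighbours of `v` in `T` form a clique. -/
def SimplicialIn (G : SimpleGraph V) (T : Finset V) (v : V) : Prop :=
  ∀ a ∈ T, ∀ b ∈ T, G.Adj v a → G.Adj v b → a ≠ b → G.Adj a b

/-- Every nonempty subset of `T` has a simplicial vertex, so that `T` has a perfect elimination
ordering. -/
def Elim (G : SimpleGraph V) (T : Finset V) : Prop :=
  ∀ T' ⊆ T, T'.Nonempty → ∃ v ∈ T', G.SimplicialIn T' v

/-- Reachability by walks all of whose vertices after the first lie in `T`. -/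
def ConIn (G : SimpleGraph V) (T : Finset V) : V → V → Prop :=
  Relation.ReflTransGen fun x y => G.Adj x y ∧ y ∈ T

/-- Two nonadjacent neighbours `u`, `w` of `v` that are connected in `T`, where `T` has no other
neighbours of `v`. -/
structure BadTriple (G : SimpleGraph V) (T : Finset V) (v u w : V) : Prop where
  adj_left : G.Adj v u
  adj_right : G.Adj v w
  ne : u ≠ w
  not_adj : ¬ G.Adj u w
  left_mem : u ∈ T
  notMem : v ∉ T
  eq_or_eq : ∀ x ∈ T, G.Adj v x → x = u ∨ x = w
  con : G.ConIn T u w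

theorem Elim.mono (h : G.Elim T) (hT : T' ⊆ T) : G.Elim T' :=
  fun S hS => h S (hS.trans hT)

theorem ConIn.mono (hT : T ⊆ T') {u w : V} (h : G.ConIn T u w) : G.ConIn T' u w := by
  induction h with
  | refl => exact .refl
  | tail _ h ih => exact .tail ih ⟨h.1, hT h.2⟩

theorem ConIn.mem {u w : V} (h : G.ConIn T u w) (hu : u ∈ T) : w ∈ T := by
  rcases Relation.ReflTransGen.cases_tail h with rfl | ⟨b, -, hb⟩
  exacts [hu, hb.2]

theorem ConIn.symm {u w : V} (h : G.ConIn T u w) (hu : u ∈ T) : G.ConIn T w u := by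
  induction h with
  | refl => exact .refl
  | tail h₁ h₂ ih => exact .head ⟨h₂.1.symm, ConIn.mem h₁ hu⟩ ih

/-- A walk with `r` steps inside `T`. -/
structure ChainIn (G : SimpleGraph V) (T : Finset V) (u w : V) (r : ℕ) (f : ℕ → V) : Prop where
  left : f 0 = u
  right : f r = w
  mem : ∀ i ≤ r, f i ∈ T
  adj : ∀ i < r, G.Adj (f i) (f (i + 1))

theorem ConIn.exists_chainIn {u w : V} (h : G.ConIn T u w) (hu : u ∈ T) :
    ∃ r f, G.ChainIn T u w r f := by
  induction h with
  | refl => exact ⟨0, fun _ => u, rfl, rfl, fun _ _ => hu, by omega⟩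
  | @tail b c _ hc ih =>
    obtain ⟨r, f, hf⟩ := ih
    refine ⟨r + 1, fun i => if i ≤ r then f i else c, by simp [hf.left], by simp, fun i hi => ?_,
      fun i hi => ?_⟩
    · split_ifs with h
      exacts [hf.mem i h, hc.2]
    · by_cases h : i < r
      · simpa [h.le, Nat.succ_le_of_lt h] using hf.adj i h
      · obtain rfl : i = r := by omega
        simpa [hf.right] using hc.1

/-- Cuts out the s steps following position i. The first condition covers a cut that reaches the end
of the chain, the second a cut bridged by an edge. -/
theorem ChainIn.shortcut {u w : V} {r : ℕ} {f : ℕ → V} (hf : G.ChainIn T u w r f) {i s : ℕ}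
    (hi : i + s ≤ r) (he : i + s = r → f i = w) (ha : i + s < r → G.Adj (f i) (f (i + s + 1))) :
    ∃ g, G.ChainIn T u w (r - s) g := by
  refine ⟨fun k => if k ≤ i then f k else f (k + s), by simp [hf.left], ?_, fun k hk => ?_,
    fun k hk => ?_⟩
  · split_ifs with h
    · obtain rfl : r - s = i := by omega
      exact he (by omega)
    · rw [show r - s + s = r by omega, hf.right]
  · split_ifs with h
    exacts [hf.mem k (by omega), hf.mem _ (by omega)]
  · by_cases h : k + 1 ≤ i
    · rw [if_pos (by omega), if_pos h]
      exact hf.adj k (by omega)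
    · by_cases h' : k ≤ i
      · obtain rfl : k = i := by omega
        rw [if_pos le_rfl, if_neg h, show k + 1 + s = k + s + 1 by omega]
        exact ha (by omega)
      · rw [if_neg h', if_neg h, show k + 1 + s = k + s + 1 by omega]
        exact hf.adj _ (by omega)

/-- A shortest chain has neither a repeated vertex nor a chord, since either would allow a shortcut.
-/
theorem ConIn.exists_induced {u w : V} (h : G.ConIn T u w) (hu : u ∈ T) :
    ∃ r f, G.ChainIn T u w r f ∧ ∀ i j, i < j → j ≤ r →
      f i ≠ f j ∧ (G.Adj (f i) (f j) → j = i + 1) := by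
  classical
  have hex := h.exists_chainIn hu
  obtain ⟨f, hf⟩ := Nat.find_spec hex
  refine ⟨_, f, hf, fun i j hij hj => ⟨fun e => ?_, fun hadj => ?_⟩⟩
  · obtain ⟨g, hg⟩ := hf.shortcut (i := i) (s := j - i) (by omega)
      (fun h => by rw [e, ← hf.right]; congr 1; omega)
      (fun h => by rw [e, show i + (j - i) = j by omega]; exact hf.adj j (by omega))
    exact Nat.find_min hex (by omega) ⟨g, hg⟩
  · by_contra hne
    obtain ⟨g, hg⟩ := hf.shortcut (i := i) (s := j - i - 1) (by omega)
      (fun h => by omega)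
      (fun h => by rw [show i + (j - i - 1) + 1 = j by omega]; exact hadj)
    exact Nat.find_min hex (by omega) ⟨g, hg⟩

variable [DecidableEq V]

/-- A walk enters and leaves z through two neighbours of z, which are equal or adjacent, so it can
bypass z. -/
theorem ConIn.erase_simplicial {u w z : V} (h : G.ConIn T u w) (hu : u ∈ T) (huz : u ≠ z)
    (hwz : w ≠ z) (hz : G.SimplicialIn T z) : G.ConIn (T.erase z) u w := by
  suffices H : ∀ y, G.ConIn T u y → (y ≠ z → G.ConIn (T.erase z) u y) ∧
      (y = z → ∃ p ∈ T, p ≠ z ∧ G.Adj z p ∧ G.ConIn (T.erase z) u p) from (H w h).1 hwz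
  intro y hy
  induction hy with
  | refl => exact ⟨fun _ => .refl, fun h => absurd h huz⟩
  | @tail y c hy hc ih =>
    refine ⟨fun hcz => ?_, fun hcz => ?_⟩
    · by_cases hyz : y = z
      · obtain ⟨p, hp, hpz, hzp, hup⟩ := ih.2 hyz
        by_cases hpc : p = c
        · exact hpc ▸ hup
        · exact .tail hup ⟨hz p hp c hc.2 hzp (hyz ▸ hc.1) hpc, Finset.mem_erase.2 ⟨hcz, hc.2⟩⟩
      · exact .tail (ih.1 hyz) ⟨hc.1, Finset.mem_erase.2 ⟨hcz, hc.2⟩⟩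
    · subst hcz
      have hyz : y ≠ c := hc.1.ne
      exact ⟨y, ConIn.mem hy hu, hyz, hc.1.symm, ih.1 hyz⟩

/-- Induction on T. A simplicial vertex z of T ∪ {v} is not v, as u and w are not adjacent. Nor is
it u or w: its neighbour on the walk would be adjacent to v, hence would be u or w, which is
impossible. Any other z is deleted without destroying the triple. -/
theorem BadTriple.not_elim {v u w : V} (h : G.BadTriple T v u w) : ¬ G.Elim (insert v T) := by
  induction T using Finset.strongInduction with
  | H T ih =>
  intro hE
  have hwT : w ∈ T := h.con.mem h.left_mem
  obtain ⟨z, hz, hs⟩ := hE _ subset_rfl ⟨v, by simp⟩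
  rcases Finset.mem_insert.1 hz with rfl | hzT
  · exact h.not_adj (hs u (by simp [h.left_mem]) w (by simp [hwT]) h.adj_left h.adj_right h.ne)
  by_cases hzu : z = u
  · subst hzu
    rcases Relation.ReflTransGen.cases_head h.con with e | ⟨c, hc, -⟩
    · exact h.ne e
    · have hcv : c ≠ v := fun e => h.notMem (e ▸ hc.2)
      have := hs v (by simp) c (by simp [hc.2]) h.adj_left.symm hc.1 hcv.symm
      rcases h.eq_or_eq c hc.2 this with rfl | rfl
      exacts [hc.1.ne rfl, h.not_adj hc.1]
  by_cases hzw : z = w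
  · subst hzw
    rcases Relation.ReflTransGen.cases_tail h.con with e | ⟨c, hcon, hc⟩
    · exact h.ne e.symm
    · have hcT := ConIn.mem hcon h.left_mem
      have hcv : c ≠ v := fun e => h.notMem (e ▸ hcT)
      have := hs v (by simp) c (by simp [hcT]) h.adj_right.symm hc.1.symm hcv.symm
      rcases h.eq_or_eq c hcT this with rfl | rfl
      exacts [h.not_adj hc.1, hc.1.ne rfl]
  · refine ih (T.erase z) (Finset.erase_ssubset hzT) ?_
      (hE.mono (Finset.insert_subset_insert _ (Finset.erase_subset _ _)))
    exact ⟨h.adj_left, h.adj_right, h.ne, h.not_adj,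
      Finset.mem_erase.2 ⟨fun e => hzu e.symm, h.left_mem⟩,
      fun hv => h.notMem (Finset.mem_of_mem_erase hv),
      fun x hx => h.eq_or_eq x (Finset.mem_of_mem_erase hx),
      h.con.erase_simplicial h.left_mem (fun e => hzu e.symm) (fun e => hzw e.symm)
        fun a ha b hb => hs a (by simp [ha]) b (by simp [hb])⟩

/-- Any two vertices of `B` are connected inside `B`. -/
def ConnectedOn (G : SimpleGraph V) (B : Finset V) : Prop :=
  ∀ a ∈ B, ∀ b ∈ B, G.ConIn B a b

theorem ConnectedOn.insert {B : Finset V} (h : G.ConnectedOn B) {b s : V} (hb : b ∈ B)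
    (hs : G.Adj b s) : G.ConnectedOn (insert s B) := by
  have h₁ : ∀ a ∈ B, G.ConIn (Insert.insert s B) a s := fun a ha =>
    .tail ((h a ha b hb).mono (Finset.subset_insert _ _)) ⟨hs, by simp⟩
  intro a ha c hc
  rcases Finset.mem_insert.1 ha with rfl | ha' <;> rcases Finset.mem_insert.1 hc with rfl | hc'
  · exact .refl
  · exact (h₁ c hc').symm hc
  · exact h₁ a ha'
  · exact (h a ha' c hc').mono (Finset.subset_insert _ _)

/-- Dirac's theorem: a set without bad triples has a simplicial vertex. -/
theorem exists_simplicialIn (hT : T.Nonempty)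
    (h : ∀ T' ⊆ T, ∀ v ∈ T, ∀ u w, ¬ G.BadTriple T' v u w) : ∃ z ∈ T, G.SimplicialIn T z := by
  classical
  induction T using Finset.strongInduction with
  | H T ih =>
  -- Dirac's argument: choose a vertex v and a nonempty connected set B disjoint from v and without
  -- neighbours of v, with B as large as possible. If no such pair exists, T is a clique.
  set F := (T ×ˢ T.powerset).filter fun p => p.2.Nonempty ∧ G.ConnectedOn p.2 ∧
    ∀ b ∈ p.2, b ≠ p.1 ∧ ¬ G.Adj p.1 b with hF
  have memF : ∀ p, p ∈ F ↔ (p.1 ∈ T ∧ p.2 ⊆ T) ∧ p.2.Nonempty ∧ G.ConnectedOn p.2 ∧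
      ∀ b ∈ p.2, b ≠ p.1 ∧ ¬ G.Adj p.1 b := fun p => by
    simp [hF, Finset.mem_product]
  rcases F.eq_empty_or_nonempty with hE | hne
  · obtain ⟨z, hz⟩ := hT
    refine ⟨z, hz, fun a ha b hb _ _ hab => ?_⟩
    by_contra hadj
    have : (a, {b}) ∈ F := (memF _).2 ⟨⟨ha, by simpa using hb⟩, by simp,
      by intro x hx y hy; simp at hx hy; subst hx; subst hy; exact .refl,
      by simp; exact ⟨fun e => hab e.symm, hadj⟩⟩
    simp [hE] at this
  · obtain ⟨⟨v, B⟩, hvB, hmax⟩ := Finset.exists_max_image F (fun p => p.2.card) hne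
    obtain ⟨⟨hv, hBT⟩, hBne, hBc, hBv⟩ := (memF _).1 hvB
    dsimp only at hv hBT hBne hBc hBv
    set S := T.filter fun x => x ∉ B ∧ ∃ b ∈ B, G.Adj b x with hS
    set R := T.filter fun x => x ∉ B ∧ ¬ ∃ b ∈ B, G.Adj b x with hR
    have hvR : v ∈ R := by
      simp only [hR, Finset.mem_filter]
      exact ⟨hv, fun hvB => (hBv v hvB).1 rfl, fun ⟨b, hb, hbv⟩ => (hBv b hb).2 hbv.symm⟩
    -- A missing edge ys would let y and B ∪ {s} contradict the maximality of B.
    have joined : ∀ y ∈ R, ∀ s ∈ S, G.Adj y s := by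
      intro y hy s hs
      simp only [hR, hS, Finset.mem_filter] at hy hs
      obtain ⟨hyT, hyB, hyN⟩ := hy
      obtain ⟨hsT, hsB, b, hb, hbs⟩ := hs
      by_contra hys
      have : (y, insert s B) ∈ F := by
        refine (memF _).2 ⟨⟨hyT, Finset.insert_subset hsT hBT⟩, by simp, hBc.insert hb hbs, ?_⟩
        intro c hc
        rcases Finset.mem_insert.1 hc with rfl | hcB
        · refine ⟨?_, hys⟩
          rintro rfl
          exact hyN ⟨b, hb, hbs⟩
        · exact ⟨fun e => hyB ((show c = y from e) ▸ hcB), fun e => hyN ⟨c, hcB, e.symm⟩⟩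
      have := hmax _ this
      simp [hsB] at this
    -- Both a and b are adjacent to v and connected through B, which contains no neighbour of v;
    -- nonadjacency would give a bad triple.
    have clique : ∀ a ∈ S, ∀ b ∈ S, a ≠ b → G.Adj a b := by
      intro a ha b hb hab
      have hva := joined v hvR a ha
      have hvb := joined v hvR b hb
      simp only [hS, Finset.mem_filter] at ha hb
      obtain ⟨haT, haB, a', ha', haa⟩ := ha
      obtain ⟨hbT, hbB, b', hb', hbb⟩ := hb
      by_contra hadj
      refine h (insert a (insert b B)) (Finset.insert_subset haT (Finset.insert_subset hbT hBT))
        v hv a b ⟨hva, hvb, hab, hadj, by simp, ?_, ?_, ?_⟩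
      · simp only [Finset.mem_insert, not_or]
        exact ⟨hva.ne, hvb.ne, fun hvB => (hBv v hvB).1 rfl⟩
      · intro x hx hvx
        simp only [Finset.mem_insert] at hx
        rcases hx with hx | hx | hx
        exacts [.inl hx, .inr hx, absurd hvx (hBv x hx).2]
      · refine .head (b := a') ⟨haa.symm, by simp [ha']⟩ (.tail (b := b') ?_ ⟨hbb, by simp⟩)
        exact (hBc a' ha' b' hb').mono fun x hx => by simp [hx]
    have hRT : R ⊂ T := by
      refine Finset.filter_ssubset.2 ?_
      obtain ⟨b, hb⟩ := hBne
      exact ⟨b, hBT hb, fun h => h.1 hb⟩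
    -- Vertices of R have no neighbours in B. All neighbours of z lie in R ∪ S, and S is a clique
    -- joined completely to R, so being simplicial in R suffices.
    obtain ⟨z, hzR, hz⟩ := ih R hRT ⟨v, hvR⟩ fun T' hT' x hx =>
      h T' (hT'.trans hRT.1) x (hRT.1 hx)
    have split : ∀ a ∈ T, G.Adj z a → a ∈ R ∨ a ∈ S := by
      intro a ha hza
      simp only [hR, hS, Finset.mem_filter] at hzR ⊢
      have : a ∉ B := fun haB => hzR.2.2 ⟨a, haB, hza.symm⟩
      tauto
    refine ⟨z, hRT.1 hzR, fun a ha b hb hza hzb hab => ?_⟩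
    rcases split a ha hza with ha' | ha' <;> rcases split b hb hzb with hb' | hb'
    · exact hz a ha' b hb' hza hzb hab
    · exact joined a ha' b hb'
    · exact (joined b hb' a ha').symm
    · exact clique a ha' b hb' hab

theorem exists_badTriple (h : ¬ G.Elim T) :
    ∃ T' ⊆ T, ∃ v ∈ T, ∃ u w, G.BadTriple T' v u w := by
  simp only [Elim, not_forall] at h
  obtain ⟨S, hS, hne, h⟩ := h
  by_contra hcon
  refine h (exists_simplicialIn hne fun T' hT' v hv u w hb => hcon ?_)
  exact ⟨T', hT'.trans hS, v, hS hv, u, w, hb⟩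

theorem cycleGraph_adj_iff_val {m : ℕ} {i j : Fin (m + 4)} :
    (cycleGraph (m + 4)).Adj i j ↔ i.val + 1 = j.val ∨ j.val + 1 = i.val ∨
      (i.val = 0 ∧ j.val = m + 3) ∨ (j.val = 0 ∧ i.val = m + 3) := by
  rw [cycleGraph_adj']
  have hi := i.isLt
  have hj := j.isLt
  rcases lt_trichotomy i.val j.val with h | h | h
  · rw [Fin.coe_sub_iff_lt.2 (Fin.lt_def.2 h), Fin.sub_val_of_le (Fin.le_def.2 h.le)]
    omega
  · have : i = j := Fin.ext h
    subst this
    rw [sub_self, Fin.val_zero]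
    omega
  · rw [Fin.coe_sub_iff_lt.2 (Fin.lt_def.2 h), Fin.sub_val_of_le (Fin.le_def.2 h.le)]
    omega

/-- An induced path from u to w in T, closed up through v, is an induced cycle because v sees only
the two ends. The path has at least two steps since u and w are distinct and not adjacent, so the
cycle has length at least 4. -/
theorem BadTriple.exists_cycle {v u w : V} (h : G.BadTriple T v u w) :
    ∃ m, ∃ φ : cycleGraph (m + 4) ↪g G, ∀ i, φ i ∈ insert v T := by
  obtain ⟨r, f, hf, hind⟩ := h.con.exists_induced h.left_mem
  have hr0 : r ≠ 0 := by
    rintro rfl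
    exact h.ne (hf.left.symm.trans hf.right)
  have hr1 : r ≠ 1 := by
    rintro rfl
    have := hf.adj 0 (by omega)
    rw [hf.left, zero_add, hf.right] at this
    exact h.not_adj this
  obtain ⟨m, rfl⟩ : ∃ m, r = m + 2 := ⟨r - 2, by omega⟩
  have hfv : ∀ i ≤ m + 2, f i ≠ v := fun i hi e => h.notMem (e ▸ hf.mem i hi)
  have hvf : ∀ i ≤ m + 2, G.Adj v (f i) ↔ i = 0 ∨ i = m + 2 := by
    refine fun i hi => ⟨fun ha => ?_, ?_⟩
    · by_contra hne
      rcases h.eq_or_eq _ (hf.mem i hi) ha with e | e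
      · rw [← hf.left] at e
        exact (hind 0 i (by omega) hi).1 e.symm
      · rw [← hf.right] at e
        exact (hind i (m + 2) (by omega) le_rfl).1 e
    · rintro (rfl | rfl)
      · rw [hf.left]; exact h.adj_left
      · rw [hf.right]; exact h.adj_right
  have hff : ∀ i j, i < j → j ≤ m + 2 → (G.Adj (f i) (f j) ↔ j = i + 1) := by
    refine fun i j hij hj => ⟨(hind i j hij hj).2, ?_⟩
    rintro rfl
    exact hf.adj i (by omega)
  let g : Fin (m + 4) → V := fun i => if i.val ≤ m + 2 then f i.val else v
  have hg : ∀ i j : Fin (m + 4), i.val < j.val →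
      g i ≠ g j ∧ (G.Adj (g i) (g j) ↔ i.val + 1 = j.val ∨ (i.val = 0 ∧ j.val = m + 3)) := by
    intro i j hij
    have hj := j.isLt
    simp only [g]
    rw [if_pos (by omega)]
    split_ifs with h'
    · refine ⟨(hind _ _ hij h').1, ?_⟩
      rw [hff _ _ hij h']
      omega
    · refine ⟨hfv _ (by omega), ?_⟩
      rw [G.adj_comm, hvf _ (by omega)]
      omega
  refine ⟨m, ⟨⟨g, fun i j e => ?_⟩, fun {i j} => ?_⟩, fun i => ?_⟩
  · rcases lt_trichotomy i.val j.val with h' | h' | h'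
    exacts [absurd e (hg i j h').1, Fin.ext h', absurd e.symm (hg j i h').1]
  · change G.Adj (g i) (g j) ↔ _
    rw [cycleGraph_adj_iff_val]
    rcases lt_trichotomy i.val j.val with h' | h' | h'
    · rw [(hg i j h').2]; omega
    · have : i = j := Fin.ext h'
      subst this
      simp only [SimpleGraph.irrefl, false_iff]
      omega
    · rw [G.adj_comm, (hg j i h').2]; omega
  · change g i ∈ _
    simp only [g]
    split_ifs with h'
    · exact Finset.mem_insert_of_mem (hf.mem _ h')
    · simp

theorem IsChordal.elim (h : G.IsChordal) (T : Finset V) : G.Elim T := by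
  by_contra hE
  obtain ⟨T', -, v, -, u, w, hb⟩ := exists_badTriple hE
  obtain ⟨m, φ, -⟩ := hb.exists_cycle
  exact h (m + 4) (by omega) ⟨φ⟩

end Elimination

end SimpleGraph

/-! ### Completions, minimal obstructions and contraction -/

namespace SimpleGraph

section Completion

variable {V : Type*} {G H : SimpleGraph V} {T : Finset V}

/-- At most `d` additional edges turn `H` into a graph with a perfect elimination ordering
of `T`. -/
def FillLE (H : SimpleGraph V) (T : Finset V) (d : ℕ) : Prop :=
  ∃ G : SimpleGraph V, H ≤ G ∧ G.Elim T ∧ ∃ A : Finset (Sym2 V), A.card ≤ d ∧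
    ∀ x y, G.Adj x y → ¬ H.Adj x y → s(x, y) ∈ A

theorem Elim.fillLE (h : H.Elim T) (d : ℕ) : H.FillLE T d :=
  ⟨H, le_rfl, h, ∅, by simp, fun _ _ h h' => absurd h h'⟩

variable [DecidableEq V]

/-- On the vertex set of an induced cycle of length at least 4 no vertex is simplicial: its two
cycle neighbours are distinct and not adjacent. -/
theorem not_elim_of_cycle {m : ℕ} (φ : cycleGraph (m + 4) ↪g G) (hφ : ∀ i, φ i ∈ T) :
    ¬ G.Elim T := by
  intro h
  obtain ⟨v, hv, hs⟩ := h (Finset.univ.image φ) (by simpa [Finset.image_subset_iff] using hφ)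
    ⟨φ 0, by simp⟩
  obtain ⟨i, -, rfl⟩ := Finset.mem_image.1 hv
  have hval : ∀ j : Fin (m + 4), j.val < m + 4 := fun j => j.isLt
  have hs' : ∀ j k : Fin (m + 4), (cycleGraph (m + 4)).Adj i j → (cycleGraph (m + 4)).Adj i k →
      j ≠ k → (cycleGraph (m + 4)).Adj j k := fun j k hj hk hjk =>
    φ.map_adj_iff.1 (hs (φ j) (by simp) (φ k) (by simp) (φ.map_adj_iff.2 hj) (φ.map_adj_iff.2 hk)
      (fun e => hjk (φ.injective e)))
  simp only [cycleGraph_adj_iff_val, Fin.ext_iff, ne_eq] at hs'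
  obtain ⟨j, hj⟩ : ∃ j : Fin (m + 4), j.val = if i.val = m + 3 then 0 else i.val + 1 :=
    ⟨⟨if i.val = m + 3 then 0 else i.val + 1, by have := hval i; split_ifs <;> omega⟩, rfl⟩
  obtain ⟨k, hk⟩ : ∃ k : Fin (m + 4), k.val = if i.val = 0 then m + 3 else i.val - 1 :=
    ⟨⟨if i.val = 0 then m + 3 else i.val - 1, by have := hval i; split_ifs <;> omega⟩, rfl⟩
  have := hs' j k
  have := hval i
  split_ifs at hj hk <;> omega

theorem val_nsmul_one {m : ℕ} (k : ℕ) : (k • (1 : Fin (m + 4))).val = k % (m + 4) := by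
  induction k with
  | zero => simp
  | succ k ih =>
    rw [succ_nsmul, Fin.val_add, ih]
    simp

/-- An inclusion-minimal set without perfect elimination ordering is at most twice as large as a set
of vertices that covers the additional edges of a supergraph with a perfect elimination
ordering. -/
theorem card_le_of_minimal {S X : Finset V} (hS : ¬ H.Elim S)
    (hmin : ∀ x ∈ S, H.Elim (S.erase x)) (hle : H ≤ G) (hG : G.Elim S)
    (hX : ∀ x ∈ S, ∀ y ∈ S, G.Adj x y → ¬ H.Adj x y → x ∈ X ∧ y ∈ X) : S.card ≤ 2 * X.card := by
  obtain ⟨T', hT', v, hv, u, w, hb⟩ := exists_badTriple hS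
  obtain ⟨m, φ, hφ⟩ := hb.exists_cycle
  have hφS : ∀ i, φ i ∈ S := fun i => (Finset.insert_subset hv hT') (hφ i)
  have hSφ : ∀ x ∈ S, ∃ i, φ i = x := by
    intro x hx
    by_contra hne
    exact not_elim_of_cycle φ
      (fun i => Finset.mem_erase.2 ⟨fun e => hne ⟨i, e⟩, hφS i⟩) (hmin x hx)
  -- If two consecutive vertices avoid X, then within S each keeps in G only its cycle neighbours.
  -- The first one, its two neighbours and the rest of the cycle then form a bad triple in G,
  -- contradicting `Elim`.
  have claim : ∀ i, φ i ∈ X ∨ φ (i + 1) ∈ X := by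
    intro i
    by_contra hcon
    obtain ⟨h₀, h₁⟩ := not_or.1 hcon
    have hadj : ∀ j, G.Adj (φ i) (φ j) → (cycleGraph (m + 4)).Adj i j := fun j hj => by
      by_contra hne
      exact h₀ (hX _ (hφS i) _ (hφS j) hj (fun h => hne (φ.map_adj_iff.1 h))).1
    have hadj₁ : ∀ j, G.Adj (φ (i + 1)) (φ j) → (cycleGraph (m + 4)).Adj (i + 1) j :=
      fun j hj => by
        by_contra hne
        exact h₁ (hX _ (hφS _) _ (hφS j) hj (fun h => hne (φ.map_adj_iff.1 h))).1
    have hstep : ∀ j : Fin (m + 4), (cycleGraph (m + 4)).Adj j (j + 1) := fun j => by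
      rw [cycleGraph_adj]; right; simp
    have hne : ∀ j k, φ j = φ k ↔ j = k := fun j k => φ.injective.eq_iff
    have hpath : ∀ k, k ≤ m + 2 → G.ConIn (S.erase (φ i)) (φ (i + 1)) (φ (i + 1 + k • 1)) := by
      intro k
      induction k with
      | zero => intro _; rw [zero_nsmul, add_zero]; exact .refl
      | succ k ih =>
        intro hk
        refine .tail (ih (by omega)) ⟨?_, ?_⟩
        · rw [succ_nsmul, ← add_assoc]
          exact hle (φ.map_adj_iff.2 (hstep _))
        · refine Finset.mem_erase.2 ⟨fun e => ?_, hφS _⟩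
          rw [hne, add_assoc, add_eq_left, add_comm (1 : Fin (m + 4)), ← succ_nsmul] at e
          have := congrArg Fin.val e
          rw [val_nsmul_one, Nat.mod_eq_of_lt (by omega), Fin.val_zero] at this
          omega
    have hwrap : i + 1 + (m + 2) • (1 : Fin (m + 4)) = i - 1 := by
      have : (m + 4) • (1 : Fin (m + 4)) = 0 := by
        ext; rw [val_nsmul_one]; simp
      rw [succ_nsmul _ (m + 3), succ_nsmul _ (m + 2)] at this
      rw [eq_sub_iff_add_eq, add_assoc i, add_comm (1 : Fin (m + 4)), add_assoc i, this, add_zero]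
    have hsub : ∀ j k : Fin (m + 4), (cycleGraph (m + 4)).Adj j k ↔ k = j - 1 ∨ k = j + 1 := by
      intro j k
      rw [cycleGraph_adj, sub_eq_iff_eq_add, sub_eq_iff_eq_add, eq_sub_iff_add_eq,
        add_comm 1 k, add_comm 1 j, @eq_comm _ j]
    have h₂ : ∀ j : Fin (m + 4), j + 1 ≠ j - 1 ∧ ¬ (cycleGraph (m + 4)).Adj (j + 1) (j - 1) := by
      intro j
      have h2 : (2 • (1 : Fin (m + 4))).val = 2 := by
        rw [val_nsmul_one]; exact Nat.mod_eq_of_lt (by omega)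
      have h3 : (3 • (1 : Fin (m + 4))).val = 3 := by
        rw [val_nsmul_one]; exact Nat.mod_eq_of_lt (by omega)
      have h1 : ((1 : Fin (m + 4))).val = 1 := rfl
      have h0 : ((0 : Fin (m + 4))).val = 0 := rfl
      rw [hsub]
      refine ⟨fun e => ?_, ?_⟩
      · have : 2 • (1 : Fin (m + 4)) = 0 := by
          rw [eq_sub_iff_add_eq, add_assoc, add_eq_left] at e
          rw [two_nsmul, e]
        rw [this] at h2; omega
      · rintro (e | e)
        · rw [add_sub_cancel_right, sub_eq_self] at e
          rw [e] at h1; omega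
        · have : 3 • (1 : Fin (m + 4)) = 0 := by
            rw [sub_eq_iff_eq_add, add_assoc, add_assoc, left_eq_add] at e
            rw [succ_nsmul, two_nsmul, add_assoc, e]
          rw [this] at h3; omega
    have hbad : G.BadTriple (S.erase (φ i)) (φ i) (φ (i + 1)) (φ (i - 1)) := by
      refine ⟨hle (φ.map_adj_iff.2 (hstep i)), hle (φ.map_adj_iff.2 ((hsub _ _).2 (.inl rfl))),
        fun e => (h₂ i).1 ((hne _ _).1 e), fun h => (h₂ i).2 (hadj₁ _ h),
        Finset.mem_erase.2 ⟨fun e => ?_, hφS _⟩, by simp, ?_, hwrap ▸ hpath (m + 2) le_rfl⟩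
      · exact (hstep i).ne ((hne _ _).1 e).symm
      · intro x hx hix
        obtain ⟨j, rfl⟩ := hSφ x (Finset.mem_of_mem_erase hx)
        rcases (hsub _ _).1 (hadj j hix) with rfl | rfl
        exacts [.inr rfl, .inl rfl]
    have := hbad.not_elim
    rw [Finset.insert_erase (hφS i)] at this
    exact this hG
  have hScard : S.card ≤ m + 4 := by
    calc S.card ≤ (Finset.univ.image φ).card := Finset.card_le_card fun x hx => by
          obtain ⟨i, rfl⟩ := hSφ x hx; simp
      _ ≤ m + 4 := Finset.card_image_le.trans (by simp)
  set I := Finset.univ.filter fun i => φ i ∈ X with hI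
  have hIX : I.card ≤ X.card := by
    rw [← Finset.card_image_of_injective I φ.injective]
    refine Finset.card_le_card fun x hx => ?_
    obtain ⟨i, hi, rfl⟩ := Finset.mem_image.1 hx
    exact (Finset.mem_filter.1 hi).2
  -- The successor map injects the positions outside X into those inside X, so at least half of the
  -- cycle lies in X.
  have hIc : Iᶜ.card ≤ I.card := by
    refine Finset.card_le_card_of_injOn (fun i => i + 1) (fun i hi => ?_)
      (fun i _ j _ h => add_right_cancel h)
    simp only [hI, Finset.coe_compl, Finset.coe_filter, Finset.mem_univ, true_and,
      Set.mem_compl_iff, Set.mem_ofPred_eq] at hi ⊢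
    exact (claim i).resolve_left hi
  have := Finset.card_add_card_compl I
  rw [Fintype.card_fin] at this
  omega

/-- Identify `q` with the vertex `p`; afterwards `q` is isolated. -/
def contractInto (H : SimpleGraph V) (p q : V) : SimpleGraph V where
  Adj i j := i ≠ j ∧ i ≠ q ∧ j ≠ q ∧ (H.Adj i j ∨ (i = p ∧ H.Adj q j) ∨ (j = p ∧ H.Adj i q))
  symm := ⟨fun i j ⟨h₁, h₂, h₃, h⟩ => ⟨h₁.symm, h₃, h₂, by
    rcases h with h | ⟨h, h'⟩ | ⟨h, h'⟩
    exacts [.inl h.symm, .inr (.inr ⟨h, h'.symm⟩), .inr (.inl ⟨h, h'.symm⟩)]⟩⟩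
  loopless := ⟨fun i h => h.1 rfl⟩

/-- Work in a set S containing p but not q; if q is in S it is isolated there, and without p nothing
changes on S. Let z be simplicial in S ∪ {q} for G. If z is neither p nor q, it stays simplicial
after contraction. If z = p, all neighbours of p are neighbours of q, so the contracted graph on S
is a copy of G on S with p replaced by q. If z = q, all other neighbours of q are neighbours of p,
so it is G on S itself. -/
theorem Elim.contractInto (h : G.Elim T) {p q : V} (hp : p ∈ T) (hq : q ∈ T) (hpq : G.Adj p q) :
    (G.contractInto p q).Elim T := by
  intro S hS hne
  by_cases hqS : q ∈ S
  · exact ⟨q, hqS, fun a _ b _ ha => absurd rfl ha.2.1⟩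
  have hSq : ∀ a ∈ S, a ≠ q := fun a ha e => hqS (e ▸ ha)
  by_cases hpS : p ∈ S
  swap
  · obtain ⟨v, hv, hs⟩ := h S hS hne
    have hSp : ∀ a ∈ S, a ≠ p := fun a ha e => hpS (e ▸ ha)
    refine ⟨v, hv, fun a ha b hb hva hvb hab => ?_⟩
    have key : ∀ a ∈ S, (G.contractInto p q).Adj v a → G.Adj v a := by
      rintro a ha ⟨-, -, -, h | ⟨h, -⟩ | ⟨h, -⟩⟩
      exacts [h, absurd h (hSp v hv), absurd h (hSp a ha)]
    exact ⟨hab, hSq a ha, hSq b hb, .inl (hs a ha b hb (key a ha hva) (key b hb hvb) hab)⟩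
  obtain ⟨z, hz, hs⟩ := h (insert q S) (Finset.insert_subset hq hS) ⟨q, by simp⟩
  have qi : q ∈ insert q S := by simp
  have si : ∀ a ∈ S, a ∈ insert q S := fun a ha => by simp [ha]
  by_cases hzp : z = p
  · subst hzp
    -- all neighbours of `p` are neighbours of `q`
    have hN : ∀ a ∈ S, G.Adj z a → G.Adj q a := fun a ha hza =>
      (hs a (si a ha) q qi hza hpq (hSq a ha)).symm
    obtain ⟨y, hy, ht⟩ := h (insert q (S.erase z))
      (Finset.insert_subset hq ((Finset.erase_subset _ _).trans hS)) ⟨q, by simp⟩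
    have ei : ∀ a ∈ S, a ≠ z → a ∈ insert q (S.erase z) := fun a ha haz => by simp [ha, haz]
    rcases Finset.mem_insert.1 hy with rfl | hyS
    · have key : ∀ a ∈ S, (G.contractInto z y).Adj z a → a ≠ z ∧ G.Adj y a := by
        rintro a ha ⟨hne, -, -, h | ⟨-, h⟩ | ⟨h, -⟩⟩
        exacts [⟨hne.symm, hN a ha h⟩, ⟨hne.symm, h⟩, absurd h.symm hne]
      refine ⟨z, hpS, fun a ha b hb hza hzb hab => ?_⟩
      obtain ⟨ha₁, ha₂⟩ := key a ha hza
      obtain ⟨hb₁, hb₂⟩ := key b hb hzb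
      exact ⟨hab, hSq a ha, hSq b hb,
        .inl (ht a (ei a ha ha₁) b (ei b hb hb₁) ha₂ hb₂ hab)⟩
    · obtain ⟨hyz, hyS⟩ := Finset.mem_erase.1 hyS
      have key : ∀ a ∈ S, a ≠ z → (G.contractInto z q).Adj y a → G.Adj y a := by
        rintro a ha haz ⟨-, -, -, h | ⟨h, -⟩ | ⟨h, -⟩⟩
        exacts [h, absurd h hyz, absurd h haz]
      have key' : (G.contractInto z q).Adj y z → G.Adj y q := by
        rintro ⟨-, -, -, h | ⟨h, -⟩ | ⟨-, h⟩⟩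
        exacts [(hN y hyS h.symm).symm, absurd h hyz, h]
      refine ⟨y, hyS, fun a ha b hb hya hyb hab => ?_⟩
      by_cases haz : a = z
      · subst haz
        exact ⟨hab, hSq _ ha, hSq _ hb, .inr (.inl ⟨rfl, ht q (by simp) b (ei b hb hab.symm)
          (key' hya) (key b hb hab.symm hyb) (hSq b hb).symm⟩)⟩
      · by_cases hbz : b = z
        · subst hbz
          exact ⟨hab, hSq _ ha, hSq _ hb, .inr (.inr ⟨rfl, ht a (ei a ha haz) q (by simp)
            (key a ha haz hya) (key' hyb) (hSq a ha)⟩)⟩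
        · exact ⟨hab, hSq _ ha, hSq _ hb, .inl (ht a (ei a ha haz) b (ei b hb hbz)
            (key a ha haz hya) (key b hb hbz hyb) hab)⟩
  by_cases hzq : z = q
  · subst hzq
    have hN : ∀ a ∈ S, a ≠ p → G.Adj z a → G.Adj p a := fun a ha hap hza =>
      hs p (si p hpS) a (si a ha) hpq.symm hza hap.symm
    obtain ⟨y, hy, ht⟩ := h S hS hne
    have key : ∀ a ∈ S, (G.contractInto p z).Adj y a → G.Adj y a := by
      rintro a ha ⟨hne, -, -, h | ⟨rfl, h⟩ | ⟨rfl, h⟩⟩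
      exacts [h, hN a ha hne.symm h, (hN y hy hne h.symm).symm]
    exact ⟨y, hy, fun a ha b hb hya hyb hab => ⟨hab, hSq _ ha, hSq _ hb,
      .inl (ht a ha b hb (key a ha hya) (key b hb hyb) hab)⟩⟩
  · have hzS : z ∈ S := (Finset.mem_insert.1 hz).resolve_left hzq
    have key : ∀ a ∈ S, a ≠ p → (G.contractInto p q).Adj z a → G.Adj z a := by
      rintro a ha hap ⟨-, -, -, h | ⟨h, -⟩ | ⟨h, -⟩⟩
      exacts [h, absurd h hzp, absurd h hap]
    have key' : (G.contractInto p q).Adj z p → G.Adj z p ∨ G.Adj z q := by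
      rintro ⟨-, -, -, h | ⟨h, -⟩ | ⟨-, h⟩⟩
      exacts [.inl h, absurd h hzp, .inr h]
    have keyp : ∀ b ∈ S, b ≠ p → (G.contractInto p q).Adj z p → G.Adj z b →
        G.Adj p b ∨ G.Adj q b := fun b hb hbp hzp' hzb => by
      rcases key' hzp' with h' | h'
      · exact .inl (hs p (si p hpS) b (si b hb) h' hzb hbp.symm)
      · exact .inr (hs q qi b (si b hb) h' hzb (hSq b hb).symm)
    refine ⟨z, hzS, fun a ha b hb hza hzb hab => ⟨hab, hSq _ ha, hSq _ hb, ?_⟩⟩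
    by_cases hap : a = p
    · subst hap
      rcases keyp b hb hab.symm hza (key b hb hab.symm hzb) with h' | h'
      exacts [.inl h', .inr (.inl ⟨rfl, h'⟩)]
    · by_cases hbp : b = p
      · subst hbp
        rcases keyp a ha hap hzb (key a ha hap hza) with h' | h'
        exacts [.inl h'.symm, .inr (.inr ⟨rfl, h'.symm⟩)]
      · exact .inl (hs a (si a ha) b (si b hb) (key a ha hap hza) (key b hb hbp hzb) hab)

theorem FillLE.of_sup_edge {p q : V} {d : ℕ} (h : (H ⊔ edge p q).FillLE T d) :
    H.FillLE T (d + 1) := by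
  obtain ⟨G, hle, hG, A, hA, hAG⟩ := h
  refine ⟨G, le_sup_left.trans hle, hG, insert s(p, q) A,
    (Finset.card_insert_le _ _).trans (by omega), fun x y hxy hn => ?_⟩
  by_cases hs : s(x, y) = s(p, q)
  · simp [hs]
  · refine Finset.mem_insert_of_mem (hAG x y hxy ?_)
    rw [sup_adj, edge_adj, ← Sym2.eq_iff]
    tauto

/-- If `H` has a completion with at most `d + 1` additional edges, then a minimal set `S` witnessing
that `H` is not chordal has at most `4 (d + 1)` elements, and adding or contracting some
pair of vertices of `S` reduces the number of additional edges. -/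
theorem FillLE.exists_pair {d : ℕ} {S : Finset V} (h : H.FillLE T (d + 1)) (hST : S ⊆ T)
    (hS : ¬ H.Elim S) (hmin : ∀ x ∈ S, H.Elim (S.erase x)) :
    S.card ≤ 4 * (d + 1) ∧ ∃ p ∈ S, ∃ q ∈ S, p ≠ q ∧ ¬ H.Adj p q ∧
      (H ⊔ edge p q).FillLE T d ∧ (H.contractInto p q).FillLE T d ∧
      (H.contractInto q p).FillLE T d := by
  obtain ⟨G, hle, hG, A, hA, hAG⟩ := h
  constructor
  -- With X the set of ends of the added edges, |X| ≤ 2(d + 1).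
  · have := card_le_of_minimal (X := A.biUnion Sym2.toFinset) hS hmin hle (hG.mono hST)
      (fun x _ y _ hxy hn => by
        simp only [Finset.mem_biUnion, Sym2.mem_toFinset]
        exact ⟨⟨_, hAG x y hxy hn, by simp⟩, ⟨_, hAG x y hxy hn, by simp⟩⟩)
    have h₂ : (A.biUnion Sym2.toFinset).card ≤ A.card * 2 := by
      refine Finset.card_biUnion_le_card_mul _ _ _ fun e _ => ?_
      rw [Sym2.card_toFinset]
      split_ifs <;> omega
    omega
  -- Without an added edge inside S, the graphs G and H would agree on S and H would inherit
  -- elimination from G.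
  · have hex : ∃ p ∈ S, ∃ q ∈ S, G.Adj p q ∧ ¬ H.Adj p q := by
      by_contra hcon
      push Not at hcon
      refine hS fun S' hS' hne => ?_
      obtain ⟨v, hv, hs⟩ := (hG.mono hST) S' hS' hne
      exact ⟨v, hv, fun a ha b hb hva hvb hab => hcon a (hS' ha) b (hS' hb)
        (hs a ha b hb (hle hva) (hle hvb) hab)⟩
    obtain ⟨p, hp, q, hq, hpq, hn⟩ := hex
    have hcard : (A.erase s(p, q)).card ≤ d := by
      rw [Finset.card_erase_of_mem (hAG p q hpq hn)]; omega
    have hcon : ∀ p q, p ∈ S → q ∈ S → G.Adj p q → (A.erase s(p, q)).card ≤ d →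
        (H.contractInto p q).FillLE T d := by
      intro p q hp hq hpq hcard
      -- Contracting the completion completes the contraction. Every edge it still adds comes from
      -- an added edge other than pq by renaming q to p, so the edge pq is saved.
      refine ⟨G.contractInto p q, ?_, hG.contractInto (hST hp) (hST hq) hpq,
        (A.erase s(p, q)).image (Sym2.map fun x => if x = q then p else x),
        Finset.card_image_le.trans hcard, ?_⟩
      · rintro x y ⟨h₁, h₂, h₃, h | ⟨h, h'⟩ | ⟨h, h'⟩⟩
        exacts [⟨h₁, h₂, h₃, .inl (hle h)⟩, ⟨h₁, h₂, h₃, .inr (.inl ⟨h, hle h'⟩)⟩,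
          ⟨h₁, h₂, h₃, .inr (.inr ⟨h, hle h'⟩)⟩]
      · rintro x y ⟨h₁, h₂, h₃, h⟩ hn
        have hn' : ¬ (H.Adj x y ∨ (x = p ∧ H.Adj q y) ∨ (y = p ∧ H.Adj x q)) :=
          fun h => hn ⟨h₁, h₂, h₃, h⟩
        rw [Finset.mem_image]
        rcases h with h | ⟨rfl, h⟩ | ⟨rfl, h⟩
        · refine ⟨s(x, y), Finset.mem_erase.2 ⟨?_, hAG x y h (by tauto)⟩, by simp [h₂, h₃]⟩
          rw [ne_eq, Sym2.eq_iff]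
          tauto
        · refine ⟨s(q, y), Finset.mem_erase.2 ⟨?_, hAG q y h (by tauto)⟩, by simp [h₃]⟩
          rw [ne_eq, Sym2.eq_iff]
          rintro (⟨-, e⟩ | ⟨-, e⟩)
          exacts [h₃ e, h₁ e.symm]
        · refine ⟨s(x, q), Finset.mem_erase.2 ⟨?_, hAG x q h (by tauto)⟩, by simp [h₂]⟩
          rw [ne_eq, Sym2.eq_iff]
          rintro (⟨e, -⟩ | ⟨e, -⟩)
          exacts [h₁ e, h₂ e]
    refine ⟨p, hp, q, hq, hpq.ne, hn, ⟨G, ?_, hG, A.erase s(p, q), hcard, fun x y hxy hn' => ?_⟩,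
      hcon p q hp hq hpq hcard, hcon q p hq hp hpq.symm (by rwa [Sym2.eq_swap])⟩
    · exact sup_le hle ((edge_le_iff _).2 (.inr hpq))
    · rw [sup_adj, edge_adj, ← Sym2.eq_iff] at hn'
      refine Finset.mem_erase.2 ⟨fun e => hn' (.inr ⟨e, hxy.ne⟩), hAG x y hxy (by tauto)⟩

end Completion

end SimpleGraph

/-! ### Zykov's dichotomy and greedy colouring -/

namespace SimpleGraph

open Ram (loopN)

section Colouring

variable {V : Type*} {G H : SimpleGraph V} {T : Finset V} {l : ℕ}

/-- The vertices in `T` can be properly coloured with `l` colours. -/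
def ColIn (H : SimpleGraph V) (T : Finset V) (l : ℕ) : Prop :=
  ∃ c : V → ℕ, (∀ x ∈ T, c x < l) ∧ ∀ x ∈ T, ∀ y ∈ T, H.Adj x y → c x ≠ c y

open Classical in
/-- Every nonempty subset of `T` has a vertex with fewer than `l` neighbours in it. -/
def Degenerate (H : SimpleGraph V) (T : Finset V) (l : ℕ) : Prop :=
  ∀ T' ⊆ T, T'.Nonempty → ∃ v ∈ T', (T'.filter (H.Adj v)).card < l

theorem ColIn.of_le (h : G.ColIn T l) (hle : H ≤ G) : H.ColIn T l := by
  obtain ⟨c, hc, hcol⟩ := h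
  exact ⟨c, hc, fun x hx y hy hxy => hcol x hx y hy (hle hxy)⟩

theorem FillLE.succ {d : ℕ} (h : H.FillLE T d) : H.FillLE T (d + 1) := by
  obtain ⟨G, h₁, h₂, A, h₃, h₄⟩ := h
  exact ⟨G, h₁, h₂, A, h₃.trans (by omega), h₄⟩

theorem FillLE.elim_of_zero (h : H.FillLE T 0) : H.Elim T := by
  obtain ⟨G, h₁, h₂, A, h₃, h₄⟩ := h
  obtain rfl : A = ∅ := by simpa using h₃
  have : H = G := le_antisymm h₁ fun x y hxy => by
    by_contra hn
    simpa using h₄ x y hxy hn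
  exact this ▸ h₂

/-- Different colours at p and q respect the extra edge; equal colours respect the contraction in
either direction. Both directions are recorded because the search contracts into the larger of the
two vertices. -/
theorem ColIn.zykov (h : H.ColIn T l) {p q : V} (hp : p ∈ T) (hq : q ∈ T) :
    (H ⊔ edge p q).ColIn T l ∨ (H.contractInto p q).ColIn T l ∧ (H.contractInto q p).ColIn T l := by
  obtain ⟨c, hc, hcol⟩ := h
  by_cases he : c p = c q
  · right
    constructor <;>
    · refine ⟨c, hc, ?_⟩
      rintro x hx y hy ⟨-, -, -, h | ⟨rfl, h⟩ | ⟨rfl, h⟩⟩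
      · exact hcol x hx y hy h
      · first
        | (rw [he]; exact hcol _ hq y hy h)
        | (rw [← he]; exact hcol _ hp y hy h)
      · first
        | (rw [he]; exact hcol x hx _ hq h)
        | (rw [← he]; exact hcol x hx _ hp h)
  · left
    refine ⟨c, hc, fun x hx y hy hxy => ?_⟩
    rw [sup_adj, edge_adj] at hxy
    rcases hxy with h | ⟨⟨rfl, rfl⟩ | ⟨rfl, rfl⟩, -⟩
    exacts [hcol x hx y hy h, he, fun e => he e.symm]

variable [DecidableEq V]

/-- Give q the colour of p; this is proper because p and q are not adjacent. -/
theorem ColIn.of_contractInto {p q : V} (h : (H.contractInto p q).ColIn T l) (hp : p ∈ T)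
    (hpq : p ≠ q) (hn : ¬ H.Adj p q) : H.ColIn T l := by
  obtain ⟨c, hc, hcol⟩ := h
  refine ⟨fun x => if x = q then c p else c x, fun x hx => ?_, fun x hx y hy hxy => ?_⟩
  · dsimp only
    split_ifs
    exacts [hc p hp, hc x hx]
  · dsimp only
    split_ifs with h₁ h₂ h₂
    · exact absurd (h₁.trans h₂.symm) hxy.ne
    · refine hcol p hp y hy ⟨?_, hpq, h₂, .inr (.inl ⟨rfl, h₁ ▸ hxy⟩)⟩
      rintro rfl
      exact hn (h₁ ▸ hxy.symm)
    · refine hcol x hx p hp ⟨?_, h₁, hpq, .inr (.inr ⟨rfl, h₂ ▸ hxy⟩)⟩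
      rintro rfl
      exact hn (h₂ ▸ hxy)
    · exact hcol x hx y hy ⟨hxy.ne, h₁, h₂, .inl hxy⟩

/-- Greedy colouring: colour the rest first, then the vertex of small degree with a colour missing
among its neighbours. -/
theorem Degenerate.colIn (h : H.Degenerate T l) : H.ColIn T l := by
  classical
  induction T using Finset.strongInduction with
  | H T ih =>
  rcases T.eq_empty_or_nonempty with rfl | hne
  · exact ⟨fun _ => 0, by simp, by simp⟩
  obtain ⟨v, hv, hdeg⟩ := h T subset_rfl hne
  obtain ⟨c, hc, hcol⟩ := ih (T.erase v) (Finset.erase_ssubset hv)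
    fun T' hT' => h T' (hT'.trans (Finset.erase_subset _ _))
  obtain ⟨k, hk, hkn⟩ : ∃ k ∈ Finset.range l, k ∉ (T.filter (H.Adj v)).image c := by
    refine Finset.exists_mem_notMem_of_card_lt_card ?_
    rw [Finset.card_range]
    exact Finset.card_image_le.trans_lt hdeg
  have hkn' : ∀ y ∈ T, H.Adj v y → c y ≠ k := fun y hy hvy e =>
    hkn (Finset.mem_image.2 ⟨y, Finset.mem_filter.2 ⟨hy, hvy⟩, e⟩)
  refine ⟨fun x => if x = v then k else c x, fun x hx => ?_, fun x hx y hy hxy => ?_⟩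
  · dsimp only
    split_ifs with h
    exacts [Finset.mem_range.1 hk, hc x (Finset.mem_erase.2 ⟨h, hx⟩)]
  · dsimp only
    split_ifs with h₁ h₂ h₂
    · exact absurd (h₁.trans h₂.symm) hxy.ne
    · exact (hkn' y hy (h₁ ▸ hxy)).symm
    · exact hkn' x hx (h₂ ▸ hxy.symm)
    · exact hcol x (Finset.mem_erase.2 ⟨h₁, hx⟩) y (Finset.mem_erase.2 ⟨h₂, hy⟩) hxy

/-- A simplicial vertex and its neighbours form a clique, on which a proper colouring is injective;
so there are fewer than l neighbours. -/
theorem Elim.degenerate (h : H.Elim T) (hc : H.ColIn T l) : H.Degenerate T l := by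
  classical
  intro T' hT' hne
  obtain ⟨v, hv, hs⟩ := h T' hT' hne
  obtain ⟨c, hc, hcol⟩ := hc
  refine ⟨v, hv, ?_⟩
  have hvn : v ∉ T'.filter (H.Adj v) := by simp
  have : (insert v (T'.filter (H.Adj v))).card ≤ (Finset.range l).card := by
    refine Finset.card_le_card_of_injOn c (fun x hx => ?_) (fun x hx y hy hxy => ?_)
    · simp only [Finset.coe_insert, Finset.coe_filter, Set.mem_insert_iff,
        Set.mem_ofPred_eq] at hx
      rcases hx with rfl | hx
      · simpa using hc x (hT' hv)
      · simpa using hc x (hT' hx.1)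
    · simp only [Finset.coe_insert, Finset.coe_filter, Set.mem_insert_iff,
        Set.mem_ofPred_eq] at hx hy
      by_contra hne
      rcases hx with rfl | hx <;> rcases hy with rfl | hy
      · exact hne rfl
      · exact hcol x (hT' hv) y (hT' hy.1) hy.2 hxy
      · exact hcol x (hT' hx.1) y (hT' hv) hx.2.symm hxy
      · exact hcol x (hT' hx.1) y (hT' hy.1) (hs x hx.1 y hy.1 hx.2 hy.2 hne) hxy
  rw [Finset.card_insert_of_notMem hvn, Finset.card_range] at this
  omega

end Colouring

/-! ### The search algorithm on finite sets of numbers -/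

section Algorithm

open Classical in
/-- Delete `v` unless it is `bad`. -/
noncomputable def killStep (bad : Finset ℕ → ℕ → Prop) (v : ℕ) (T : Finset ℕ) : Finset ℕ :=
  if bad T v then T else T.erase v

/-- Go through the vertices below `n` and delete every vertex that is not `bad`. -/
noncomputable def killRound (bad : Finset ℕ → ℕ → Prop) (n : ℕ) (S : Finset ℕ) : Finset ℕ :=
  loopN (killStep bad) n S

/-- Repeat the deletion of vertices that are not `bad` for `n` rounds. -/
noncomputable def killAll (bad : Finset ℕ → ℕ → Prop) (n : ℕ) (S : Finset ℕ) : Finset ℕ :=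
  loopN (fun _ T => killRound bad n T) n S

variable {bad : Finset ℕ → ℕ → Prop} {n : ℕ}

theorem loopN_subset {g : ℕ → Finset ℕ → Finset ℕ} (hg : ∀ i T, g i T ⊆ T) (k m : ℕ)
    (S : Finset ℕ) : loopN g (k + m) S ⊆ loopN g k S := by
  induction m with
  | zero => rfl
  | succ m ih => exact (hg _ _).trans ih

theorem killStep_subset (v : ℕ) (T : Finset ℕ) : killStep bad v T ⊆ T := by
  unfold killStep
  split_ifs
  exacts [subset_rfl, Finset.erase_subset _ _]

theorem killRound_subset (S : Finset ℕ) : killRound bad n S ⊆ S := by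
  unfold killRound
  simpa [loopN] using loopN_subset (killStep_subset (bad := bad)) 0 n S

theorem killAll_subset (S : Finset ℕ) : killAll bad n S ⊆ S := by
  have := loopN_subset (g := fun _ T => killRound bad n T) (fun i T => killRound_subset T) 0 n S
  rwa [zero_add] at this

/-- Sets only shrink during a round, so a round without net change never changed anything, and each
vertex was tested against S itself. -/
theorem bad_of_killRound_eq {S : Finset ℕ} (h : killRound bad n S = S) (hS : S ⊆ Finset.range n) :
    ∀ v ∈ S, bad S v := by
  intro v hv
  have hvn := Finset.mem_range.1 (hS hv)
  have hk : ∀ k ≤ n, loopN (killStep bad) k S = S := fun k hk => by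
    refine subset_antisymm ?_ ?_
    · simpa [loopN] using loopN_subset (killStep_subset (bad := bad)) 0 k S
    · have := loopN_subset (killStep_subset (bad := bad)) k (n - k) S
      rw [show k + (n - k) = n by omega] at this
      exact h.symm.subset.trans this
  have h₁ := hk (v + 1) hvn
  change killStep bad v (loopN (killStep bad) v S) = S at h₁
  rw [hk v hvn.le] at h₁
  by_contra hb
  rw [killStep, if_neg hb] at h₁
  rw [← h₁] at hv
  simp at hv

/-- A round either is stationary, and then all later ones are, or removes a vertex; after n rounds
the set is stable or empty. -/
theorem killAll_bad {S : Finset ℕ} (hS : S ⊆ Finset.range n) :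
    ∀ v ∈ killAll bad n S, bad (killAll bad n S) v := by
  set g : ℕ → Finset ℕ → Finset ℕ := fun _ T => killRound bad n T with hg
  have hcl : ∀ r, killRound bad n (loopN g r S) = loopN g r S ∨
      (loopN g r S).card + r ≤ S.card := by
    intro r
    induction r with
    | zero => right; simp [loopN]
    | succ r ih =>
      change killRound bad n (killRound bad n (loopN g r S)) = killRound bad n (loopN g r S) ∨
        (killRound bad n (loopN g r S)).card + (r + 1) ≤ S.card
      rcases ih with ih | ih
      · left; rw [ih, ih]
      · by_cases he : killRound bad n (loopN g r S) = loopN g r S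
        · left; rw [he, he]
        · right
          have := Finset.card_lt_card
            ((killRound_subset (bad := bad) (n := n) (loopN g r S)).ssubset_of_ne he)
          omega
  have hsub : killAll bad n S ⊆ Finset.range n := (killAll_subset S).trans hS
  refine bad_of_killRound_eq (n := n) ?_ hsub
  rcases hcl n with h | h
  · exact h
  · have hc := Finset.card_le_card hS
    rw [Finset.card_range] at hc
    have : killAll bad n S = ∅ := Finset.card_eq_zero.1 (by
      change (loopN g n S).card = 0
      omega)
    rw [this]
    exact Finset.subset_empty.1 (killRound_subset ∅)

theorem subset_loopN {g : ℕ → Finset ℕ → Finset ℕ} {T : Finset ℕ}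
    (hg : ∀ i S, T ⊆ S → T ⊆ g i S) (k : ℕ) {S : Finset ℕ} (hS : T ⊆ S) : T ⊆ loopN g k S := by
  induction k with
  | zero => exact hS
  | succ k ih => exact hg _ _ ih

/-- As `bad` is monotone in the set, members of T stay bad in every larger set and are never
deleted. With `killAll_bad` this makes the final set the largest all-bad subset of S. -/
theorem subset_killAll (hbad : ∀ T T' v, T ⊆ T' → bad T v → bad T' v) {S T : Finset ℕ}
    (hT : T ⊆ S) (h : ∀ v ∈ T, bad T v) : T ⊆ killAll bad n S := by
  refine subset_loopN (fun _ S hS => subset_loopN (fun v S hS => ?_) n hS) n hT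
  unfold killStep
  split_ifs with hb
  · exact hS
  · refine fun x hx => Finset.mem_erase.2 ⟨?_, hS hx⟩
    rintro rfl
    exact hb (hbad _ _ _ hS (h x hx))

theorem killAll_eq_empty (hbad : ∀ T T' v, T ⊆ T' → bad T v → bad T' v) {S : Finset ℕ}
    (hS : S ⊆ Finset.range n) :
    killAll bad n S = ∅ ↔ ∀ T ⊆ S, T.Nonempty → ∃ v ∈ T, ¬ bad T v := by
  refine ⟨fun h T hT hne => ?_, fun h => ?_⟩
  · by_contra hcon
    push Not at hcon
    have := subset_killAll (n := n) hbad hT hcon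
    rw [h, Finset.subset_empty] at this
    exact hne.ne_empty this
  · by_contra hne
    obtain ⟨v, hv, hb⟩ := h _ (killAll_subset S) (Finset.nonempty_iff_ne_empty.2 hne)
    exact hb (killAll_bad hS v hv)

variable (H : SimpleGraph ℕ)

theorem killAll_simplicial_eq_empty {S : Finset ℕ} (hS : S ⊆ Finset.range n) :
    killAll (fun T v => ¬ H.SimplicialIn T v) n S = ∅ ↔ H.Elim S := by
  rw [killAll_eq_empty (fun T T' v hT h h' => h fun a ha b hb => h' a (hT ha) b (hT hb)) hS]
  simp [Elim]

open Classical in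
theorem killAll_degree_eq_empty {S : Finset ℕ} (hS : S ⊆ Finset.range n) (l : ℕ) :
    killAll (fun T v => l ≤ (T.filter (H.Adj v)).card) n S = ∅ ↔ H.Degenerate S l := by
  rw [killAll_eq_empty (fun T T' v hT h =>
    h.trans (Finset.card_le_card (Finset.filter_subset_filter _ hT))) hS]
  simp [Degenerate]

open Classical in
/-- Delete `x` from a set without perfect elimination ordering if the rest has none either. -/
noncomputable def minStep (n x : ℕ) (S : Finset ℕ) : Finset ℕ :=
  -- The program removes x before testing and then writes the truth value of this condition, hence
  -- the `insert`. The first conjunct keeps the set empty when there is nothing to find.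
  if ¬ H.Elim (Finset.range n) ∧ H.Elim (S.erase x) then insert x S else S.erase x

open Classical in
/-- A minimal set of vertices below `n` without perfect elimination ordering, found by trying to
delete the vertices one by one; it is empty if there is no such set. -/
noncomputable def minNonElim (n : ℕ) : Finset ℕ :=
  loopN (H.minStep n) n (if H.Elim (Finset.range n) then ∅ else Finset.range n)

variable {H}

theorem minNonElim_of_elim (h : H.Elim (Finset.range n)) : H.minNonElim n = ∅ := by
  have : ∀ x S, H.minStep n x S ⊆ S := fun x S => by
    simpa [minStep, h] using Finset.erase_subset x S
  rw [minNonElim, if_pos h]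
  exact Finset.subset_empty.1 (by simpa [loopN] using loopN_subset this 0 n ∅)

/-- Invariant after k steps: vertices from k on are untouched, the set still violates `Elim`, and
every surviving vertex below k is indispensable. The last property persists because `Elim` passes to
subsets. -/
theorem minNonElim_spec (h : ¬ H.Elim (Finset.range n)) :
    H.minNonElim n ⊆ Finset.range n ∧ ¬ H.Elim (H.minNonElim n) ∧
      ∀ x ∈ H.minNonElim n, H.Elim ((H.minNonElim n).erase x) := by
  classical
  rw [minNonElim, if_neg h]
  set g : ℕ → Finset ℕ → Finset ℕ := H.minStep n with hg
  suffices H' : ∀ k ≤ n, loopN g k (Finset.range n) ⊆ Finset.range n ∧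
      (∀ x, k ≤ x → x < n → x ∈ loopN g k (Finset.range n)) ∧
      ¬ H.Elim (loopN g k (Finset.range n)) ∧
      ∀ x < k, x ∈ loopN g k (Finset.range n) →
        H.Elim ((loopN g k (Finset.range n)).erase x) by
    obtain ⟨h₁, -, h₂, h₃⟩ := H' n le_rfl
    exact ⟨h₁, h₂, fun x hx => h₃ x (Finset.mem_range.1 (h₁ hx)) hx⟩
  intro k
  induction k with
  | zero => exact fun _ => ⟨subset_rfl, fun x _ hx => Finset.mem_range.2 hx, h, by simp⟩
  | succ k ih =>
    intro hk
    obtain ⟨h₁, h₂, h₃, h₄⟩ := ih (by omega)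
    change g k (loopN g k (Finset.range n)) ⊆ _ ∧ (∀ x, k + 1 ≤ x → x < n →
      x ∈ g k (loopN g k (Finset.range n))) ∧ ¬ H.Elim (g k (loopN g k (Finset.range n))) ∧
      ∀ x < k + 1, x ∈ g k (loopN g k (Finset.range n)) →
        H.Elim ((g k (loopN g k (Finset.range n))).erase x)
    generalize loopN g k (Finset.range n) = S at *
    by_cases hE : H.Elim (S.erase k)
    · have : g k S = S := by
        simp only [hg, minStep, h, hE, not_false_eq_true, and_self, if_true]
        exact Finset.insert_eq_of_mem (h₂ k le_rfl (by omega))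
      rw [this]
      refine ⟨h₁, fun x hx => h₂ x (by omega), h₃, fun x hx hxS => ?_⟩
      rcases Nat.lt_succ_iff_lt_or_eq.1 hx with hx | rfl
      exacts [h₄ x hx hxS, hE]
    · have : g k S = S.erase k := by simp [hg, minStep, hE]
      rw [this]
      refine ⟨(Finset.erase_subset _ _).trans h₁,
        fun x hx hxn => Finset.mem_erase.2 ⟨by omega, h₂ x (by omega) hxn⟩, hE,
        fun x hx hxS => ?_⟩
      obtain ⟨hxk, hxS⟩ := Finset.mem_erase.1 hxS
      exact (h₄ x (by omega) hxS).mono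
        (Finset.erase_subset_erase _ (Finset.erase_subset _ _))

/-- The element of `S` with `r` smaller elements in `S` (and some number below `n` if there is no
such element). -/
def pick (n : ℕ) (S : Finset ℕ) (r : ℕ) : ℕ :=
  -- The double truncated subtraction is the minimum of n - 1 and the sum: whatever the digits, the
  -- result is bounded by n - 1.
  (n - 1) - ((n - 1) - ∑ x ∈ Finset.range n,
    if x ∈ S ∧ (S.filter (· < x)).card = r then x else 0)

theorem pick_rank {S : Finset ℕ} (hS : S ⊆ Finset.range n) {p : ℕ} (hp : p ∈ S) :
    pick n S (S.filter (· < p)).card = p := by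
  have hpn := Finset.mem_range.1 (hS hp)
  rw [pick, Finset.sum_eq_single p]
  · simp only [hp, true_and, if_true]
    omega
  · intro x _ hxp
    rw [if_neg]
    rintro ⟨hx, he⟩
    rcases lt_or_gt_of_ne hxp with h | h
    · refine (Finset.card_lt_card (Finset.ssubset_iff_of_subset ?_ |>.2 ⟨x, ?_, ?_⟩)).ne he
      · exact fun y hy => by
          simp only [Finset.mem_filter] at hy ⊢
          exact ⟨hy.1, by omega⟩
      · simp [hx, h]
      · simp
    · refine (Finset.card_lt_card (Finset.ssubset_iff_of_subset ?_ |>.2 ⟨p, ?_, ?_⟩)).ne' he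
      · exact fun y hy => by
          simp only [Finset.mem_filter] at hy ⊢
          exact ⟨hy.1, by omega⟩
      · simp [hp, h]
      · simp
  · intro h
    exact absurd (hS hp) h

theorem rank_lt {S : Finset ℕ} {p : ℕ} (hp : p ∈ S) : (S.filter (· < p)).card < S.card :=
  Finset.card_lt_card (Finset.filter_ssubset.2 ⟨p, hp, by simp⟩)

theorem pick_empty (r : ℕ) : pick n ∅ r = 0 := by simp [pick]

theorem pick_le (S : Finset ℕ) (r : ℕ) : pick n S r ≤ n - 1 := Nat.sub_le _ _

/-- The state of a branch of the search: the current graph, the remaining choices, and a flag that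
is `0` after a contraction. -/
structure Branch where
  graph : SimpleGraph ℕ
  choices : ℕ
  flag : ℕ

open Classical in
/-- One step of a branch: two digits in base `b` select two elements of the minimal nonchordal set;
depending on their order the pair is added as an edge or contracted. -/
noncomputable def Branch.next (n b : ℕ) (s : Branch) : Branch :=
  let p := pick n (s.graph.minNonElim n) (s.choices % b)
  let q := pick n (s.graph.minNonElim n) (s.choices / b % b)
  -- For p = q nothing happens, which lets a branch idle. Contraction requires nonadjacency, so
  -- arbitrary guesses never produce a colouring that cannot be lifted back.
  { graph := if p < q then s.graph ⊔ edge p q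
      else if q < p ∧ ¬ s.graph.Adj p q then s.graph.contractInto p q else s.graph
    choices := s.choices / b / b
    flag := if q < p then 0 else s.flag }

variable {b : ℕ}

theorem Branch.colIn_of_next {s : Branch} {l : ℕ}
    (h : (s.next n b).graph.ColIn (Finset.range n) l) : s.graph.ColIn (Finset.range n) l := by
  simp only [Branch.next] at h
  split_ifs at h with h₁ h₂
  · exact h.of_le le_sup_left
  · refine h.of_contractInto (Finset.mem_range.2 ?_) h₂.1.ne' h₂.2
    have := pick_le (n := n) (s.graph.minNonElim n) (s.choices % b)
    omega
  · exact h

theorem Branch.colIn_of_iterate (d : ℕ) {s : Branch} {l : ℕ}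
    (h : ((Branch.next n b)^[d] s).graph.ColIn (Finset.range n) l) :
    s.graph.ColIn (Finset.range n) l := by
  induction d generalizing s with
  | zero => exact h
  | succ d ih => exact Branch.colIn_of_next (ih h)

theorem Branch.flag_iterate (d : ℕ) {s : Branch} (h : s.flag = 0) :
    ((Branch.next n b)^[d] s).flag = 0 := by
  induction d generalizing s with
  | zero => exact h
  | succ d ih => exact ih (by simp [Branch.next, h])

/-- A surviving flag means that no step contracted, so the final graph is the initial one plus at
most one edge per step. -/
theorem Branch.fillLE_of_iterate (d : ℕ) {s : Branch}
    (h : ((Branch.next n b)^[d] s).graph.Elim (Finset.range n))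
    (hf : ((Branch.next n b)^[d] s).flag ≠ 0) : s.graph.FillLE (Finset.range n) d := by
  induction d generalizing s with
  | zero => exact Elim.fillLE h 0
  | succ d ih =>
    have h₁ := ih h hf
    have h₂ : (s.next n b).flag ≠ 0 := fun h => hf (Branch.flag_iterate d h)
    simp only [Branch.next, ne_eq, ite_eq_left_iff, not_lt, Classical.not_imp] at h₁ h₂
    split_ifs at h₁ with h₃ h₄
    · exact h₁.of_sup_edge
    · omega
    · exact h₁.succ

/-- Two digits in base `b` and the remaining choices. -/
theorem digits_spec {b α β N : ℕ} (hα : α < b) (hβ : β < b) :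
    (α + b * (β + b * N)) % b = α ∧ (α + b * (β + b * N)) / b % b = β ∧
      (α + b * (β + b * N)) / b / b = N := by
  have h₁ : (α + b * (β + b * N)) / b = β + b * N := by
    rw [Nat.add_mul_div_left _ _ (by omega), Nat.div_eq_of_lt hα, zero_add]
  refine ⟨by rw [Nat.add_mul_mod_self_left, Nat.mod_eq_of_lt hα], ?_, ?_⟩
  · rw [h₁, Nat.add_mul_mod_self_left, Nat.mod_eq_of_lt hβ]
  · rw [h₁, Nat.add_mul_div_left _ _ (by omega), Nat.div_eq_of_lt hβ, zero_add]

theorem digits_lt {b α β N j : ℕ} (hα : α < b) (hβ : β < b) (hN : N < b ^ (2 * j)) :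
    α + b * (β + b * N) < b ^ (2 * (j + 1)) := by
  have h₁ : β + b * N < b * b ^ (2 * j) := by
    calc β + b * N < b + b * N := by omega
      _ = b * (N + 1) := by ring
      _ ≤ _ := Nat.mul_le_mul_left _ hN
  calc α + b * (β + b * N) < b + b * (β + b * N) := by omega
    _ = b * (β + b * N + 1) := by ring
    _ ≤ b * (b * b ^ (2 * j)) := Nat.mul_le_mul_left _ h₁
    _ = _ := by ring

/-- Once elimination holds the minimal set is empty and both picks are 0, so the step only consumes
two digits. This fills up branches that finish early. -/
theorem Branch.next_of_elim {H : SimpleGraph ℕ} (hE : H.Elim (Finset.range n)) (hb : 0 < b)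
    (N a : ℕ) : Branch.next n b ⟨H, 0 + b * (0 + b * N), a⟩ = ⟨H, N, a⟩ := by
  obtain ⟨-, -, h₃⟩ := digits_spec (N := N) hb hb
  simp only [Branch.next, minNonElim_of_elim hE, pick_empty, h₃, lt_irrefl, false_and, if_false]

/-- The digits are the ranks of p and q in the minimal set; they are below its cardinality and hence
below b. -/
theorem Branch.next_of_mem {H : SimpleGraph ℕ} (hE : ¬ H.Elim (Finset.range n))
    (hcard : (H.minNonElim n).card ≤ b) {p q : ℕ} (hp : p ∈ H.minNonElim n)
    (hq : q ∈ H.minNonElim n) :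
    ∃ α < b, ∃ β < b, (p < q → ∀ N a, Branch.next n b ⟨H, α + b * (β + b * N), a⟩ =
        ⟨H ⊔ edge p q, N, a⟩) ∧
      (q < p → ¬ H.Adj p q → ∀ N a, Branch.next n b ⟨H, α + b * (β + b * N), a⟩ =
        ⟨H.contractInto p q, N, 0⟩) := by
  have hS := (minNonElim_spec hE).1
  have hα := (rank_lt hp).trans_le hcard
  have hβ := (rank_lt hq).trans_le hcard
  refine ⟨_, hα, _, hβ, fun h N a => ?_, fun h hn N a => ?_⟩
  · obtain ⟨h₁, h₂, h₃⟩ := digits_spec (N := N) hα hβ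
    simp only [Branch.next, h₁, h₂, h₃, pick_rank hS hp, pick_rank hS hq, if_pos h,
      if_neg (not_lt.2 h.le)]
  · obtain ⟨h₁, h₂, h₃⟩ := digits_spec (N := N) hα hβ
    simp only [Branch.next, h₁, h₂, h₃, pick_rank hS hp, pick_rank hS hq, if_neg (not_lt.2 h.le),
      h, hn, not_false_eq_true, and_self, if_true]

/-- Normalises the pair to p < q. The digits in the order p, q add the edge, and those in the order
q, p contract p into q. -/
theorem FillLE.exists_ordered_pair {j : ℕ} (hb : 4 * (j + 1) ≤ b) {H : SimpleGraph ℕ}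
    (h : H.FillLE (Finset.range n) (j + 1)) (hE : ¬ H.Elim (Finset.range n)) :
    ∃ p ∈ H.minNonElim n, ∃ q ∈ H.minNonElim n, p < q ∧ ¬ H.Adj p q ∧
      (H.minNonElim n).card ≤ b ∧
      (H ⊔ edge p q).FillLE (Finset.range n) j ∧
      (H.contractInto q p).FillLE (Finset.range n) j := by
  obtain ⟨hS, hS₁, hS₂⟩ := minNonElim_spec hE
  obtain ⟨hcard, p, hp, q, hq, hpq, hn, h₁, h₂, h₃⟩ := h.exists_pair hS hS₁ hS₂
  rcases lt_or_gt_of_ne hpq with hlt | hlt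
  · exact ⟨p, hp, q, hq, hlt, hn, hcard.trans hb, h₁, h₃⟩
  · exact ⟨q, hq, p, hp, hlt, fun h => hn h.symm, hcard.trans hb, by rwa [edge_comm], h₂⟩

/-- Always choose to add an edge of the completion; the flag is then untouched. The fixed base b
works at every level because the bound 4j on the minimal set decreases with j. -/
theorem FillLE.exists_branch (j : ℕ) (hb : 4 * j ≤ b) {H : SimpleGraph ℕ}
    (h : H.FillLE (Finset.range n) j) (a : ℕ) :
    ∃ N < b ^ (2 * j), ((Branch.next n b)^[j] ⟨H, N, a⟩).graph.Elim (Finset.range n) ∧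
      ((Branch.next n b)^[j] ⟨H, N, a⟩).flag = a := by
  induction j generalizing H with
  | zero => exact ⟨0, by simp, h.elim_of_zero, rfl⟩
  | succ j ih =>
    by_cases hE : H.Elim (Finset.range n)
    · obtain ⟨N, hN, h₁⟩ := ih (by omega) (hE.fillLE j)
      refine ⟨0 + b * (0 + b * N), digits_lt (by omega) (by omega) hN, ?_⟩
      rwa [Function.iterate_succ_apply, Branch.next_of_elim hE (by omega)]
    · obtain ⟨p, hp, q, hq, hlt, hn, hcard, hF, -⟩ := h.exists_ordered_pair hb hE
      obtain ⟨N, hN, h₁⟩ := ih (by omega) hF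
      obtain ⟨α, hα, β, hβ, h₂, -⟩ := Branch.next_of_mem hE hcard hp hq
      refine ⟨α + b * (β + b * N), digits_lt hα hβ hN, ?_⟩
      rwa [Function.iterate_succ_apply, h₂ hlt]

/-- Let a fixed colouring decide by Zykov between adding and contracting; after j steps the graph
has an elimination ordering and is still l-colourable, hence degenerate. -/
theorem FillLE.exists_branch_colIn (j : ℕ) (hb : 4 * j ≤ b) {H : SimpleGraph ℕ} {l : ℕ}
    (h : H.FillLE (Finset.range n) j) (hc : H.ColIn (Finset.range n) l) (a : ℕ) :
    ∃ N < b ^ (2 * j), ((Branch.next n b)^[j] ⟨H, N, a⟩).graph.Degenerate (Finset.range n) l := by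
  induction j generalizing H a with
  | zero => exact ⟨0, by simp, h.elim_of_zero.degenerate hc⟩
  | succ j ih =>
    by_cases hE : H.Elim (Finset.range n)
    · obtain ⟨N, hN, h₁⟩ := ih (by omega) (hE.fillLE j) hc a
      refine ⟨0 + b * (0 + b * N), digits_lt (by omega) (by omega) hN, ?_⟩
      rwa [Function.iterate_succ_apply, Branch.next_of_elim hE (by omega)]
    · obtain ⟨p, hp, q, hq, hlt, hn, hcard, hF, hF'⟩ := h.exists_ordered_pair hb hE
      have hS := (minNonElim_spec hE).1
      rcases hc.zykov (hS hp) (hS hq) with hc' | ⟨-, hc'⟩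
      · obtain ⟨N, hN, h₁⟩ := ih (by omega) hF hc' a
        obtain ⟨α, hα, β, hβ, h₂, -⟩ := Branch.next_of_mem hE hcard hp hq
        refine ⟨α + b * (β + b * N), digits_lt hα hβ hN, ?_⟩
        rwa [Function.iterate_succ_apply, h₂ hlt]
      · obtain ⟨N, hN, h₁⟩ := ih (by omega) hF' hc' 0
        obtain ⟨α, hα, β, hβ, -, h₂⟩ := Branch.next_of_mem hE hcard hq hp
        refine ⟨α + b * (β + b * N), digits_lt hα hβ hN, ?_⟩
        rwa [Function.iterate_succ_apply, h₂ hlt (fun h => hn h.symm)]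

end Algorithm

end SimpleGraph

/-! ### Frames, loop invariants, bounds and truth values for loop programs -/

namespace Ram

namespace Stmt

/-- The variables assigned by a program (loop variables are restored). -/
def modV : Stmt → List ℕ
  | assign x _ => [x]
  | store _ _ _ => []
  | seq c d => c.modV ++ d.modV
  | .loop _ _ c => c.modV

/-- The arrays modified by a program. -/
def modA : Stmt → List (Fin 4)
  | assign _ _ => []
  | store a _ _ => [a]
  | seq c d => c.modA ++ d.modA
  | .loop _ _ c => c.modA

/-- `τ` agrees with `σ` on everything that `c` does not modify, except possibly on `x`. -/
structure Frame (c : Stmt) (x : ℕ → Prop) (σ τ : St) : Prop where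
  v : ∀ y, y ∉ c.modV → ¬ x y → τ.v y = σ.v y
  A : ∀ a, a ∉ c.modA → τ.A a = σ.A a
  base : τ.base = σ.base
  input : τ.input = σ.input

theorem frame_loopN {c : Stmt} (h : ∀ τ, c.Frame (fun _ => False) τ (c.den τ)) (x : ℕ) (σ : St)
    (n : ℕ) : c.Frame (· = x) σ (loopN (fun i τ => c.den (τ.setV x i)) n σ) := by
  induction n with
  | zero => exact ⟨fun _ _ _ => rfl, fun _ _ => rfl, rfl, rfl⟩
  | succ n ih =>
    have := h ((loopN (fun i τ => c.den (τ.setV x i)) n σ).setV x n)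
    refine ⟨fun y hy hyx => ?_, fun a ha => ?_, ?_, ?_⟩
    · refine (this.v y hy id).trans ?_
      rw [St.setV_v, if_neg hyx]
      exact ih.v y hy hyx
    · exact (this.A a ha).trans (ih.A a ha)
    · exact this.base.trans ih.base
    · exact this.input.trans ih.input

theorem frame_den (c : Stmt) : ∀ σ, c.Frame (fun _ => False) σ (c.den σ) := by
  induction c with
  | assign x e =>
    intro σ
    refine ⟨fun y hy _ => ?_, fun _ _ => rfl, rfl, rfl⟩
    rw [den, St.setV_v, if_neg]
    simpa [modV] using hy
  | store a i e =>
    intro σ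
    refine ⟨fun _ _ _ => rfl, fun b hb => ?_, rfl, rfl⟩
    ext j
    rw [den, St.setA_A, if_neg]
    rintro ⟨rfl, -⟩
    simp [modA] at hb
  | seq c d hc hd =>
    intro σ
    have h₁ := hc σ
    have h₂ := hd (c.den σ)
    refine ⟨fun y hy hx => ?_, fun a ha => ?_, h₂.base.trans h₁.base, h₂.input.trans h₁.input⟩
    · simp only [modV, List.mem_append, not_or] at hy
      exact (h₂.v y hy.2 hx).trans (h₁.v y hy.1 hx)
    · simp only [modA, List.mem_append, not_or] at ha
      exact (h₂.A a ha.2).trans (h₁.A a ha.1)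
  | loop x e c hc =>
    intro σ
    have := frame_loopN hc x σ (e.eval σ)
    refine ⟨fun y hy _ => ?_, this.A, this.base, this.input⟩
    rw [den, St.setV_v]
    split_ifs with h
    · rw [h]
    · exact this.v y hy h

/-- The side condition is decidable for a concrete program, so parameters are carried through long
programs by `decide`. -/
theorem den_v {c : Stmt} {σ : St} {y : ℕ} (h : y ∉ c.modV) : (c.den σ).v y = σ.v y :=
  (c.frame_den σ).v y h id

theorem den_A {c : Stmt} {σ : St} {a : Fin 4} (h : a ∉ c.modA) : (c.den σ).A a = σ.A a :=
  (c.frame_den σ).A a h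

@[simp] theorem den_base {c : Stmt} {σ : St} : (c.den σ).base = σ.base := (c.frame_den σ).base

@[simp] theorem den_input {c : Stmt} {σ : St} : (c.den σ).input = σ.input :=
  (c.frame_den σ).input

@[simp] theorem den_seq {c d : Stmt} {σ : St} : (seq c d).den σ = d.den (c.den σ) := rfl

/-- Loop invariants. -/
theorem for_inv {x : ℕ} {e : Exp} {c : Stmt} {σ : St} (I : ℕ → St → Prop) (h0 : I 0 σ)
    (hI : ∀ i τ k, I i τ → I i (τ.setV x k))
    (hs : ∀ i < e.eval σ, ∀ τ, τ.v x = i → c.Frame (· = x) σ τ → I i τ → I (i + 1) (c.den τ)) :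
    I (e.eval σ) ((Stmt.loop x e c).den σ) := by
  -- The loop variable is set before every pass and restored at the end, so the invariant has to be
  -- insensitive to it.
  refine hI _ _ _ ?_
  suffices H : ∀ i ≤ e.eval σ, I i (loopN (fun i τ => c.den (τ.setV x i)) i σ) from H _ le_rfl
  intro i
  induction i with
  | zero => exact fun _ => h0
  | succ i ih =>
    intro hi
    refine hs i (by omega) _ (by simp [St.setV_v]) ?_ (hI _ _ _ (ih (by omega)))
    have := frame_loopN c.frame_den x σ i
    refine ⟨fun y hy hyx => ?_, this.A, this.base, this.input⟩
    rw [St.setV_v, if_neg hyx]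
    exact this.v y hy hyx

/-- Loop invariants that also bound all values. -/
theorem for_bdd {X x : ℕ} {e : Exp} {c : Stmt} {σ : St} (I : ℕ → St → Prop) (h0 : I 0 σ)
    (hX : e.eval σ ≤ X) (hσ : σ.Bnd X) (hI : ∀ i τ k, I i τ → I i (τ.setV x k))
    (hs : ∀ i < e.eval σ, ∀ τ, τ.v x = i → c.Frame (· = x) σ τ → I i τ → τ.Bnd X →
      c.Bdd X τ ∧ I (i + 1) (c.den τ)) :
    (Stmt.loop x e c).Bdd X σ ∧ I (e.eval σ) ((Stmt.loop x e c).den σ) := by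
  have hfr : ∀ i, c.Frame (· = x) σ ((loopN (fun i τ => c.den (τ.setV x i)) i σ).setV x i) := by
    intro i
    have := frame_loopN c.frame_den x σ i
    refine ⟨fun y hy hyx => ?_, this.A, this.base, this.input⟩
    rw [St.setV_v, if_neg hyx]
    exact this.v y hy hyx
  have H : ∀ i ≤ e.eval σ, (loopN (fun i τ => c.den (τ.setV x i)) i σ).Bnd X ∧
      I i (loopN (fun i τ => c.den (τ.setV x i)) i σ) := by
    intro i
    induction i with
    | zero => exact fun _ => ⟨hσ, h0⟩
    | succ i ih =>
      intro hi
      obtain ⟨h₁, h₂⟩ := ih (by omega)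
      have h₃ := h₁.setV (x := x) (k := i) (by omega)
      obtain ⟨h₄, h₅⟩ := hs i (by omega) _ (by simp [St.setV_v]) (hfr i) (hI _ _ _ h₂) h₃
      exact ⟨c.bnd_den h₃ h₄, h₅⟩
  refine ⟨⟨hX, fun i hi => ?_⟩, hI _ _ _ (H _ le_rfl).2⟩
  obtain ⟨h₁, h₂⟩ := H i hi.le
  exact (hs i hi _ (by simp [St.setV_v]) (hfr i) (hI _ _ _ h₂) (h₁.setV (by omega))).1

end Stmt

/-- Expressions with values `0` and `1` only. -/
def Exp.isBool : Exp → Bool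
  | const c => c ≤ 1
  | sub (const c) _ => c ≤ 1
  | mul e f => e.isBool && f.isBool
  | _ => false

/-- Expressions whose value is bounded by the values stored. -/
def Exp.safe : Exp → Bool
  | const c => c ≤ 1
  | var _ => true
  | inp _ => true
  | arr _ _ => true
  | sub e _ => e.safe
  | mul e f => e.isBool && f.safe || e.safe && f.isBool
  | sum _ e f => e.safe && f.isBool
  | add _ _ => false

/-- Programs that assign only safe expressions and have only safe loop bounds. -/
def Stmt.safe : Stmt → Bool
  | assign _ e => e.safe
  | store _ _ e => e.safe
  | seq c d => c.safe && d.safe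
  | .loop _ e c => e.safe && c.safe

theorem Exp.eval_le_one {e : Exp} (h : e.isBool) (σ : St) : e.eval σ ≤ 1 := by
  induction e with
  | const c => simpa [isBool, eval] using h
  | sub e f =>
    cases e with
    | const c =>
      simp only [isBool, decide_eq_true_eq] at h
      exact (Nat.sub_le _ _).trans h
    | _ => simp [isBool] at h
  | mul e f he hf =>
    simp only [isBool, Bool.and_eq_true] at h
    exact Nat.mul_le_mul (he h.1) (hf h.2)
  | _ => simp [isBool] at h

/-- Subtractions, counts and products with truth values never exceed what is already stored.
Boundedness of `branchC` thus becomes a syntactic check; large numbers arise only in `levelC` and in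
the loop bound of `mainC`. -/
theorem Exp.eval_le_of_safe {X : ℕ} (hX : 1 ≤ X) {e : Exp} (h : e.safe) {σ : St} (hσ : σ.Bnd X) :
    e.eval σ ≤ X := by
  induction e generalizing σ with
  | const c =>
    simp only [safe, decide_eq_true_eq] at h
    exact le_trans h hX
  | var x => exact hσ.v x
  | inp e => exact hσ.mem _
  | arr a e => exact hσ.A _ _
  | add e f => simp [safe] at h
  | sub e f he => exact (Nat.sub_le _ _).trans (he h hσ)
  | mul e f he hf =>
    simp only [safe, Bool.or_eq_true, Bool.and_eq_true] at h
    rcases h with h | h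
    · exact (Nat.mul_le_mul (eval_le_one h.1 σ) (hf h.2 hσ)).trans (one_mul X).le
    · exact (Nat.mul_le_mul (he h.1 hσ) (eval_le_one h.2 σ)).trans (mul_one X).le
  | sum x e f he =>
    simp only [safe, Bool.and_eq_true] at h
    calc _ ≤ ∑ _i ∈ Finset.range (e.eval σ), 1 :=
          Finset.sum_le_sum fun i _ => eval_le_one h.2 _
      _ = e.eval σ := by simp
      _ ≤ X := he h.1 hσ

theorem Stmt.bdd_of_safe {X : ℕ} (hX : 1 ≤ X) {c : Stmt} (h : c.safe) {σ : St} (hσ : σ.Bnd X) :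
    c.Bdd X σ := by
  induction c generalizing σ with
  | assign x e => exact Exp.eval_le_of_safe hX h hσ
  | store a i e => exact Exp.eval_le_of_safe hX h hσ
  | seq c d hc hd =>
    simp only [safe, Bool.and_eq_true] at h
    exact ⟨hc h.1 hσ, hd h.2 (c.bnd_den hσ (hc h.1 hσ))⟩
  | loop x e c hc =>
    simp only [safe, Bool.and_eq_true] at h
    exact (for_bdd (fun _ _ => True) trivial (Exp.eval_le_of_safe hX h.1 hσ) hσ
      (fun _ _ _ _ => trivial) fun _ _ _ _ _ _ hτ => ⟨hc h.2 hτ, trivial⟩).1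

open Classical in
/-- The truth value of a proposition. -/
noncomputable def ind (p : Prop) : ℕ := if p then 1 else 0

theorem ind_true {p : Prop} (h : p) : ind p = 1 := if_pos h
theorem ind_false {p : Prop} (h : ¬ p) : ind p = 0 := if_neg h

theorem ind_congr {p q : Prop} (h : p ↔ q) : ind p = ind q := by rw [propext h]

@[simp] theorem ind_eq_zero {p : Prop} : ind p = 0 ↔ ¬ p := by
  by_cases h : p <;> simp [ind, h]

theorem ind_mul (p q : Prop) : ind p * ind q = ind (p ∧ q) := by
  by_cases hp : p <;> by_cases hq : q <;> simp [ind, hp, hq]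

theorem one_sub_ind (p : Prop) : 1 - ind p = ind (¬ p) := by
  by_cases hp : p <;> simp [ind, hp]

theorem one_sub_one_sub (a : ℕ) : 1 - (1 - a) = ind (a ≠ 0) := by
  unfold ind
  split_ifs <;> omega

theorem one_sub_sub (a b : ℕ) : 1 - (a - b) = ind (a ≤ b) := by
  unfold ind
  split_ifs <;> omega

theorem sum_ind (n : ℕ) (p : ℕ → Prop) [DecidablePred p] :
    ∑ i ∈ Finset.range n, ind (p i) = ((Finset.range n).filter p).card := by
  rw [Finset.card_filter]
  exact Finset.sum_congr rfl fun i _ => by unfold ind; congr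

theorem sum_ind_ne_zero (n : ℕ) (p : ℕ → Prop) :
    ∑ i ∈ Finset.range n, ind (p i) ≠ 0 ↔ ∃ i < n, p i := by
  simp [Finset.sum_eq_zero_iff]

namespace Exp

/-- Truth value of `e ≤ f`. -/
def le (e f : Exp) : Exp := sub (const 1) (sub e f)
/-- Truth value of `e < f`. -/
def lt (e f : Exp) : Exp := le (add e (const 1)) f
/-- Truth value of `e = f`. -/
def eq (e f : Exp) : Exp := mul (le e f) (le f e)
/-- Negation of a truth value. -/
def not (e : Exp) : Exp := sub (const 1) e
/-- Truth value of `e ≠ 0`. -/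
def nz (e : Exp) : Exp := sub (const 1) (sub (const 1) e)
/-- Disjunction of truth values. -/
def or (e f : Exp) : Exp := nz (add e f)
/-- Bounded existential quantification. -/
def any (x : ℕ) (e f : Exp) : Exp := nz (sum x e f)
/-- The quotient of the variables `y` and `z`, with the auxiliary variable `x`. -/
def div (x y z : ℕ) : Exp := sum x (var y) (le (mul (add (var x) (const 1)) (var z)) (var y))
/-- The remainder of the variables `y` and `z`, with the auxiliary variable `x`. -/
def mod (x y z : ℕ) : Exp := sub (var y) (mul (div x y z) (var z))

variable {e f : Exp} {σ : St} {p q : Prop}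

theorem eval_le' : (le e f).eval σ = ind (e.eval σ ≤ f.eval σ) := one_sub_sub _ _

theorem eval_lt : (lt e f).eval σ = ind (e.eval σ < f.eval σ) := one_sub_sub _ _

theorem eval_nz : (nz e).eval σ = ind (e.eval σ ≠ 0) := one_sub_one_sub _

theorem eval_eq : (eq e f).eval σ = ind (e.eval σ = f.eval σ) := by
  rw [eq, eval, eval_le', eval_le', ind_mul]
  exact ind_congr le_antisymm_iff.symm

theorem eval_not (h : e.eval σ = ind p) : (not e).eval σ = ind (¬ p) := by
  rw [not, eval, h]; exact one_sub_ind p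

theorem eval_and (h : e.eval σ = ind p) (h' : f.eval σ = ind q) :
    (mul e f).eval σ = ind (p ∧ q) := by
  rw [eval, h, h', ind_mul]

theorem eval_or (h : e.eval σ = ind p) (h' : f.eval σ = ind q) :
    (or e f).eval σ = ind (p ∨ q) := by
  rw [or, eval_nz]
  refine ind_congr ?_
  rw [eval, h, h']
  by_cases hp : p <;> by_cases hq : q <;> simp [ind, hp, hq]

theorem eval_any {x : ℕ} {P : ℕ → Prop}
    (h : ∀ i < e.eval σ, f.eval (σ.setV x i) = ind (P i)) :
    (any x e f).eval σ = ind (∃ i < e.eval σ, P i) := by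
  rw [any, eval_nz, eval, Finset.sum_congr rfl fun i hi => h i (Finset.mem_range.1 hi)]
  exact ind_congr (sum_ind_ne_zero _ _)

/-- The quotient is the number of i with (i + 1) z ≤ y; a count is safe in the above sense. -/
theorem eval_div {x y z : ℕ} (hxy : y ≠ x) (hxz : z ≠ x) (hz : 0 < σ.v z) :
    (div x y z).eval σ = σ.v y / σ.v z := by
  have : ∀ i, (le (mul (add (var x) (const 1)) (var z)) (var y)).eval (σ.setV x i) =
      ind (i < σ.v y / σ.v z) := fun i => by
    rw [eval_le']
    simp only [eval, St.setV_v, if_true, if_neg hxy, if_neg hxz]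
    exact ind_congr (Nat.le_div_iff_mul_le hz).symm
  rw [div, eval]
  simp only [this, eval]
  rw [sum_ind]
  have h₂ : (Finset.range (σ.v y)).filter (fun i => i < σ.v y / σ.v z) =
      Finset.range (σ.v y / σ.v z) := by
    ext i
    have := Nat.div_le_self (σ.v y) (σ.v z)
    simp only [Finset.mem_filter, Finset.mem_range]
    omega
  rw [h₂, Finset.card_range]

theorem eval_mod {x y z : ℕ} (hxy : y ≠ x) (hxz : z ≠ x) (hz : 0 < σ.v z) :
    (mod x y z).eval σ = σ.v y % σ.v z := by
  have h : (mod x y z).eval σ = σ.v y - (div x y z).eval σ * σ.v z := rfl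
  rw [h, eval_div hxy hxz hz]
  have := Nat.div_add_mod' (σ.v y) (σ.v z)
  omega

end Exp

end Ram

/-! ### Programs for elimination, degeneracy and minimal obstructions -/

namespace Ram

open SimpleGraph Exp

/-- Sequential composition of loop programs. -/
infixr:60 " ⨟ " => Stmt.seq

/-- The array `a` holds the adjacency matrix of `H` on the vertices below `n`. -/
def RepG (n : ℕ) (H : SimpleGraph ℕ) (σ : St) (a : Fin 4) : Prop :=
  ∀ i < n, ∀ j < n, σ.A a (i * n + j) = ind (H.Adj i j)

/-- The array `a` holds the characteristic function of `S` on the numbers below `n`. -/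
def RepS (n : ℕ) (S : Finset ℕ) (σ : St) (a : Fin 4) : Prop :=
  ∀ i < n, σ.A a i = ind (i ∈ S)

theorem RepG.congr {n : ℕ} {H : SimpleGraph ℕ} {σ τ : St} {a : Fin 4} (h : RepG n H σ a)
    (e : τ.A a = σ.A a) : RepG n H τ a := by unfold RepG; rwa [e]

theorem RepS.congr {n : ℕ} {S : Finset ℕ} {σ τ : St} {a : Fin 4} (h : RepS n S σ a)
    (e : τ.A a = σ.A a) : RepS n S τ a := by unfold RepS; rwa [e]

theorem index_lt {n i j : ℕ} (hi : i < n) (hj : j < n) : i * n + j < n * n := by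
  calc i * n + j < i * n + n := by omega
    _ = (i + 1) * n := by ring
    _ ≤ n * n := Nat.mul_le_mul_right _ hi

/-- Truth value of the adjacency of the variables `x` and `y`. -/
def adjE (x y : ℕ) : Exp := arr 0 (add (mul (var x) (var 1)) (var y))

theorem eval_adjE {n : ℕ} {H : SimpleGraph ℕ} {σ : St} (h : RepG n H σ 0) (hn : σ.v 1 = n)
    {x y : ℕ} (hx : σ.v x < n) (hy : σ.v y < n) :
    (adjE x y).eval σ = ind (H.Adj (σ.v x) (σ.v y)) := by
  simp only [adjE, eval, hn]
  exact h _ hx _ hy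

theorem eval_arr {n : ℕ} {S : Finset ℕ} {σ : St} {a : Fin 4} (h : RepS n S σ a) {x : ℕ}
    (hx : σ.v x < n) : (arr a (var x)).eval σ = ind (σ.v x ∈ S) := h _ hx

/-- The expression may depend on the loop variable and on whatever the loop leaves alone, but not on
the array being filled; its value is then unaffected by earlier passes. -/
theorem fill_spec {x : ℕ} {a : Fin 4} {b e : Exp} {σ : St} {E : ℕ → ℕ}
    (hE : ∀ i < b.eval σ, ∀ τ : St, τ.v x = i → (∀ y, y ≠ x → τ.v y = σ.v y) →
      (∀ a', a' ≠ a → τ.A a' = σ.A a') → τ.base = σ.base → τ.input = σ.input →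
      e.eval τ = E i) :
    ∀ i < b.eval σ, ((Stmt.loop x b (.store a (var x) e)).den σ).A a i = E i := by
  refine Stmt.for_inv (fun k τ => ∀ i < k, τ.A a i = E i) (by simp) (fun _ _ _ h => h) ?_
  intro i hi τ hx hf hτ j hj
  have he := hE i hi τ hx (fun y hy => hf.v y (by simp [Stmt.modV]) hy)
    (fun a' ha => hf.A a' (by simpa [Stmt.modA] using ha)) hf.base hf.input
  simp only [Stmt.den, St.setA_A, eval, hx, true_and]
  split_ifs with h
  · rw [he, h]
  · exact hτ j (by omega)

/-- `n` rounds of deleting the vertices that are not `bad` from the set in array `1`. -/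
def killC (bad : Exp) : Stmt :=
  .loop 20 (var 1) (.loop 21 (var 1) (.store 1 (var 21) (mul (arr 1 (var 21)) bad)))

/-- The two loops mirror `killAll`. Multiplying the cell by the test deletes a vertex exactly when
the test fails. -/
theorem killC_spec {bad : Exp} {P : Finset ℕ → ℕ → Prop} {n : ℕ} {S : Finset ℕ} {σ : St}
    (hn : σ.v 1 = n) (hS : S ⊆ Finset.range n) (hrep : RepS n S σ 1)
    (hbad : ∀ (τ : St) (T : Finset ℕ), T ⊆ Finset.range n →
      (∀ y, y ≠ 20 → y ≠ 21 → τ.v y = σ.v y) → (∀ a, a ≠ 1 → τ.A a = σ.A a) → RepS n T τ 1 →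
      τ.v 21 < n → bad.eval τ = ind (P T (τ.v 21))) :
    RepS n (killAll P n S) ((killC bad).den σ) 1 := by
  have key := Stmt.for_inv (x := 20) (e := var 1)
    (c := .loop 21 (var 1) (.store 1 (var 21) (mul (arr 1 (var 21)) bad))) (σ := σ)
    (fun k τ => RepS n (loopN (fun _ T => killRound P n T) k S) τ 1) hrep (fun _ _ _ h => h) ?_
  · rw [eval, hn] at key
    exact key
  intro i _ τ _ hf hτ
  have hsub : loopN (fun _ T => killRound P n T) i S ⊆ Finset.range n := by
    refine Finset.Subset.trans ?_ hS
    simpa [loopN] using loopN_subset (fun (_ : ℕ) T => killRound_subset (bad := P) (n := n) T) 0 i S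
  change RepS n (killRound P n (loopN (fun _ T => killRound P n T) i S)) _ 1
  generalize loopN (fun _ T => killRound P n T) i S = T at hτ hsub ⊢
  have hτn : τ.v 1 = n := by rw [hf.v 1 (by simp [Stmt.modV]) (by simp), hn]
  have key := Stmt.for_inv (x := 21) (e := var 1)
    (c := .store 1 (var 21) (mul (arr 1 (var 21)) bad)) (σ := τ)
    (fun k τ => RepS n (loopN (killStep P) k T) τ 1) hτ (fun _ _ _ h => h) ?_
  · rw [eval, hτn] at key
    exact key
  intro j hj ρ hρj hfρ hρ
  rw [eval, hτn] at hj
  have hsub' : loopN (killStep P) j T ⊆ Finset.range n := by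
    refine Finset.Subset.trans ?_ hsub
    simpa [loopN] using loopN_subset (killStep_subset (bad := P)) 0 j T
  change RepS n (killStep P j (loopN (killStep P) j T)) _ 1
  generalize loopN (killStep P) j T = U at hρ hsub' ⊢
  have hb := hbad ρ U hsub' (fun y h₁ h₂ => by
      rw [hfρ.v y (by simp [Stmt.modV]) h₂, hf.v y (by simp [Stmt.modV]) h₁])
    (fun a ha => by
      rw [hfρ.A a (by simpa [Stmt.modA] using ha), hf.A a (by simpa [Stmt.modA] using ha)])
    hρ (by omega)
  intro k hk
  simp only [Stmt.den, St.setA_A, eval, hρj, true_and]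
  split_ifs with h
  · subst h
    rw [hb, hρj, hρ k hk, ind_mul]
    refine ind_congr ?_
    unfold killStep
    split_ifs with h <;> simp [h]
  · rw [hρ k hk]
    refine ind_congr ?_
    unfold killStep
    split_ifs <;> simp [h]

/-- Truth value of the statement that the set in array `1` is nonempty. -/
def aliveE : Exp := any 22 (var 1) (arr 1 (var 22))

theorem eval_aliveE {n : ℕ} {S : Finset ℕ} {σ : St} (hn : σ.v 1 = n) (hS : S ⊆ Finset.range n)
    (h : RepS n S σ 1) : aliveE.eval σ = ind (¬ S = ∅) := by
  rw [aliveE, eval_any (P := fun i => i ∈ S)]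
  · refine ind_congr ?_
    rw [← Finset.not_nonempty_iff_eq_empty, not_not]
    constructor
    · rintro ⟨i, -, hi⟩
      exact ⟨i, hi⟩
    · rintro ⟨i, hi⟩
      exact ⟨i, by simpa [eval, hn] using hS hi, hi⟩
  · intro i hi
    rw [eval, hn] at hi
    have h' : RepS n S (σ.setV 22 i) 1 := h
    rw [eval_arr h' (by simpa [St.setV_v] using hi)]
    simp [St.setV_v]

/-- Truth value of the statement that variable `21` is not simplicial in the set in array `1`. -/
def badSimp : Exp :=
  any 22 (var 1) (any 23 (var 22) (mul (mul (arr 1 (var 22)) (arr 1 (var 23)))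
    (mul (mul (adjE 21 22) (adjE 21 23)) (Exp.not (adjE 22 23)))))

/-- By symmetry it suffices to look at pairs j < i, which also spares a test for distinctness. -/
theorem eval_badSimp {n : ℕ} {H : SimpleGraph ℕ} {T : Finset ℕ} {σ : St} (hn : σ.v 1 = n)
    (hG : RepG n H σ 0) (hT : T ⊆ Finset.range n) (h : RepS n T σ 1) (hv : σ.v 21 < n) :
    badSimp.eval σ = ind (¬ H.SimplicialIn T (σ.v 21)) := by
  rw [badSimp, eval_any (P := fun i => ∃ j < i, (i ∈ T ∧ j ∈ T) ∧
    (H.Adj (σ.v 21) i ∧ H.Adj (σ.v 21) j) ∧ ¬ H.Adj i j)]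
  · refine ind_congr ?_
    simp only [eval, hn]
    constructor
    · rintro ⟨i, -, j, hji, ⟨hi, hj⟩, ⟨hvi, hvj⟩, hn⟩ hs
      exact hn (hs i hi j hj hvi hvj hji.ne')
    · intro hs
      simp only [SimplicialIn, not_forall] at hs
      obtain ⟨a, ha, b, hb, hva, hvb, hab, hn⟩ := hs
      rcases lt_or_gt_of_ne hab with hlt | hlt
      · exact ⟨b, Finset.mem_range.1 (hT hb), a, hlt, ⟨hb, ha⟩, ⟨hvb, hva⟩, fun h => hn h.symm⟩
      · exact ⟨a, Finset.mem_range.1 (hT ha), b, hlt, ⟨ha, hb⟩, ⟨hva, hvb⟩, hn⟩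
  · intro i hi
    rw [eval, hn] at hi
    rw [eval_any (P := fun j => (i ∈ T ∧ j ∈ T) ∧
      (H.Adj (σ.v 21) i ∧ H.Adj (σ.v 21) j) ∧ ¬ H.Adj i j)]
    · simp [eval, St.setV_v]
    · intro j hj
      have hj : j < i := by simpa [eval, St.setV_v] using hj
      have h₁ : ((σ.setV 22 i).setV 23 j).v 1 = n := by simp [St.setV_v, hn]
      have e₁ : ((σ.setV 22 i).setV 23 j).v 21 = σ.v 21 := by simp [St.setV_v]
      have e₂ : ((σ.setV 22 i).setV 23 j).v 22 = i := by simp [St.setV_v]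
      have e₃ : ((σ.setV 22 i).setV 23 j).v 23 = j := by simp [St.setV_v]
      have hG' : RepG n H ((σ.setV 22 i).setV 23 j) 0 := hG
      have hT' : RepS n T ((σ.setV 22 i).setV 23 j) 1 := h
      rw [eval_and (eval_and (eval_arr hT' (by omega)) (eval_arr hT' (by omega)))
        (eval_and (eval_and (eval_adjE hG' h₁ (by omega) (by omega))
          (eval_adjE hG' h₁ (by omega) (by omega)))
          (eval_not (eval_adjE hG' h₁ (by omega) (by omega)))), e₁, e₂, e₃]

/-- Truth value of the statement that variable `21` has at least `l` neighbours in the set in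
array `1`. -/
def badDeg : Exp := le (var 0) (sum 22 (var 1) (mul (arr 1 (var 22)) (adjE 21 22)))

open Classical in
theorem eval_badDeg {n l : ℕ} {H : SimpleGraph ℕ} {T : Finset ℕ} {σ : St} (hl : σ.v 0 = l)
    (hn : σ.v 1 = n) (hG : RepG n H σ 0) (hT : T ⊆ Finset.range n) (h : RepS n T σ 1)
    (hv : σ.v 21 < n) : badDeg.eval σ = ind (l ≤ (T.filter (H.Adj (σ.v 21))).card) := by
  rw [badDeg, eval_le', eval, hl, eval, eval, hn]
  have : ∀ i ∈ Finset.range n, (mul (arr 1 (var 22)) (adjE 21 22)).eval (σ.setV 22 i) =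
      ind (i ∈ T ∧ H.Adj (σ.v 21) i) := by
    intro i hi
    have hi := Finset.mem_range.1 hi
    have h₁ : (σ.setV 22 i).v 1 = n := by simp [St.setV_v, hn]
    have e₁ : (σ.setV 22 i).v 21 = σ.v 21 := by simp [St.setV_v]
    have e₂ : (σ.setV 22 i).v 22 = i := by simp [St.setV_v]
    have hG' : RepG n H (σ.setV 22 i) 0 := hG
    have hT' : RepS n T (σ.setV 22 i) 1 := h
    rw [eval_and (eval_arr hT' (by omega)) (eval_adjE hG' h₁ (by omega) (by omega)), e₁, e₂]
  rw [Finset.sum_congr rfl this, sum_ind]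
  have h₂ : (Finset.range n).filter (fun i => i ∈ T ∧ H.Adj (σ.v 21) i) =
      T.filter (H.Adj (σ.v 21)) := by
    ext i
    simp only [Finset.mem_filter]
    exact ⟨fun h => h.2, fun h => ⟨hT h.1, h⟩⟩
  rw [h₂]

/-- Delete simplicial vertices from a copy of the set in array `2`. -/
def elimC : Stmt := .loop 21 (var 1) (.store 1 (var 21) (arr 2 (var 21))) ⨟ killC badSimp

/-- Array 0 is the current graph, array 2 the set under test, and array 1 the copy that is worn
down; the set has an elimination ordering if and only if nothing remains. -/
theorem elimC_spec {n : ℕ} {H : SimpleGraph ℕ} {S : Finset ℕ} {σ : St} (hn : σ.v 1 = n)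
    (hG : RepG n H σ 0) (hS : S ⊆ Finset.range n) (h : RepS n S σ 2) :
    aliveE.eval (elimC.den σ) = ind (¬ H.Elim S) := by
  have h₁ : RepS n S ((Stmt.loop 21 (var 1) (.store 1 (var 21) (arr 2 (var 21)))).den σ) 1 := by
    have := fill_spec (x := 21) (a := 1) (b := var 1) (e := arr 2 (var 21)) (σ := σ)
      (E := fun i => σ.A 2 i) (fun i hi τ hx _ hA _ _ => by simp [eval, hx, hA])
    rw [eval, hn] at this
    exact fun i hi => (this i hi).trans (h i hi)
  have h₂ := killC_spec (bad := badSimp) (P := fun T v => ¬ H.SimplicialIn T v)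
    (by rw [Stmt.den_v (by decide), hn]) hS h₁ (fun τ T hT hv hA hT' h21 =>
      eval_badSimp (by rw [hv 1 (by simp) (by simp), Stmt.den_v (by decide), hn])
        (hG.congr (by rw [hA 0 (by simp), Stmt.den_A (by decide)])) hT hT' h21)
  rw [elimC, Stmt.den_seq, eval_aliveE (n := n) _ _ h₂, killAll_simplicial_eq_empty H hS]
  · rw [Stmt.den_v (by decide), Stmt.den_v (by decide), hn]
  · exact (killAll_subset S).trans hS

/-- Compute a minimal set without perfect elimination ordering in array `2`. -/
def minC : Stmt :=
  .loop 21 (var 1) (.store 2 (var 21) (const 1)) ⨟ elimC ⨟ .assign 12 aliveE ⨟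
  .loop 21 (var 1) (.store 2 (var 21) (var 12)) ⨟
  .loop 24 (var 1) (.store 2 (var 24) (const 0) ⨟ elimC ⨟
    .store 2 (var 24) (mul (var 12) (Exp.not aliveE)))

/-- Variable 12 records whether the whole graph violates `Elim`. It both initialises array 2, as
everything or nothing, and guards the reinsertion of a vertex in the main loop. -/
theorem minC_spec {n : ℕ} {H : SimpleGraph ℕ} {σ : St} (hn : σ.v 1 = n) (hG : RepG n H σ 0) :
    RepS n (H.minNonElim n) (minC.den σ) 2 := by
  classical
  simp only [minC, Stmt.den_seq]
  set σ₁ := (Stmt.loop 21 (var 1) (.store 2 (var 21) (const 1))).den σ with hσ₁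
  have h₁ : RepS n (Finset.range n) σ₁ 2 := by
    have := fill_spec (x := 21) (a := 2) (b := var 1) (e := const 1) (σ := σ)
      (E := fun i => 1) (fun i hi τ hx _ hA _ _ => rfl)
    rw [eval, hn] at this
    exact fun i hi => (this i hi).trans (ind_true (Finset.mem_range.2 hi)).symm
  have h₂ := elimC_spec (n := n) (H := H) (σ := σ₁) (by rw [hσ₁, Stmt.den_v (by decide), hn])
    (hG.congr (by rw [hσ₁, Stmt.den_A (by decide)])) subset_rfl h₁
  set σ₂ := (Stmt.assign 12 aliveE).den (elimC.den σ₁) with hσ₂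
  have h₃ : σ₂.v 12 = ind (¬ H.Elim (Finset.range n)) := by
    rw [hσ₂, Stmt.den, h₂]; simp [St.setV_v]
  have hn₂ : σ₂.v 1 = n := by
    rw [hσ₂, Stmt.den_v (by decide), Stmt.den_v (by decide), hσ₁, Stmt.den_v (by decide), hn]
  set σ₃ := (Stmt.loop 21 (var 1) (.store 2 (var 21) (var 12))).den σ₂ with hσ₃
  have h₄ : RepS n (if H.Elim (Finset.range n) then ∅ else Finset.range n) σ₃ 2 := by
    have := fill_spec (x := 21) (a := 2) (b := var 1) (e := var 12) (σ := σ₂)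
      (E := fun i => σ₂.v 12) (fun i hi τ hx hv hA _ _ => hv 12 (by simp))
    rw [eval, hn₂] at this
    refine fun i hi => (this i hi).trans (h₃.trans (ind_congr ?_))
    split_ifs with h <;> simp [h, hi]
  have hn₃ : σ₃.v 1 = n := by rw [hσ₃, Stmt.den_v (by decide), hn₂]
  have h₃' : σ₃.v 12 = ind (¬ H.Elim (Finset.range n)) := by
    rw [hσ₃, Stmt.den_v (by decide), h₃]
  have hG₃ : RepG n H σ₃ 0 := hG.congr (by
    rw [hσ₃, Stmt.den_A (by decide), hσ₂, Stmt.den_A (by decide), Stmt.den_A (by decide), hσ₁,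
      Stmt.den_A (by decide)])
  have key := Stmt.for_inv (x := 24) (e := var 1) (c := .store 2 (var 24) (const 0) ⨟ elimC ⨟
    .store 2 (var 24) (mul (var 12) (Exp.not aliveE))) (σ := σ₃)
    (fun k τ => RepS n (loopN (H.minStep n) k
      (if H.Elim (Finset.range n) then ∅ else Finset.range n)) τ 2 ∧
      loopN (H.minStep n) k (if H.Elim (Finset.range n) then ∅ else Finset.range n) ⊆ Finset.range n)
    ⟨h₄, by rw [loopN]; split_ifs <;> simp⟩ (fun _ _ _ h => h) ?_
  · rw [eval, hn₃] at key
    exact key.1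
  rintro i hi τ hτi hf ⟨hτ, hsub⟩
  rw [eval, hn₃] at hi
  change RepS n (H.minStep n i (loopN (H.minStep n) i _)) _ 2 ∧
    H.minStep n i (loopN (H.minStep n) i _) ⊆ _
  generalize loopN (H.minStep n) i _ = U at hτ hsub ⊢
  simp only [minStep]
  have hτn : τ.v 1 = n := by rw [hf.v 1 (by decide) (by simp), hn₃]
  have hτ12 : τ.v 12 = ind (¬ H.Elim (Finset.range n)) := by
    rw [hf.v 12 (by decide) (by simp), h₃']
  have hU : RepS n (U.erase i) ((Stmt.store 2 (var 24) (const 0)).den τ) 2 := by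
    intro j hj
    simp only [Stmt.den, St.setA_A, eval, hτi, true_and]
    split_ifs with h
    · subst h; simp [ind]
    · rw [hτ j hj]; exact ind_congr (by simp [h])
  have hE := elimC_spec (n := n) (H := H) (σ := (Stmt.store 2 (var 24) (const 0)).den τ)
    (by rw [Stmt.den_v (by decide), hτn])
    (hG₃.congr (by rw [Stmt.den_A (by decide), hf.A 0 (by decide)]))
    ((Finset.erase_subset _ _).trans hsub) hU
  refine ⟨fun j hj => ?_, ?_⟩
  · rw [Stmt.den_seq, Stmt.den_seq, Stmt.den, St.setA_A, eval_and (p := ¬ H.Elim (Finset.range n))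
      (by rw [eval, Stmt.den_v (by decide), Stmt.den_v (by decide), hτ12]) (eval_not hE),
      eval, Stmt.den_v (by decide), Stmt.den_v (by decide), hτi, Stmt.den_A (by decide)]
    simp only [true_and, not_not]
    split_ifs with h₁ h₂ h₂
    · exact ind_congr (by simp [h₁, h₂])
    · exact ind_congr (by simp [h₁, h₂])
    · rw [hU j hj]; exact ind_congr (by simp [h₁])
    · exact hU j hj
  · split_ifs
    · exact Finset.insert_subset (Finset.mem_range.2 hi) hsub
    · exact (Finset.erase_subset _ _).trans hsub

end Ram

/-! ### One branch of the search as a program -/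

namespace Ram

open SimpleGraph Exp

/-- The element of the set in array `2` whose rank is the value of `r`. -/
def pickE (r : ℕ) : Exp :=
  sub (sub (var 1) (const 1)) (sub (sub (var 1) (const 1)) (sum 24 (var 1)
    (mul (mul (arr 2 (var 24)) (Exp.eq (sum 25 (var 24) (arr 2 (var 25))) (var r))) (var 24))))

theorem eval_pickE {n r : ℕ} {S : Finset ℕ} {σ : St} (hr : r ≠ 24) (hn : σ.v 1 = n)
    (h : RepS n S σ 2) : (pickE r).eval σ = pick n S (σ.v r) := by
  have key : ∀ i ∈ Finset.range n,
      (mul (mul (arr 2 (var 24)) (Exp.eq (sum 25 (var 24) (arr 2 (var 25))) (var r)))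
        (var 24)).eval (σ.setV 24 i) =
      if i ∈ S ∧ (S.filter (· < i)).card = σ.v r then i else 0 := by
    intro i hi
    have hi := Finset.mem_range.1 hi
    have e₁ : (σ.setV 24 i).v 24 = i := by simp [St.setV_v]
    have e₂ : (σ.setV 24 i).v r = σ.v r := by simp [St.setV_v, hr]
    have hT : RepS n S (σ.setV 24 i) 2 := h
    have hrank : (sum 25 (var 24) (arr 2 (var 25))).eval (σ.setV 24 i) =
        (S.filter (· < i)).card := by
      have h₁ : ∀ j ∈ Finset.range i, (arr 2 (var 25)).eval ((σ.setV 24 i).setV 25 j) =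
          ind (j ∈ S) := by
        intro j hj
        have hj := Finset.mem_range.1 hj
        have hT' : RepS n S ((σ.setV 24 i).setV 25 j) 2 := h
        have e₃ : ((σ.setV 24 i).setV 25 j).v 25 = j := by simp [St.setV_v]
        rw [eval_arr hT' (by omega), e₃]
      rw [eval, eval, e₁, Finset.sum_congr rfl h₁, sum_ind]
      congr 1
      ext j
      simp [and_comm]
    rw [eval, eval_and (eval_arr hT (by omega)) eval_eq, hrank, eval, eval, e₁, e₂]
    unfold ind
    split_ifs <;> simp
  have : (pickE r).eval σ = σ.v 1 - 1 - (σ.v 1 - 1 - ∑ i ∈ Finset.range (σ.v 1),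
    (mul (mul (arr 2 (var 24)) (Exp.eq (sum 25 (var 24) (arr 2 (var 25))) (var r)))
        (var 24)).eval (σ.setV 24 i)) := rfl
  rw [this, hn, Finset.sum_congr rfl key, pick]

/-- Adjacency of the variables `17` and `18` after the operation on the pair in the variables `13`
and `14`. -/
def newAdj : Exp :=
  Exp.or (mul (lt (var 13) (var 14)) (Exp.or (adjE 17 18)
      (Exp.or (mul (Exp.eq (var 17) (var 13)) (Exp.eq (var 18) (var 14)))
        (mul (Exp.eq (var 17) (var 14)) (Exp.eq (var 18) (var 13))))))
    (Exp.or (mul (mul (lt (var 14) (var 13)) (Exp.not (adjE 13 14)))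
      (mul (Exp.not (Exp.eq (var 17) (var 18))) (mul (Exp.not (Exp.eq (var 17) (var 14)))
        (mul (Exp.not (Exp.eq (var 18) (var 14))) (Exp.or (adjE 17 18)
          (Exp.or (mul (Exp.eq (var 17) (var 13)) (adjE 14 18))
            (mul (Exp.eq (var 18) (var 13)) (adjE 17 14))))))))
      (mul (mul (Exp.not (lt (var 13) (var 14)))
        (Exp.not (mul (lt (var 14) (var 13)) (Exp.not (adjE 13 14))))) (adjE 17 18)))

-- The three disjuncts carry mutually exclusive guards, one for each case of `Branch.next`:
-- addition, contraction, no change.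
open Classical in
theorem eval_newAdj {n : ℕ} {H : SimpleGraph ℕ} {σ : St} (hn : σ.v 1 = n) (hG : RepG n H σ 0)
    {i j p q : ℕ} (hi : σ.v 17 = i) (hj : σ.v 18 = j) (hp : σ.v 13 = p) (hq : σ.v 14 = q)
    (hin : i < n) (hjn : j < n) (hpn : p < n) (hqn : q < n) :
    newAdj.eval σ = ind ((if p < q then H ⊔ edge p q
      else if q < p ∧ ¬ H.Adj p q then H.contractInto p q else H).Adj i j) := by
  have hadj : ∀ x y, σ.v x < n → σ.v y < n → (adjE x y).eval σ = ind (H.Adj (σ.v x) (σ.v y)) :=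
    fun x y hx hy => eval_adjE hG hn hx hy
  rw [newAdj, eval_or (eval_and eval_lt (eval_or (hadj 17 18 (by omega) (by omega))
    (eval_or (eval_and eval_eq eval_eq) (eval_and eval_eq eval_eq))))
    (eval_or (eval_and (eval_and eval_lt (eval_not (hadj 13 14 (by omega) (by omega))))
      (eval_and (eval_not eval_eq) (eval_and (eval_not eval_eq) (eval_and (eval_not eval_eq)
        (eval_or (hadj 17 18 (by omega) (by omega))
          (eval_or (eval_and eval_eq (hadj 14 18 (by omega) (by omega)))
            (eval_and eval_eq (hadj 17 14 (by omega) (by omega)))))))))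
      (eval_and (eval_and (eval_not eval_lt) (eval_not (eval_and eval_lt
        (eval_not (hadj 13 14 (by omega) (by omega)))))) (hadj 17 18 (by omega) (by omega))))]
  refine ind_congr ?_
  simp only [eval, hi, hj, hp, hq]
  split_ifs with h₁ h₂
  · have h₃ : ¬ q < p := not_lt.2 h₁.le
    simp only [h₁, h₃, true_and, false_and, not_true_eq_false, or_false, sup_adj, edge_adj]
    have : (i = p ∧ j = q ∨ i = q ∧ j = p) → i ≠ j := by omega
    tauto
  · simp only [h₁, h₂, false_and, false_or, not_false_eq_true, true_and, and_true, not_true_eq_false,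
      or_false]
    rfl
  · simp only [h₁, h₂, false_and, false_or, not_false_eq_true, true_and]

/-- Write the new adjacency matrix into array `3` and copy it to array `0`. -/
def updC : Stmt :=
  .loop 25 (var 2) (.assign 17 (div 26 25 1) ⨟
    .assign 18 (sub (var 25) (mul (var 17) (var 1))) ⨟ .store 3 (var 25) newAdj) ⨟
  .loop 25 (var 2) (.store 0 (var 25) (arr 3 (var 25)))

-- The new entries depend on several old ones, so the matrix is built in array 3 before array 0 is
-- overwritten. An index m below n² is decoded as row m / n and column m % n.
open Classical in
theorem updC_spec {n : ℕ} {H : SimpleGraph ℕ} {σ : St} (hn : σ.v 1 = n) (hnn : σ.v 2 = n * n)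
    (hG : RepG n H σ 0) {p q : ℕ} (hp : σ.v 13 = p) (hq : σ.v 14 = q) (hpn : p ≤ n - 1)
    (hqn : q ≤ n - 1) :
    RepG n (if p < q then H ⊔ edge p q
      else if q < p ∧ ¬ H.Adj p q then H.contractInto p q else H) (updC.den σ) 0 := by
  set H' := (if p < q then H ⊔ edge p q
      else if q < p ∧ ¬ H.Adj p q then H.contractInto p q else H)
  set c : Stmt := .assign 17 (div 26 25 1) ⨟
    .assign 18 (sub (var 25) (mul (var 17) (var 1))) ⨟ .store 3 (var 25) newAdj with hc
  have key := Stmt.for_inv (x := 25) (e := var 2) (c := c) (σ := σ)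
    (fun k τ => ∀ i < k, τ.A 3 i = ind (H'.Adj (i / n) (i % n)))
    (by simp) (fun _ _ _ h => h) (by
      intro m hm τ hx hf hτ k hk
      rw [eval, hnn] at hm
      have hn0 : 0 < n := Nat.pos_of_ne_zero (by rintro rfl; simp at hm)
      have hτn : τ.v 1 = n := by rw [hf.v 1 (by decide) (by simp), hn]
      have hdiv : (div 26 25 1).eval τ = m / n := by
        rw [eval_div (by simp) (by simp) (by omega), hx, hτn]
      rw [hc, Stmt.den_seq, Stmt.den_seq]
      set τ₁ := (Stmt.assign 17 (div 26 25 1)).den τ with hτ₁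
      set τ₂ := (Stmt.assign 18 (sub (var 25) (mul (var 17) (var 1)))).den τ₁ with hτ₂
      have h17 : τ₁.v 17 = m / n := by rw [hτ₁, Stmt.den, hdiv]; simp [St.setV_v]
      have h17' : τ₂.v 17 = m / n := by rw [hτ₂, Stmt.den_v (by decide), h17]
      have h25 : τ₂.v 25 = m := by
        rw [hτ₂, Stmt.den_v (by decide), hτ₁, Stmt.den_v (by decide), hx]
      have h1 : τ₂.v 1 = n := by
        rw [hτ₂, Stmt.den_v (by decide), hτ₁, Stmt.den_v (by decide), hτn]
      have h18 : τ₂.v 18 = m % n := by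
        rw [hτ₂, Stmt.den]
        simp only [St.setV_v, if_true, eval, h17]
        rw [hτ₁, Stmt.den_v (by decide), Stmt.den_v (by decide), hx, hτn]
        have := Nat.div_add_mod' m n
        omega
      have h13 : τ₂.v 13 = p := by
        rw [hτ₂, Stmt.den_v (by decide), hτ₁, Stmt.den_v (by decide),
          hf.v 13 (by decide) (by simp), hp]
      have h14 : τ₂.v 14 = q := by
        rw [hτ₂, Stmt.den_v (by decide), hτ₁, Stmt.den_v (by decide),
          hf.v 14 (by decide) (by simp), hq]
      have hG₂ : RepG n H τ₂ 0 := hG.congr (by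
        rw [hτ₂, Stmt.den_A (by decide), hτ₁, Stmt.den_A (by decide), hf.A 0 (by decide)])
      have hnew : newAdj.eval τ₂ = ind (H'.Adj (m / n) (m % n)) :=
        eval_newAdj h1 hG₂ h17' h18 h13 h14
          (Nat.div_lt_of_lt_mul hm) (Nat.mod_lt _ hn0) (by omega) (by omega)
      rw [Stmt.den, St.setA_A, hnew, eval, h25]
      simp only [true_and]
      by_cases h : k = m
      · rw [if_pos h, h]
      · rw [if_neg h, hτ₂, Stmt.den_A (by decide), hτ₁, Stmt.den_A (by decide)]
        exact hτ k (by omega))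
  rw [updC, Stmt.den_seq]
  set σ₁ := (Stmt.loop 25 (var 2) c).den σ with hσ₁
  have h₂ := fill_spec (x := 25) (a := 0) (b := var 2) (e := arr 3 (var 25)) (σ := σ₁)
    (E := fun i => σ₁.A 3 i) (fun i hi τ hx _ hA _ _ => by simp [eval, hx, hA])
  have hnn₁ : σ₁.v 2 = n * n := by rw [hσ₁, Stmt.den_v (by decide), hnn]
  rw [eval, hnn₁] at h₂
  rw [eval, hnn] at key
  intro i hi j hj
  rw [h₂ _ (index_lt hi hj), key _ (index_lt hi hj)]
  have hn0 : 0 < n := by omega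
  rw [Nat.add_comm, Nat.add_mul_div_right _ _ hn0, Nat.div_eq_of_lt hj, zero_add,
    Nat.add_mul_mod_self_right, Nat.mod_eq_of_lt hj]

/-- One step of a branch of the search. -/
def stepC : Stmt :=
  minC ⨟ .assign 15 (mod 26 7 4) ⨟ .assign 7 (div 26 7 4) ⨟ .assign 16 (mod 26 7 4) ⨟
  .assign 7 (div 26 7 4) ⨟ .assign 13 (pickE 15) ⨟ .assign 14 (pickE 16) ⨟
  .assign 8 (mul (Exp.not (lt (var 14) (var 13))) (var 8)) ⨟ updC

/-- The program state represents a state of a branch. -/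
structure RepB (n : ℕ) (s : Branch) (σ : St) : Prop where
  graph : RepG n s.graph σ 0
  choices : σ.v 7 = s.choices
  flag : σ.v 8 = s.flag

/-- Variables 15 and 16 receive the two digits, 13 and 14 the selected vertices, 7 the remaining
choices and 8 the flag. Both vertices are picked from the obstruction of the old graph before the
update. -/
theorem stepC_spec {n b : ℕ} {s : Branch} {σ : St} (hn : σ.v 1 = n) (hnn : σ.v 2 = n * n)
    (hb : σ.v 4 = b) (hb0 : 0 < b) (h : RepB n s σ) : RepB n (s.next n b) (stepC.den σ) := by
  simp only [stepC, Stmt.den_seq]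
  have hS := minC_spec hn h.graph
  set σ₁ := minC.den σ with hσ₁
  set σ₂ := (Stmt.assign 15 (mod 26 7 4)).den σ₁ with hσ₂
  set σ₃ := (Stmt.assign 7 (div 26 7 4)).den σ₂ with hσ₃
  set σ₄ := (Stmt.assign 16 (mod 26 7 4)).den σ₃ with hσ₄
  set σ₅ := (Stmt.assign 7 (div 26 7 4)).den σ₄ with hσ₅
  set σ₆ := (Stmt.assign 13 (pickE 15)).den σ₅ with hσ₆
  set σ₇ := (Stmt.assign 14 (pickE 16)).den σ₆ with hσ₇
  set σ₈ := (Stmt.assign 8 (mul (Exp.not (lt (var 14) (var 13))) (var 8))).den σ₇ with hσ₈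
  have v2 : ∀ y, y ≠ 15 → σ₂.v y = σ₁.v y := fun y hy => by
    rw [hσ₂, Stmt.den_v (by simpa [Stmt.modV] using hy)]
  have v3 : ∀ y, y ≠ 7 → σ₃.v y = σ₂.v y := fun y hy => by
    rw [hσ₃, Stmt.den_v (by simpa [Stmt.modV] using hy)]
  have v4 : ∀ y, y ≠ 16 → σ₄.v y = σ₃.v y := fun y hy => by
    rw [hσ₄, Stmt.den_v (by simpa [Stmt.modV] using hy)]
  have v5 : ∀ y, y ≠ 7 → σ₅.v y = σ₄.v y := fun y hy => by
    rw [hσ₅, Stmt.den_v (by simpa [Stmt.modV] using hy)]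
  have v6 : ∀ y, y ≠ 13 → σ₆.v y = σ₅.v y := fun y hy => by
    rw [hσ₆, Stmt.den_v (by simpa [Stmt.modV] using hy)]
  have v7 : ∀ y, y ≠ 14 → σ₇.v y = σ₆.v y := fun y hy => by
    rw [hσ₇, Stmt.den_v (by simpa [Stmt.modV] using hy)]
  have v8 : ∀ y, y ≠ 8 → σ₈.v y = σ₇.v y := fun y hy => by
    rw [hσ₈, Stmt.den_v (by simpa [Stmt.modV] using hy)]
  have hb₁ : σ₁.v 4 = b := by rw [hσ₁, Stmt.den_v (by decide), hb]
  have hb₂ : σ₂.v 4 = b := by rw [v2 4 (by simp), hb₁]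
  have hb₃ : σ₃.v 4 = b := by rw [v3 4 (by simp), hb₂]
  have hb₄ : σ₄.v 4 = b := by rw [v4 4 (by simp), hb₃]
  have t₁ : σ₁.v 7 = s.choices := by rw [hσ₁, Stmt.den_v (by decide), h.choices]
  have t₂ : σ₂.v 7 = s.choices := by rw [v2 7 (by simp), t₁]
  have t₃ : σ₃.v 7 = s.choices / b := by
    rw [hσ₃, Stmt.den, eval_div (by simp) (by simp) (by omega), t₂, hb₂]; simp [St.setV_v]
  have t₄ : σ₄.v 7 = s.choices / b := by rw [v4 7 (by simp), t₃]
  have t₅ : σ₅.v 7 = s.choices / b / b := by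
    rw [hσ₅, Stmt.den, eval_div (by simp) (by simp) (by omega), t₄, hb₄]; simp [St.setV_v]
  have α₂ : σ₂.v 15 = s.choices % b := by
    rw [hσ₂, Stmt.den, eval_mod (by simp) (by simp) (by omega), t₁, hb₁]; simp [St.setV_v]
  have α₅ : σ₅.v 15 = s.choices % b := by
    rw [v5 15 (by simp), v4 15 (by simp), v3 15 (by simp), α₂]
  have β₄ : σ₄.v 16 = s.choices / b % b := by
    rw [hσ₄, Stmt.den, eval_mod (by simp) (by simp) (by omega), t₃, hb₃]; simp [St.setV_v]
  have β₆ : σ₆.v 16 = s.choices / b % b := by rw [v6 16 (by simp), v5 16 (by simp), β₄]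
  have n₅ : σ₅.v 1 = n := by
    rw [v5 1 (by simp), v4 1 (by simp), v3 1 (by simp), v2 1 (by simp), hσ₁,
      Stmt.den_v (by decide), hn]
  have n₆ : σ₆.v 1 = n := by rw [v6 1 (by simp), n₅]
  have A₅ : σ₅.A = σ₁.A := rfl
  have A₆ : σ₆.A = σ₁.A := rfl
  have A₈ : σ₈.A = σ₁.A := rfl
  have p₆ : σ₆.v 13 = pick n (s.graph.minNonElim n) (s.choices % b) := by
    rw [hσ₆, Stmt.den, eval_pickE (by simp) n₅ (hS.congr (by rw [A₅])), α₅]; simp [St.setV_v]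
  have q₇ : σ₇.v 14 = pick n (s.graph.minNonElim n) (s.choices / b % b) := by
    rw [hσ₇, Stmt.den, eval_pickE (by simp) n₆ (hS.congr (by rw [A₆])), β₆]; simp [St.setV_v]
  have p₇ := (v7 13 (by simp)).trans p₆
  have p₈ := (v8 13 (by simp)).trans p₇
  have q₈ := (v8 14 (by simp)).trans q₇
  have f₇ : σ₇.v 8 = s.flag := by
    rw [v7 8 (by simp), v6 8 (by simp), v5 8 (by simp), v4 8 (by simp), v3 8 (by simp),
      v2 8 (by simp), hσ₁, Stmt.den_v (by decide), h.flag]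
  have f₈ : σ₈.v 8 = if pick n (s.graph.minNonElim n) (s.choices / b % b) <
      pick n (s.graph.minNonElim n) (s.choices % b) then 0 else s.flag := by
    rw [hσ₈, Stmt.den, eval, eval_not eval_lt]
    simp only [eval, p₇, q₇, f₇, St.setV_v, if_true]
    unfold ind
    split_ifs <;> simp_all
  refine ⟨?_, ?_, ?_⟩
  · refine updC_spec (H := s.graph) ?_ ?_ (h.graph.congr ?_) p₈ q₈ (pick_le _ _) (pick_le _ _)
    · rw [v8 1 (by simp), v7 1 (by simp), n₆]
    · rw [v8 2 (by simp), v7 2 (by simp), v6 2 (by simp), v5 2 (by simp), v4 2 (by simp),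
        v3 2 (by simp), v2 2 (by simp), hσ₁, Stmt.den_v (by decide), hnn]
    · rw [A₈, hσ₁, Stmt.den_A (by decide)]
  · rw [Stmt.den_v (by decide), v8 7 (by simp), v7 7 (by simp), v6 7 (by simp), t₅]
    rfl
  · rw [Stmt.den_v (by decide), f₈]
    rfl

/-- Follow the branch given by variable `6` for `d` steps, and test the resulting graph. -/
def branchC : Stmt :=
  .assign 7 (var 6) ⨟ .assign 8 (const 1) ⨟
  .loop 25 (var 2) (.store 0 (var 25) (inp (var 25))) ⨟
  .loop 27 (var 3) stepC ⨟
  .loop 21 (var 1) (.store 2 (var 21) (const 1)) ⨟ elimC ⨟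
  .assign 9 (Exp.or (var 9) (mul (Exp.not aliveE) (nz (var 8)))) ⨟
  .loop 21 (var 1) (.store 1 (var 21) (const 1)) ⨟ killC badDeg ⨟
  .assign 10 (Exp.or (var 10) (Exp.not aliveE))

/-- The parameters of the search are stored in the variables and in the input. -/
structure Params (n l d : ℕ) (G : SimpleGraph ℕ) (σ : St) : Prop where
  hl : σ.v 0 = l
  hn : σ.v 1 = n
  hnn : σ.v 2 = n * n
  hd : σ.v 3 = d
  hbase : σ.base = n * n
  hinput : ∀ i < n, ∀ j < n, σ.input (i * n + j) = ind (G.Adj i j)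

/-- Variable 9 accumulates the success of branches that only added edges, variable 10 that of
degenerate leaves. The graph is reloaded from the read-only input for each branch. A positive base
is needed only for d ≠ 0, since no division is performed otherwise. -/
theorem branchC_spec {n l d b N : ℕ} {G : SimpleGraph ℕ} {σ : St} {P Q : Prop}
    (hσ : Params n l d G σ) (hb : σ.v 4 = b) (hb0 : d ≠ 0 → 0 < b) (hN : σ.v 6 = N)
    (hP : σ.v 9 = ind P) (hQ : σ.v 10 = ind Q) :
    (branchC.den σ).v 9 = ind (P ∨
      ((Branch.next n b)^[d] ⟨G, N, 1⟩).graph.Elim (Finset.range n) ∧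
      ((Branch.next n b)^[d] ⟨G, N, 1⟩).flag ≠ 0) ∧
    (branchC.den σ).v 10 = ind (Q ∨
      ((Branch.next n b)^[d] ⟨G, N, 1⟩).graph.Degenerate (Finset.range n) l) := by
  classical
  simp only [branchC, Stmt.den_seq]
  set σ₁ := (Stmt.assign 8 (const 1)).den ((Stmt.assign 7 (var 6)).den σ) with hσ₁
  set σ₂ := (Stmt.loop 25 (var 2) (.store 0 (var 25) (inp (var 25)))).den σ₁ with hσ₂
  have v1 : ∀ y, y ≠ 7 → y ≠ 8 → σ₁.v y = σ.v y := fun y h₇ h₈ => by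
    rw [hσ₁, Stmt.den_v (by simpa [Stmt.modV] using h₈), Stmt.den_v (by simpa [Stmt.modV] using h₇)]
  have v2 : ∀ y, σ₂.v y = σ₁.v y := fun y => by rw [hσ₂, Stmt.den_v (by simp [Stmt.modV])]
  have h₂ : RepB n ⟨G, N, 1⟩ σ₂ := by
    refine ⟨?_, ?_, ?_⟩
    · have := fill_spec (x := 25) (a := 0) (b := var 2) (e := inp (var 25)) (σ := σ₁)
        (E := fun i => σ.input i) (fun i hi τ hx _ hA hbase hinp => by
          rw [eval, v1 2 (by simp) (by simp), hσ.hnn] at hi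
          rw [eval, eval, hx, St.mem_of_lt, hinp]
          · rfl
          · rw [hbase]
            change i < σ.base
            rw [hσ.hbase]
            exact hi)
      rw [eval, v1 2 (by simp) (by simp), hσ.hnn] at this
      intro i hi j hj
      rw [this _ (index_lt hi hj), hσ.hinput i hi j hj]
    · rw [v2, hσ₁, Stmt.den_v (by decide), Stmt.den]; simp [St.setV_v, eval, hN]
    · rw [v2, hσ₁]; simp [Stmt.den, St.setV_v, eval]
  have key := Stmt.for_inv (x := 27) (e := var 3) (c := stepC) (σ := σ₂)
    (fun k τ => RepB n ((Branch.next n b)^[k] ⟨G, N, 1⟩) τ) h₂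
    (fun _ _ _ h => ⟨h.graph, by rw [St.setV_v, if_neg (by simp)]; exact h.choices,
      by rw [St.setV_v, if_neg (by simp)]; exact h.flag⟩) (by
      intro i hi τ _ hf hτ
      rw [eval, v2, v1 3 (by simp) (by simp), hσ.hd] at hi
      rw [Function.iterate_succ_apply']
      refine stepC_spec ?_ ?_ ?_ (hb0 (by omega)) hτ
      · rw [hf.v 1 (by decide) (by simp), v2, v1 1 (by simp) (by simp), hσ.hn]
      · rw [hf.v 2 (by decide) (by simp), v2, v1 2 (by simp) (by simp), hσ.hnn]
      · rw [hf.v 4 (by decide) (by simp), v2, v1 4 (by simp) (by simp), hb])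
  rw [eval, v2, v1 3 (by simp) (by simp), hσ.hd] at key
  set σ₃ := (Stmt.loop 27 (var 3) stepC).den σ₂ with hσ₃
  generalize (Branch.next n b)^[d] ⟨G, N, 1⟩ = s at key ⊢
  have v3 : ∀ y, y ∉ stepC.modV → y ≠ 7 → y ≠ 8 → σ₃.v y = σ.v y := fun y hy h₇ h₈ => by
    rw [hσ₃, Stmt.den_v (c := .loop 27 (var 3) stepC) hy, v2, v1 y h₇ h₈]
  set σ₄ := (Stmt.loop 21 (var 1) (.store 2 (var 21) (const 1))).den σ₃ with hσ₄
  have n₃ : σ₃.v 1 = n := by rw [v3 1 (by decide) (by simp) (by simp), hσ.hn]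
  have l₃ : σ₃.v 0 = l := by rw [v3 0 (by decide) (by simp) (by simp), hσ.hl]
  have v4 : ∀ y, σ₄.v y = σ₃.v y := fun y => by rw [hσ₄, Stmt.den_v (by simp [Stmt.modV])]
  have hV : RepS n (Finset.range n) σ₄ 2 := by
    have := fill_spec (x := 21) (a := 2) (b := var 1) (e := const 1) (σ := σ₃)
      (E := fun i => 1) (fun i hi τ hx _ hA _ _ => rfl)
    rw [eval, n₃] at this
    exact fun i hi => (this i hi).trans (ind_true (Finset.mem_range.2 hi)).symm
  have hE := elimC_spec (n := n) (H := s.graph) (σ := σ₄) (by rw [v4, n₃])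
    (key.graph.congr (by rw [hσ₄, Stmt.den_A (by decide)])) subset_rfl hV
  set σ₅ := elimC.den σ₄ with hσ₅
  have v5 : ∀ y, σ₅.v y = σ₃.v y := fun y => by
    rw [hσ₅, Stmt.den_v (by simp [Stmt.modV, elimC, killC]), v4]
  set σ₆ := (Stmt.assign 9 (Exp.or (var 9) (mul (Exp.not aliveE) (nz (var 8))))).den σ₅ with hσ₆
  set σ₇ := (Stmt.loop 21 (var 1) (.store 1 (var 21) (const 1))).den σ₆ with hσ₇
  have v7 : ∀ y, y ≠ 9 → σ₇.v y = σ₃.v y := fun y hy => by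
    rw [hσ₇, Stmt.den_v (by simp [Stmt.modV]), hσ₆, Stmt.den_v (by simpa [Stmt.modV] using hy), v5]
  have hV' : RepS n (Finset.range n) σ₇ 1 := by
    have := fill_spec (x := 21) (a := 1) (b := var 1) (e := const 1) (σ := σ₆)
      (E := fun i => 1) (fun i hi τ hx _ hA _ _ => rfl)
    rw [eval, hσ₆, Stmt.den_v (by decide), v5, n₃] at this
    exact fun i hi => (this i hi).trans (ind_true (Finset.mem_range.2 hi)).symm
  have hG₇ : RepG n s.graph σ₇ 0 := key.graph.congr (by
    rw [hσ₇, Stmt.den_A (by decide), hσ₆, Stmt.den_A (by decide), hσ₅, Stmt.den_A (by decide), hσ₄,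
      Stmt.den_A (by decide)])
  have hK := killC_spec (bad := badDeg)
    (P := fun T v => l ≤ (T.filter (s.graph.Adj v)).card) (n := n) (σ := σ₇)
    (by rw [v7 1 (by simp), n₃]) subset_rfl hV' (fun τ T hT hv hA hT' h21 =>
      eval_badDeg (by rw [hv 0 (by simp) (by simp), v7 0 (by simp), l₃])
        (by rw [hv 1 (by simp) (by simp), v7 1 (by simp), n₃])
        (hG₇.congr (by rw [hA 0 (by simp)])) hT hT' h21)
  set σ₈ := (killC badDeg).den σ₇ with hσ₈
  have v8 : ∀ y, y ≠ 9 → σ₈.v y = σ₃.v y := fun y hy => by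
    rw [hσ₈, Stmt.den_v (by simp [Stmt.modV, killC]), v7 y hy]
  have hA₈ := eval_aliveE (n := n) (σ := σ₈) (by rw [v8 1 (by simp), n₃])
    (killAll_subset _) hK
  rw [killAll_degree_eq_empty s.graph subset_rfl] at hA₈
  constructor
  · rw [Stmt.den_v (by decide), hσ₈, Stmt.den_v (by decide), hσ₇, Stmt.den_v (by decide), hσ₆,
      Stmt.den, eval_or (p := P) (by rw [eval, v5, v3 9 (by decide) (by simp) (by simp), hP])
      (eval_and (eval_not hE) eval_nz), St.setV_v, if_pos rfl, eval, v5, key.flag, not_not]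
  · rw [Stmt.den, eval_or (p := Q)
      (by rw [eval, v8 10 (by simp), v3 10 (by decide) (by simp) (by simp), hQ]) (eval_not hA₈),
      St.setV_v, if_pos rfl, not_not]

end Ram

/-! ### The search over all branches and all numbers of fill edges -/

namespace Ram

open SimpleGraph Exp

/-- The last hypothesis rules out a right-hand side 0 ^ p with p positive; for k = 0 the relevant
powers are 0 ^ 0 = 1. -/
theorem pow_le_pow_of_imp {a b m p : ℕ} (h : a ≤ b) (h' : m ≤ p) (h₀ : b = 0 → p = 0) :
    a ^ m ≤ b ^ p := by
  rcases Nat.eq_zero_or_pos b with rfl | hb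
  · obtain rfl := h₀ rfl
    obtain rfl : m = 0 := by omega
    simp
  · exact (Nat.pow_le_pow_left h _).trans (Nat.pow_le_pow_right hb h')

/-- Search all branches for the number of fill edges in variable `3`. -/
def levelC : Stmt :=
  .assign 4 (mul (var 3) (const 4)) ⨟ .assign 5 (const 1) ⨟
  .loop 27 (mul (var 3) (const 2)) (.assign 5 (mul (var 5) (var 4))) ⨟
  .assign 9 (const 0) ⨟ .loop 6 (var 5) branchC ⨟ .assign 11 (Exp.or (var 9) (var 10))

theorem Params.congr {n l d : ℕ} {G : SimpleGraph ℕ} {σ τ : St} (h : Params n l d G σ)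
    (hv : ∀ y < 4, τ.v y = σ.v y) (hb : τ.base = σ.base) (hi : τ.input = σ.input) :
    Params n l d G τ :=
  ⟨(hv 0 (by simp)).trans h.hl, (hv 1 (by simp)).trans h.hn, (hv 2 (by simp)).trans h.hnn,
    (hv 3 (by simp)).trans h.hd, hb.trans h.hbase, by rw [hi]; exact h.hinput⟩

theorem Params.den {n l d : ℕ} {G : SimpleGraph ℕ} {σ : St} (h : Params n l d G σ) {c : Stmt}
    (hc : ∀ y < 4, y ∉ c.modV) : Params n l d G (c.den σ) :=
  h.congr (fun y hy => Stmt.den_v (hc y hy)) Stmt.den_base Stmt.den_input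

/-- Some branch adds edges only and ends with a chordal graph. -/
def BranchElim (n d : ℕ) (G : SimpleGraph ℕ) (P : ℕ) : Prop :=
  ∃ N < P, ((Branch.next n (d * 4))^[d] ⟨G, N, 1⟩).graph.Elim (Finset.range n) ∧
    ((Branch.next n (d * 4))^[d] ⟨G, N, 1⟩).flag ≠ 0

/-- Some branch ends with a graph that can be coloured greedily. -/
def BranchDegenerate (n l d : ℕ) (G : SimpleGraph ℕ) (P : ℕ) : Prop :=
  ∃ N < P, ((Branch.next n (d * 4))^[d] ⟨G, N, 1⟩).graph.Degenerate (Finset.range n) l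

theorem exists_lt_succ_iff {p : ℕ → Prop} {i : ℕ} :
    (∃ N < i + 1, p N) ↔ (∃ N < i, p N) ∨ p i := by
  constructor
  · rintro ⟨N, hN, h⟩
    rcases Nat.lt_succ_iff_lt_or_eq.1 hN with h' | rfl
    · exact .inl ⟨N, h', h⟩
    · exact .inr h
  · rintro (⟨N, hN, h⟩ | h)
    · exact ⟨N, hN.trans i.lt_succ_self, h⟩
    · exact ⟨i, i.lt_succ_self, h⟩

/-- Variable 4 is the base 4d and variable 5 the number (4d)^(2d) of branches. For d = 0 this is 0 ^
0 = 1, a single branch without steps that tests the input graph itself. The invariant of the branch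
loop is the disjunction over the branches tried so far. -/
theorem levelC_spec {X n l d : ℕ} {G : SimpleGraph ℕ} {σ : St} (hσ : Params n l d G σ)
    (h10 : σ.v 10 = 0) (hX : 20 ≤ X) (hB : σ.Bnd X) (hd : d * 4 ≤ X)
    (hP : (d * 4) ^ (d * 2) ≤ X) :
    levelC.Bdd X σ ∧
    (levelC.den σ).v 10 = ind (BranchDegenerate n l d G ((d * 4) ^ (d * 2))) ∧
    (levelC.den σ).v 11 = ind (BranchElim n d G ((d * 4) ^ (d * 2)) ∨
      BranchDegenerate n l d G ((d * 4) ^ (d * 2))) := by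
  set σ₁ := (Stmt.assign 4 (mul (var 3) (const 4))).den σ with hσ₁
  have b₁ : (Stmt.assign 4 (mul (var 3) (const 4))).Bdd X σ := by
    simpa [Stmt.Bdd, eval, hσ.hd] using hd
  have B₁ := Stmt.bnd_den _ hB b₁
  rw [← hσ₁] at B₁
  have p₁ : Params n l d G σ₁ := hσ.den (by decide)
  have v₁ : σ₁.v 4 = d * 4 := by simp [hσ₁, Stmt.den, eval, St.setV_v, hσ.hd]
  set σ₂ := (Stmt.assign 5 (const 1)).den σ₁ with hσ₂
  have b₂ : (Stmt.assign 5 (const 1)).Bdd X σ₁ := by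
    simp only [Stmt.Bdd, eval]; omega
  have B₂ := Stmt.bnd_den _ B₁ b₂
  rw [← hσ₂] at B₂
  have p₂ : Params n l d G σ₂ := p₁.den (by decide)
  have v₂ : σ₂.v 4 = d * 4 := by rw [hσ₂, Stmt.den_v (by decide), v₁]
  have e₃ : (mul (var 3) (const 2)).eval σ₂ = d * 2 := by simp [eval, p₂.hd]
  obtain ⟨b₃, v₃⟩ := Stmt.for_bdd (X := X) (x := 27) (e := mul (var 3) (const 2))
    (c := .assign 5 (mul (var 5) (var 4))) (σ := σ₂) (fun i τ => τ.v 5 = (d * 4) ^ i)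
    (by simp [hσ₂, Stmt.den, eval, St.setV_v]) (by omega) B₂
    (fun _ _ _ h => by rw [St.setV_v, if_neg (by simp)]; exact h) (by
      intro i hi τ _ hf hτ _
      rw [e₃] at hi
      have h4 : τ.v 4 = d * 4 := by rw [hf.v 4 (by decide) (by simp), v₂]
      have he : (mul (var 5) (var 4)).eval τ = (d * 4) ^ (i + 1) := by
        rw [eval, eval, eval, hτ, h4, pow_succ]
      refine ⟨?_, by rw [Stmt.den, St.setV_v, if_pos rfl, he]⟩
      change (mul (var 5) (var 4)).eval τ ≤ X
      rw [he]
      exact (Nat.pow_le_pow_right (by omega) hi).trans hP)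
  rw [e₃] at v₃
  have B₃ := Stmt.bnd_den _ B₂ b₃
  set σ₃ := (Stmt.loop 27 (mul (var 3) (const 2)) (.assign 5 (mul (var 5) (var 4)))).den σ₂
    with hσ₃
  have p₃ : Params n l d G σ₃ := p₂.den (by decide)
  have w₃ : σ₃.v 4 = d * 4 := by rw [hσ₃, Stmt.den_v (by decide), v₂]
  set σ₄ := (Stmt.assign 9 (const 0)).den σ₃ with hσ₄
  have b₄ : (Stmt.assign 9 (const 0)).Bdd X σ₃ := by simp [Stmt.Bdd, eval]
  have B₄ := Stmt.bnd_den _ B₃ b₄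
  rw [← hσ₄] at B₄
  have p₄ : Params n l d G σ₄ := p₃.den (by decide)
  have v₄ : σ₄.v 4 = d * 4 := by rw [hσ₄, Stmt.den_v (by decide), w₃]
  have w₄ : σ₄.v 5 = (d * 4) ^ (d * 2) := by rw [hσ₄, Stmt.den_v (by decide), v₃]
  obtain ⟨b₅, v₅⟩ := Stmt.for_bdd (X := X) (x := 6) (e := var 5) (c := branchC) (σ := σ₄)
    (fun i τ => τ.v 9 = ind (BranchElim n d G i) ∧ τ.v 10 = ind (BranchDegenerate n l d G i))
    ⟨by rw [ind_false (by simp [BranchElim])]; simp [hσ₄, Stmt.den, eval, St.setV_v], by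
      rw [ind_false (by simp [BranchDegenerate]), hσ₄, Stmt.den_v (by decide), hσ₃,
        Stmt.den_v (by decide), hσ₂, Stmt.den_v (by decide), hσ₁, Stmt.den_v (by decide), h10]⟩
    (B₄.v 5) B₄
    (fun _ _ _ h => by rw [St.setV_v, St.setV_v, if_neg (by simp), if_neg (by simp)]; exact h) (by
      intro i hi τ h6 hf hτ hτB
      have h := branchC_spec (d := d) (b := d * 4) (N := i) (σ := τ)
        (p₄.congr (fun y hy => hf.v y (by
          revert y; decide) (by omega)) hf.base hf.input)
        (by rw [hf.v 4 (by decide) (by simp), v₄]) (by omega) h6 hτ.1 hτ.2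
      exact ⟨Stmt.bdd_of_safe (by omega) (by decide) hτB,
        h.1.trans (ind_congr exists_lt_succ_iff.symm),
        h.2.trans (ind_congr exists_lt_succ_iff.symm)⟩)
  rw [eval, w₄] at v₅
  have B₅ := Stmt.bnd_den _ B₄ b₅
  set σ₅ := (Stmt.loop 6 (var 5) branchC).den σ₄ with hσ₅
  refine ⟨⟨b₁, b₂, b₃, b₄, b₅, Stmt.bdd_of_safe (by omega) (by decide) B₅⟩, ?_, ?_⟩
  · change ((Stmt.assign 11 (Exp.or (var 9) (var 10))).den σ₅).v 10 = _
    rw [Stmt.den_v (by decide), v₅.2]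
  · change ((Stmt.assign 11 (Exp.or (var 9) (var 10))).den σ₅).v 11 = _
    rw [Stmt.den, St.setV_v, if_pos rfl, eval_or (e := var 9) (f := var 10) v₅.1 v₅.2]

theorem BranchElim.fillLE {n d P : ℕ} {G : SimpleGraph ℕ} (h : BranchElim n d G P) :
    G.FillLE (Finset.range n) d := by
  obtain ⟨N, -, h₁, h₂⟩ := h
  exact Branch.fillLE_of_iterate d h₁ h₂

theorem BranchDegenerate.colIn {n l d P : ℕ} {G : SimpleGraph ℕ}
    (h : BranchDegenerate n l d G P) : G.ColIn (Finset.range n) l := by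
  obtain ⟨N, -, h⟩ := h
  exact Branch.colIn_of_iterate d h.colIn

theorem branchElim_of_fillLE {n d : ℕ} {G : SimpleGraph ℕ} (h : G.FillLE (Finset.range n) d) :
    BranchElim n d G ((d * 4) ^ (d * 2)) := by
  obtain ⟨N, hN, h₁, h₂⟩ := h.exists_branch d (b := d * 4) (by omega) 1
  exact ⟨N, by rwa [mul_comm d 2], h₁, by rw [h₂]; simp⟩

theorem branchDegenerate_of_fillLE {n l d : ℕ} {G : SimpleGraph ℕ}
    (h : G.FillLE (Finset.range n) d) (hc : G.ColIn (Finset.range n) l) :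
    BranchDegenerate n l d G ((d * 4) ^ (d * 2)) := by
  obtain ⟨N, hN, h⟩ := h.exists_branch_colIn d (b := d * 4) (by omega) hc 1
  exact ⟨N, by rwa [mul_comm d 2], h⟩

/-- Increase the number of fill edges until some branch succeeds. -/
def mainC : Stmt := .loop 3 (add (var 2) (const 1)) (.loop 28 (Exp.not (var 11)) levelC)

/-- Invariant: either variable 11 is set and variable 10 holds the right answer, or the search is
undecided and the current level is at most k. The second alternative cannot outlive level k ≤ n².
The inner loop, with its 0 or 1 iterations, serves as a conditional. -/
theorem mainC_spec {X n l k : ℕ} {G : SimpleGraph ℕ} {σ : St} (hσ : Params n l (σ.v 3) G σ)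
    (h10 : σ.v 10 = 0) (h11 : σ.v 11 = 0) (hX : 20 ≤ X) (hB : σ.Bnd X) (hn : n * n + 1 ≤ X)
    (hk : k * 4 ≤ X) (hP : (k * 4) ^ (k * 2) ≤ X) (hkn : k ≤ n * n)
    (hG : G.FillLE (Finset.range n) k) :
    mainC.Bdd X σ ∧ (mainC.den σ).v 10 = ind (G.ColIn (Finset.range n) l) := by
  have e : (add (var 2) (const 1)).eval σ = n * n + 1 := by simp [eval, hσ.hnn]
  have key := Stmt.for_bdd (X := X) (x := 3) (e := add (var 2) (const 1))
    (c := .loop 28 (Exp.not (var 11)) levelC) (σ := σ)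
    (fun i τ => τ.v 11 = 1 ∧ τ.v 10 = ind (G.ColIn (Finset.range n) l) ∨
      τ.v 11 = 0 ∧ τ.v 10 = 0 ∧ i ≤ k)
    (.inr ⟨h11, h10, by omega⟩) (by omega) hB
    (fun _ _ _ h => by rw [St.setV_v, St.setV_v, if_neg (by simp), if_neg (by simp)]; exact h) (by
      intro i hi τ h3 hf hτ hτB
      rcases hτ with h | ⟨h₁, h₂, hik⟩
      · have e₁ : (Exp.not (var 11)).eval τ = 0 := by simp [Exp.not, eval, h.1]
        refine ⟨⟨by omega, fun j hj => by omega⟩, .inl ?_⟩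
        rw [Stmt.den, e₁, loopN, St.setV_self]
        exact h
      · have e₁ : (Exp.not (var 11)).eval τ = 1 := by simp [Exp.not, eval, h₁]
        have hp : Params n l i G (τ.setV 28 0) := by
          have h := hσ
          refine ⟨?_, ?_, ?_, h3, hf.base.trans h.hbase, ?_⟩
          · exact (hf.v 0 (by decide) (by simp)).trans h.hl
          · exact (hf.v 1 (by decide) (by simp)).trans h.hn
          · exact (hf.v 2 (by decide) (by simp)).trans h.hnn
          · rw [St.setV_input, hf.input]; exact h.hinput
        have hPi : (i * 4) ^ (i * 2) ≤ X :=
          (pow_le_pow_of_imp (by omega) (by omega) (by omega)).trans hP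
        obtain ⟨l₁, l₂, l₃⟩ := levelC_spec hp h₂ hX (hτB.setV (by omega)) (by omega) hPi
        refine ⟨⟨by omega, fun j hj => ?_⟩, ?_⟩
        · obtain rfl : j = 0 := by omega
          exact l₁
        · have e₂ : (Stmt.loop 28 (Exp.not (var 11)) levelC).den τ =
              (levelC.den (τ.setV 28 0)).setV 28 (τ.v 28) := by rw [Stmt.den, e₁]; rfl
          rw [e₂, St.setV_v, St.setV_v, if_neg (by simp), if_neg (by simp), l₂, l₃]
          by_cases hD : BranchDegenerate n l i G ((i * 4) ^ (i * 2))
          · exact .inl ⟨ind_true (.inr hD), by rw [ind_true hD, ind_true hD.colIn]⟩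
          -- A completion with at most i edges exists, so the search at this level was exhaustive
          -- and the absence of degenerate leaves refutes colourability.
          by_cases hE : BranchElim n i G ((i * 4) ^ (i * 2))
          · exact .inl ⟨ind_true (.inl hE), ind_congr
              ⟨fun h => h.colIn, fun h => branchDegenerate_of_fillLE hE.fillLE h⟩⟩
          · refine .inr ⟨ind_false (by tauto), ind_false hD, ?_⟩
            refine lt_of_le_of_ne hik ?_
            rintro rfl
            -- An undecided level cannot be k itself: there the promised completion would have been
            -- found.
            exact hE (branchElim_of_fillLE hG))
  refine ⟨key.1, ?_⟩
  rw [e] at key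
  rcases key.2 with h | h
  · exact h.2
  · omega

end Ram

/-! ### The decision program on the machine -/

namespace Ram

open SimpleGraph Exp

/-- The state with given registers and memory. -/
def St.ofMem (R M : ℕ → ℕ) : St where
  v x := R (vreg x)
  A a i := M (R 0 + (4 * i + a.val))
  base := R 0
  input := M

theorem Sim.ofMem (R M : ℕ → ℕ) : Sim (.ofMem R M) R M := by
  refine ⟨rfl, fun _ => rfl, funext fun m => ?_⟩
  unfold St.mem
  split_ifs with h
  · rfl
  · have h : ¬ m < R 0 := h
    change M m = M (R 0 + (4 * ((m - R 0) / 4) + (m - R 0) % 4))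
    rw [Nat.div_add_mod]
    congr 1
    omega

open Cmd in
/-- Decide colourability: cap the number of colours by the number of vertices, reserve the memory
after the input for the arrays, and search. -/
def decideC : Cmd :=
  .prim (.copy 3 0) ;; .prim (.sub 2 3 1) ;; .prim (.sub 1 3 2) ;;
  (Stmt.assign 2 (mul (var 1) (var 1))).cmd 0 ;; .prim (.copy 0 (vreg 2)) ;;
  mainC.cmd 0 ;; .prim (.copy 0 (vreg 10))

theorem colouringInput_mem {n : ℕ} (G : SimpleGraph (Fin n)) (l : ℕ) {i j : ℕ} (hi : i < n)
    (hj : j < n) : (colouringInput G l).mem (i * n + j) =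
      ind ((G.map Fin.valEmbedding).Adj i j) := by
  classical
  have : (colouringInput G l).mem (i * n + j) =
      ind (∃ i' j' : Fin n, i * n + j = i'.val * n + j'.val ∧ G.Adj i' j') := by
    unfold ind
    simp only [colouringInput]
    split_ifs <;> rfl
  rw [this]
  refine ind_congr ?_
  rw [SimpleGraph.map_adj]
  constructor
  · rintro ⟨i', j', h, hG⟩
    have h₁ : i = i'.val := by
      have e₁ : (i * n + j) / n = i := by
        rw [Nat.add_comm, Nat.add_mul_div_right _ _ (by omega), Nat.div_eq_of_lt hj, zero_add]
      have e₂ : (i'.val * n + j'.val) / n = i'.val := by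
        rw [Nat.add_comm, Nat.add_mul_div_right _ _ (by omega), Nat.div_eq_of_lt j'.2, zero_add]
      rw [← e₁, h, e₂]
    subst h₁
    exact ⟨i', j', hG, rfl, show j'.val = j by omega⟩
  · rintro ⟨i', j', hG, rfl, rfl⟩
    exact ⟨i', j', rfl, hG⟩

/-- Capping the number of colours by n is essential: l is an arbitrary input, while X, which must
bound every stored value, does not depend on it. -/
theorem decideC_spec {X n l k : ℕ} {G : SimpleGraph (Fin n)} (hX : 20 ≤ X) (hn : n * n + 1 ≤ X)
    (hk : k * 4 ≤ X) (hP : (k * 4) ^ (k * 2) ≤ X) (hkn : k ≤ n * n)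
    (hG : (G.map Fin.valEmbedding).FillLE (Finset.range n) k) :
    ∃ t ≤ X ^ ((Stmt.assign 2 (mul (var 1) (var 1))).wt + mainC.wt + 1),
      DecidesWithin (decideC.code 0) (colouringInput G l) t
        ((G.map Fin.valEmbedding).ColIn (Finset.range n) (n - (n - l))) := by
  set M := (colouringInput G l).mem with hM
  have hM₁ : ∀ m, M m ≤ 1 := by
    intro m
    simp only [hM, colouringInput]
    split_ifs <;> simp
  set R := (colouringInput G l).reg with hR
  have hR0 : R 0 = n := rfl
  have hR1 : R 1 = l := rfl
  have hRr : ∀ r, 2 ≤ r → R r = 0 := fun r hr => by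
    simp only [hR, colouringInput]
    rw [if_neg (by omega), if_neg (by omega)]
  have E₁ := Cmd.Exec.copy R M 3 0
  set R₁ := Function.update R 3 (R 0) with hR₁
  have E₂ := Cmd.Exec.sub R₁ M 2 3 1
  set R₂ := Function.update R₁ 2 (R₁ 3 - R₁ 1) with hR₂
  have E₃ := Cmd.Exec.sub R₂ M 1 3 2
  set R₃ := Function.update R₂ 1 (R₂ 3 - R₂ 2) with hR₃
  have hnn : n ≤ n * n := Nat.le_mul_self n
  -- Registers 1 and 3 are variables 0 and 1, so the first three instructions leave min(n, l) and n
  -- where the loop program expects them.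
  have w₃ : ∀ x, R₃ (vreg x) = if x = 0 then n - (n - l) else if x = 1 then n else 0 := by
    intro x
    rcases x with _ | _ | x
    · simp [hR₃, hR₂, hR₁, hR0, hR1, vreg]
    · simp [hR₃, hR₂, hR₁, hR0, vreg]
    · have h : 4 ≤ vreg (x + 1 + 1) := by simp only [vreg]; omega
      rw [if_neg (by omega), if_neg (by omega), hR₃, Function.update_of_ne (by omega), hR₂,
        Function.update_of_ne (by omega), hR₁, Function.update_of_ne (by omega), hRr _ (by omega)]
  have B₃ : (St.ofMem R₃ M).Bnd X := by
    refine ⟨fun x => ?_, fun a i => (hM₁ _).trans (by omega), fun i _ => (hM₁ _).trans (by omega)⟩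
    change R₃ (vreg x) ≤ X
    rw [w₃]
    split_ifs <;> omega
  have v₃ : (St.ofMem R₃ M).v 1 = n := by
    change R₃ (vreg 1) = n
    rw [w₃]; simp
  have e₃ : (mul (var 1) (var 1)).eval (St.ofMem R₃ M) = n * n := by simp only [eval, v₃]
  obtain ⟨R₄, M₄, t₄, E₄, ht₄, S₄, -⟩ := Stmt.exec_cmd hX (.assign 2 (mul (var 1) (var 1))) B₃
    (by change (mul (var 1) (var 1)).eval _ ≤ X; omega) 0 (Sim.ofMem R₃ M)
  have hM₄ : M₄ = M := S₄.mem.trans (Sim.ofMem R₃ M).mem.symm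
  rw [hM₄] at E₄
  have w₄ : ∀ x, R₄ (vreg x) =
      if x = 2 then n * n else if x = 0 then n - (n - l) else if x = 1 then n else 0 := by
    intro x
    rw [S₄.v, Stmt.den, St.setV_v, e₃, ← w₃]
    rfl
  have E₅ := Cmd.Exec.copy R₄ M 0 (vreg 2)
  -- Moving the base from n to n² puts the arrays behind the adjacency matrix.
  set R₅ := Function.update R₄ 0 (R₄ (vreg 2)) with hR₅
  have w₅ : ∀ x, (St.ofMem R₅ M).v x =
      if x = 2 then n * n else if x = 0 then n - (n - l) else if x = 1 then n else 0 := by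
    intro x
    change R₅ (vreg x) = _
    rw [hR₅, Function.update_of_ne (by simp [vreg]), w₄]
  have B₅ : (St.ofMem R₅ M).Bnd X := by
    refine ⟨fun x => ?_, fun a i => (hM₁ _).trans (by omega), fun i _ => (hM₁ _).trans (by omega)⟩
    rw [w₅]
    split_ifs <;> omega
  have p₅ : Params n (n - (n - l)) ((St.ofMem R₅ M).v 3) (G.map Fin.valEmbedding)
      (St.ofMem R₅ M) := by
    refine ⟨by rw [w₅]; simp, by rw [w₅]; simp, by rw [w₅]; simp, rfl, ?_, fun i hi j hj =>
      colouringInput_mem G l hi hj⟩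
    change R₅ 0 = n * n
    rw [hR₅, Function.update_self, w₄, if_pos rfl]
  obtain ⟨b₅, h₅⟩ := mainC_spec p₅ (by rw [w₅]; simp) (by rw [w₅]; simp) hX B₅ hn hk hP hkn hG
  obtain ⟨R₆, M₆, t₆, E₆, ht₆, S₆, -⟩ := Stmt.exec_cmd hX mainC B₅ b₅ 0 (Sim.ofMem R₅ M)
  have E₇ := Cmd.Exec.copy R₆ M₆ 0 (vreg 10)
  have E : Cmd.Exec decideC R M _ _ _ :=
    E₁.seq (E₂.seq (E₃.seq (E₄.seq (E₅.seq (E₆.seq E₇)))))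
  have hrun := E.run (P := decideC.code 0) (o := 0) fun i _ => by rw [zero_add]
  have hres : Function.update R₆ 0 (R₆ (vreg 10)) 0 =
      ind ((G.map Fin.valEmbedding).ColIn (Finset.range n) (n - (n - l))) := by
    rw [Function.update_self, S₆.v, h₅]
  refine ⟨1 + (1 + (1 + (t₄ + (1 + (t₆ + 1))))), ?_, ?_⟩
  rotate_left
  · change (step (decideC.code 0))^[_] (colouringInput G l) = _ at hrun
    unfold DecidesWithin
    rw [hrun]
    refine ⟨?_, fun h => ?_, fun h => ?_⟩
    · change (decideC.code 0).length ≤ 0 + decideC.size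
      rw [Cmd.length_code, zero_add]
    · exact hres.trans (ind_true h)
    · exact hres.trans (ind_false h)
  · have hp₁ := Nat.one_le_pow (Stmt.assign 2 (mul (var 1) (var 1))).wt X (by omega)
    have hp₂ := Nat.one_le_pow mainC.wt X (by omega)
    have h₁ := add_le_mul_add_one hp₁ hp₂
    rw [pow_succ, pow_add]
    have h₂ := Nat.mul_le_mul hp₁ hp₂
    have h₃ := Nat.mul_le_mul_left
      (X ^ (Stmt.assign 2 (mul (var 1) (var 1))).wt * X ^ mainC.wt) hX
    omega

end Ram

/-! ### Transfer between `Fin n` and the numbers below n -/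

namespace SimpleGraph

open Ram

theorem colIn_map_iff {n : ℕ} (G : SimpleGraph (Fin n)) (l : ℕ) :
    (G.map Fin.valEmbedding).ColIn (Finset.range n) l ↔ G.Colorable l := by
  constructor
  · rintro ⟨c, hc, h⟩
    refine ⟨Coloring.mk (fun v => ⟨c v, hc v (Finset.mem_range.2 v.2)⟩) fun {u v} huv he => ?_⟩
    refine h u (Finset.mem_range.2 u.2) v (Finset.mem_range.2 v.2) ?_ (Fin.mk.inj_iff.1 he)
    exact (SimpleGraph.map_adj_apply (f := Fin.valEmbedding)).2 huv
  · rintro ⟨C⟩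
    refine ⟨fun x => if h : x < n then C ⟨x, h⟩ else 0, fun x hx => ?_, fun x hx y hy hxy => ?_⟩
    · beta_reduce
      rw [dif_pos (Finset.mem_range.1 hx)]
      exact (C _).2
    · beta_reduce
      rw [dif_pos (Finset.mem_range.1 hx), dif_pos (Finset.mem_range.1 hy)]
      obtain ⟨u, v, huv, rfl, rfl⟩ := (SimpleGraph.map_adj ..).1 hxy
      exact fun h => C.valid huv (Fin.ext h)

/-- The truncated difference is min(n, l), and n colours always suffice. -/
theorem colorable_sub_iff {n : ℕ} (G : SimpleGraph (Fin n)) (l : ℕ) :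
    G.Colorable (n - (n - l)) ↔ G.Colorable l := by
  refine ⟨fun h => h.mono (by omega), fun h => ?_⟩
  rcases le_total l n with hl | hl
  · rwa [Nat.sub_sub_self hl]
  · rw [Nat.sub_eq_zero_of_le hl, Nat.sub_zero]
    exact ⟨Coloring.mk id fun {u v} huv => huv.ne⟩

theorem Elim.map_val {n : ℕ} {G : SimpleGraph (Fin n)} (h : G.Elim Finset.univ) :
    (G.map Fin.valEmbedding).Elim (Finset.range n) := by
  intro T hT hne
  obtain ⟨x, hx⟩ := hne
  obtain ⟨v, hv, hs⟩ := h (Finset.univ.filter fun v => v.val ∈ T) (Finset.subset_univ _)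
    ⟨⟨x, Finset.mem_range.1 (hT hx)⟩, by simpa using hx⟩
  refine ⟨v, by simpa using hv, fun a ha b hb hva hvb hab => ?_⟩
  obtain ⟨v₁, a, h₁, e₁, rfl⟩ := (SimpleGraph.map_adj ..).1 hva
  obtain ⟨v₂, b, h₂, e₂, rfl⟩ := (SimpleGraph.map_adj ..).1 hvb
  obtain rfl : v₁ = v := Fin.ext e₁
  obtain rfl : v₂ = v₁ := Fin.ext e₂
  exact (SimpleGraph.map_adj_apply (f := Fin.valEmbedding)).2
    (hs a (by simpa using ha) b (by simpa using hb) h₁ h₂ fun h => hab (by rw [h]))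

/-- The exact size of A is used instead of k because it is also at most n², within the range of
levels that the program tries. -/
theorem InChordalMinus.fillLE {n k : ℕ} {G : SimpleGraph (Fin n)} (h : G.InChordalMinus k) :
    ∃ d ≤ k, d ≤ n * n ∧ (G.map Fin.valEmbedding).FillLE (Finset.range n) d := by
  classical
  obtain ⟨A, -, hA, hch⟩ := h
  refine ⟨A.card, hA, ?_, (G.addPairs A).map Fin.valEmbedding,
    SimpleGraph.map_monotone _ le_sup_left, (hch.elim _).map_val, A.image (Sym2.map Fin.val),
    Finset.card_image_le, fun x y hxy hn => ?_⟩
  · have := Fintype.card_le_of_surjective (fun p : Fin n × Fin n => s(p.1, p.2))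
      (fun e => e.ind fun a b => ⟨(a, b), rfl⟩)
    rw [Fintype.card_prod, Fintype.card_fin] at this
    exact (Finset.card_le_univ A).trans this
  · obtain ⟨u, v, huv, rfl, rfl⟩ := (SimpleGraph.map_adj ..).1 hxy
    rcases huv with huv | huv
    · exact absurd ((SimpleGraph.map_adj_apply (f := Fin.valEmbedding)).2 huv) hn
    · exact Finset.mem_image.2 ⟨s(u, v), by simpa using huv.1, rfl⟩

end SimpleGraph

/-! ### Numerical estimates -/

namespace Ram

/-- For k ≥ 2 one has 4k ≤ k³, which gives the exponent 6. The factor 16 is needed for k = 1, where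
the logarithm vanishes. -/
theorem four_mul_pow_le (k : ℕ) :
    (((k * 4) ^ (k * 2) : ℕ) : ℝ) ≤ 16 * (2 : ℝ) ^ (6 * (k * Real.logb 2 k)) := by
  have hk : k = 0 ∨ k = 1 ∨ 2 ≤ k := by omega
  rcases hk with rfl | rfl | hk
  · norm_num
  · norm_num
  have h₁ : (k * 4) ^ (k * 2) ≤ k ^ (6 * k) := by
    calc (k * 4) ^ (k * 2) ≤ (k ^ 3) ^ (k * 2) := Nat.pow_le_pow_left (by
            have := Nat.mul_le_mul hk hk
            calc k * 4 ≤ k * (k * k) := Nat.mul_le_mul_left k (by omega)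
              _ = k ^ 3 := by ring) _
      _ = k ^ (6 * k) := by rw [← pow_mul]; congr 1; ring
  have h₂ : ((k ^ (6 * k) : ℕ) : ℝ) = (2 : ℝ) ^ (6 * (k * Real.logb 2 k)) := by
    have h₃ : (6 : ℝ) * (k * Real.logb 2 k) = Real.logb 2 k * ((6 * k : ℕ) : ℝ) := by
      push_cast; ring
    rw [h₃, Real.rpow_mul (by norm_num), Real.rpow_logb (by norm_num) (by norm_num)
      (by exact_mod_cast (by omega : 0 < k)), Real.rpow_natCast]
    push_cast
    rfl
  calc (((k * 4) ^ (k * 2) : ℕ) : ℝ) ≤ ((k ^ (6 * k) : ℕ) : ℝ) := by exact_mod_cast h₁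
    _ = (2 : ℝ) ^ (6 * (k * Real.logb 2 k)) := h₂
    _ ≤ _ := le_mul_of_one_le_left (by positivity) (by norm_num)

/-- The bound for all values stored during the search. -/
def valueBound (n k : ℕ) : ℕ := 20 * (n + 1) ^ 2 * (k * 4) ^ (k * 2)

/-- One constant plays all three roles: 320 ^ w = (20 · 16) ^ w is the factor, 6w the multiple of k
log k, and 2w ≤ 6w the degree in n + 1. -/
theorem valueBound_pow_le (n k w : ℕ) :
    ((valueBound n k ^ w : ℕ) : ℝ) ≤ ((320 ^ w + 6 * w : ℕ) : ℝ) *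
      (2 : ℝ) ^ (((320 ^ w + 6 * w : ℕ) : ℝ) * (k * Real.logb 2 k)) *
      ((n : ℝ) + 1) ^ (320 ^ w + 6 * w) := by
  have hL : 0 ≤ (k : ℝ) * Real.logb 2 k := by
    rcases Nat.eq_zero_or_pos k with rfl | hk
    · simp
    · exact mul_nonneg k.cast_nonneg (Real.logb_nonneg (by norm_num) (by exact_mod_cast hk))
  set L := (k : ℝ) * Real.logb 2 k with hLdef
  have h₁ : (valueBound n k : ℝ) ≤ 320 * (2 : ℝ) ^ (6 * L) * ((n : ℝ) + 1) ^ 2 := by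
    have := mul_le_mul_of_nonneg_left (four_mul_pow_le k)
      (by positivity : (0 : ℝ) ≤ 20 * ((n : ℝ) + 1) ^ 2)
    rw [← hLdef] at this
    calc (valueBound n k : ℝ) = 20 * ((n : ℝ) + 1) ^ 2 * (((k * 4) ^ (k * 2) : ℕ) : ℝ) := by
          unfold valueBound; push_cast; rfl
      _ ≤ _ := this
      _ = _ := by ring
  have hw : 0 < 320 ^ w := by positivity
  have h₂ : (2 : ℝ) ^ (6 * L * w) ≤ (2 : ℝ) ^ (((320 ^ w + 6 * w : ℕ) : ℝ) * L) := by
    refine Real.rpow_le_rpow_of_exponent_le (by norm_num) ?_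
    have : ((6 * w : ℕ) : ℝ) ≤ ((320 ^ w + 6 * w : ℕ) : ℝ) := by exact_mod_cast Nat.le_add_left _ _
    calc 6 * L * w = ((6 * w : ℕ) : ℝ) * L := by push_cast; ring
      _ ≤ _ := mul_le_mul_of_nonneg_right this hL
  have h₃ : ((n : ℝ) + 1) ^ (2 * w) ≤ ((n : ℝ) + 1) ^ (320 ^ w + 6 * w) :=
    pow_le_pow_right₀ (by have := n.cast_nonneg (α := ℝ); linarith) (by omega)
  have h₄ : (320 : ℝ) ^ w ≤ ((320 ^ w + 6 * w : ℕ) : ℝ) := by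
    exact_mod_cast Nat.le_add_right (320 ^ w) (6 * w)
  calc ((valueBound n k ^ w : ℕ) : ℝ) = (valueBound n k : ℝ) ^ w := by push_cast; rfl
    _ ≤ (320 * (2 : ℝ) ^ (6 * L) * ((n : ℝ) + 1) ^ 2) ^ w :=
        pow_le_pow_left₀ (by positivity) h₁ w
    _ = 320 ^ w * (2 : ℝ) ^ (6 * L * w) * ((n : ℝ) + 1) ^ (2 * w) := by
        rw [mul_pow, mul_pow, Real.rpow_mul_natCast (by norm_num), pow_mul]
    _ ≤ _ := mul_le_mul (mul_le_mul h₄ h₂ (by positivity) (by positivity)) h₃ (by positivity)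
        (by positivity)

end Ram

/-! ### Partitions of cliques into independent sets -/

namespace SimpleGraph

variable {n : ℕ} {G : SimpleGraph (Fin n)} {A : Finset (Sym2 (Fin n))} {C : Finset (Fin n)}

/-- The vertices of `C` that belong to some pair of `A`. -/
def touched (A : Finset (Sym2 (Fin n))) (C : Finset (Fin n)) : Finset (Fin n) :=
  C.filter fun x => ∃ e ∈ A, x ∈ e

theorem card_touched_le (A : Finset (Sym2 (Fin n))) (C : Finset (Fin n)) :
    (touched A C).card ≤ 2 * A.card := by
  classical
  calc (touched A C).card ≤ (A.biUnion fun e => e.toFinset).card := by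
        refine Finset.card_le_card fun x hx => ?_
        obtain ⟨e, he, hxe⟩ := (Finset.mem_filter.1 hx).2
        exact Finset.mem_biUnion.2 ⟨e, he, Sym2.mem_toFinset.2 hxe⟩
    _ ≤ A.card * 2 := Finset.card_biUnion_le_card_mul _ _ _ fun e _ => by
        rw [Sym2.card_toFinset]; split_ifs <;> simp
    _ = 2 * A.card := mul_comm _ _

/-- In a partition of a clique of `G + A` into independent sets, two vertices in the same part are
equal or both belong to pairs of `A`. -/
theorem eq_or_touched (hC : (G.addPairs A).IsClique (C : Set (Fin n))) {P : Finpartition C}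
    (hP : P ∈ G.indepPartitions C) {x y : Fin n} (hx : x ∈ C) (h : y ∈ P.part x) :
    y = x ∨ y ∈ touched A C := by
  refine or_iff_not_imp_left.2 fun hne => ?_
  have hy := P.part_subset x h
  rcases hC (Finset.mem_coe.2 hy) (Finset.mem_coe.2 hx) hne with hG | hA
  · exact absurd hG (hP _ (P.part_mem.2 hx) h (P.mem_part hx) hne)
  · exact Finset.mem_filter.2 ⟨hy, _, hA.1, Sym2.mem_mk_left _ _⟩

theorem part_inter_nonempty (P : Finpartition C) (x : touched A C) :
    (P.part x ∩ touched A C).Nonempty :=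
  ⟨x, Finset.mem_inter.2 ⟨P.mem_part (Finset.mem_filter.1 x.2).1, x.2⟩⟩

/-- Map a vertex in a pair of `A` to the least such vertex in the same part. -/
def leastInPart (A : Finset (Sym2 (Fin n))) (P : Finpartition C) (x : touched A C) :
    touched A C :=
  ⟨(P.part x ∩ touched A C).min' (part_inter_nonempty P x),
    (Finset.mem_inter.1 (Finset.min'_mem _ _)).2⟩

/-- The least touched vertex is a canonical representative of its part, so the map remembers which
touched vertices share a part. -/
theorem part_eq_part_iff (P : Finpartition C) (x y : touched A C) :
    P.part x = P.part y ↔ leastInPart A P x = leastInPart A P y := by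
  have h : ∀ z : touched A C, P.part z = P.part (leastInPart A P z) := fun z =>
    (P.part_eq_of_mem (P.part_mem.2 (Finset.mem_filter.1 z.2).1)
      (Finset.mem_inter.1 (Finset.min'_mem _ (part_inter_nonempty P z))).1).symm
  constructor
  · intro e
    simp only [leastInPart, e]
  · intro e
    rw [h x, e, ← h y]

/-- Distinct vertices of a common part are both touched, so equal maps give each vertex the same
part in P and Q. -/
theorem leastInPart_injOn (hC : (G.addPairs A).IsClique (C : Set (Fin n))) :
    Set.InjOn (leastInPart A) (G.indepPartitions C) := by
  have key : ∀ P ∈ G.indepPartitions C, ∀ Q ∈ G.indepPartitions C,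
      leastInPart A P = leastInPart A Q → ∀ x ∈ C, P.part x ⊆ Q.part x := by
    intro P hP Q hQ h x hx y hy
    rcases eq_or_touched hC hP hx hy with rfl | hyt
    · exact Q.mem_part hx
    have hyC := P.part_subset x hy
    have hPe : P.part y = P.part x := P.part_eq_of_mem (P.part_mem.2 hx) hy
    rcases eq_or_touched hC hP hyC (hPe ▸ P.mem_part hx) with rfl | hxt
    · exact Q.mem_part hx
    have := (part_eq_part_iff P ⟨y, hyt⟩ ⟨x, hxt⟩).1 hPe
    rw [h] at this
    rw [← (part_eq_part_iff Q ⟨y, hyt⟩ ⟨x, hxt⟩).2 this]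
    exact Q.mem_part hyC
  have sub : ∀ P ∈ G.indepPartitions C, ∀ Q ∈ G.indepPartitions C,
      leastInPart A P = leastInPart A Q → P.parts ⊆ Q.parts := by
    intro P hP Q hQ h T hT
    obtain ⟨x, hx⟩ := P.nonempty_of_mem_parts hT
    have hxC := P.subset hT hx
    rw [← P.part_eq_of_mem hT hx,
      (key P hP Q hQ h x hxC).antisymm (key Q hQ P hP h.symm x hxC)]
    exact Q.part_mem.2 hxC
  exact fun P hP Q hQ h => Finpartition.ext ((sub P hP Q hQ h).antisymm (sub Q hQ P hP h.symm))

theorem ncard_indepPartitions_le {k : ℕ} (hA : A.card ≤ k)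
    (hC : (G.addPairs A).IsClique (C : Set (Fin n))) :
    (G.indepPartitions C).ncard ≤ (2 * k) ^ (2 * k) := by
  classical
  have hcard : (touched A C).card ≤ 2 * k := (card_touched_le A C).trans (by omega)
  calc (G.indepPartitions C).ncard ≤ (Set.univ : Set (touched A C → touched A C)).ncard :=
        Set.ncard_le_ncard_of_injOn _ (fun _ _ => Set.mem_univ _) (leastInPart_injOn hC)
    _ = (touched A C).card ^ (touched A C).card := by
        rw [Set.ncard_univ, Nat.card_eq_fintype_card, Fintype.card_fun, Fintype.card_coe]
    _ ≤ (2 * k) ^ (2 * k) := Ram.pow_le_pow_of_imp hcard hcard id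

end SimpleGraph

theorem mainTheorem6 :
    (∃ (P : Ram.Program) (c : ℕ), ∀ (n : ℕ) (G : SimpleGraph (Fin n)) (l k : ℕ),
      0 < l → G.InChordalMinus k →
        ∃ t : ℕ,
          (t : ℝ) ≤ c * (2 : ℝ) ^ ((c : ℝ) * (k * Real.logb 2 k)) * ((n : ℝ) + 1) ^ c ∧
          Ram.DecidesWithin P (Ram.colouringInput G l) t (G.Colorable l)) ∧
    (∀ (n k : ℕ) (G : SimpleGraph (Fin n)) (A : Finset (Sym2 (Fin n))) (C : Finset (Fin n)),
      (∀ e ∈ A, ¬ e.IsDiag) → A.card ≤ k → (G.addPairs A).IsChordal →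
        (G.addPairs A).IsClique (C : Set (Fin n)) →
        (G.indepPartitions C).ncard ≤ (2 * k) ^ (2 * k)) := by
  -- The exponent w depends on the program alone, so 320 ^ w + 6 * w is an absolute constant.
  obtain ⟨w, hw⟩ : ∃ w, w = (Ram.Stmt.assign 2 (.mul (.var 1) (.var 1))).wt +
    Ram.mainC.wt + 1 := ⟨_, rfl⟩
  refine ⟨⟨Ram.decideC.code 0, 320 ^ w + 6 * w, fun n G l k _ hG => ?_⟩,
    fun n k G A C _ hA _ hC => SimpleGraph.ncard_indepPartitions_le hA hC⟩
  obtain ⟨d, hdk, hdn, hd⟩ := hG.fillLE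
  have hp : (d * 4) ^ (d * 2) ≤ (k * 4) ^ (k * 2) :=
    Ram.pow_le_pow_of_imp (by omega) (by omega) (by omega)
  have h₁ : 1 ≤ (n + 1) ^ 2 := Nat.one_le_pow _ _ (by omega)
  have h₂ : 1 ≤ (k * 4) ^ (k * 2) := by
    simpa using Ram.pow_le_pow_of_imp (a := 0) (b := k * 4) (m := 0) (p := k * 2)
      (by omega) (by omega) (by omega)
  have h₃ : 20 * (n + 1) ^ 2 ≤ Ram.valueBound n k := Nat.le_mul_of_pos_right _ h₂
  have h₄ : (k * 4) ^ (k * 2) ≤ Ram.valueBound n k :=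
    Nat.le_mul_of_pos_left _ (by omega)
  have h₅ : k * 4 ≤ (k * 4) ^ (k * 2) := by
    rcases Nat.eq_zero_or_pos k with rfl | hk
    · simp
    · exact Nat.le_self_pow (by omega) _
  have h₆ : (n + 1) ^ 2 = n * n + 2 * n + 1 := by ring
  obtain ⟨t, ht, hrun⟩ := Ram.decideC_spec (l := l) (X := Ram.valueBound n k) (by omega)
    (by omega) (by omega) (hp.trans h₄) hdn hd
  rw [← hw] at ht
  refine ⟨t, (Nat.cast_le.2 ht).trans (Ram.valueBound_pow_le n k w), ?_⟩
  rwa [SimpleGraph.colIn_map_iff, SimpleGraph.colorable_sub_iff] at hrun
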